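/- Fix a constant $k\in\mathbb N$. An instance consists of a finite graph $G=(V,E)$, pairwise disjoint groups $G_1,\dots,G_k\subseteq V$, vertex weights $w\colon V\to\mathbb R$, absolute bounds $\ell_i,u_i\in\mathbb N$ for $i\in[k]$, a set $S\subseteq[k]^2$ and ratios $\alpha_{ij}\in\mathbb R_{\ge 0}$ for $(i,j)\in S$. For a matching $m$ of $G$ let $V(m)$ be the set of vertices covered by $m$, and let $M_{\mathrm{gf}}$ be the set of all matchings $m$ of $G$ such that \[ \ell_i\le |V(m)\cap G_i|\le u_i \quad (i\in[k]), \qquad |V(m)\cap G_i|\le \alpha_{ij}\,|V(m)\cap G_j| \quad ((i,j)\in S). \] Then there is an algorithm that, for every such instance, either finds a matching $m\in M_{\mathrm{gf}}$ of maximum total vertex weight $\sum_{v\in V(m)}w(v)$ or reports that $M_{\mathrm{gf}}=\emptyset$, in time polynomial in $|V|$. Here time is the number of elementary steps of a random access machine with unit-cost addition, subtraction and comparison of natural numbers and of real numbers, together with conversion of natural to real numbers and scaling of real numbers by fixed rational constants. -/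

import Mathlib

open scoped NNReal

namespace GroupFair

/-! ## Machine model

A random access machine with two kinds of memory, one for natural numbers and one for real
numbers, programmed by structured (`while`) programs. Every memory cell has an address
`a[i][j]`, where the array name `a` is fixed in the program text and the indices `i`, `j` are
computed at run time. Every elementary operation has cost one. The operations on natural numbers
are addition, truncated subtraction and comparison; those on real numbers are addition,
subtraction, scaling by a rational constant fixed in the program text, conversion from the natural
numbers, and comparison. There is no product of two computed numbers, no rounding and no
irrational program constant, so that on rational data the numbers that occur in a computation have
a bit length bounded linearly in that of the input and the number of steps. -/

/-- A memory: the contents of the cells `a[i][j]` of the two kinds. -/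
structure State where
  nat : ℕ → ℕ → ℕ → ℕ
  real : ℕ → ℕ → ℕ → ℝ

/-- Expressions with values in the natural numbers. -/
inductive NExp : Type
  | const (c : ℕ)
  | get (a : ℕ) (i j : NExp)
  | add (e f : NExp)
  | sub (e f : NExp)

/-- Expressions with values in the real numbers. -/
inductive RExp : Type
  | ofNat (e : NExp)
  | get (a : ℕ) (i j : NExp)
  | add (e f : RExp)
  | sub (e f : RExp)
  | scale (q : ℚ) (e : RExp)

/-- Tests. -/
inductive BExp : Type
  | natLe (e f : NExp)
  | realLe (e f : RExp)
  | not (b : BExp)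
  | and (b c : BExp)

/-- Programs. -/
inductive Cmd : Type
  | skip
  | setNat (a : ℕ) (i j e : NExp)
  | setReal (a : ℕ) (i j : NExp) (e : RExp)
  | seq (c d : Cmd)
  | ite (b : BExp) (c d : Cmd)
  | while (b : BExp) (c : Cmd)

/-- The value of an expression in a memory. -/
def NExp.eval (s : State) : NExp → ℕ
  | const c => c
  | get a i j => s.nat a (i.eval s) (j.eval s)
  | add e f => e.eval s + f.eval s
  | sub e f => e.eval s - f.eval s

/-- The number of elementary operations in the evaluation of an expression. -/
def NExp.cost : NExp → ℕ
  | const _ => 1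
  | get _ i j => i.cost + j.cost + 1
  | add e f => e.cost + f.cost + 1
  | sub e f => e.cost + f.cost + 1

/-- The value of an expression in a memory. -/
noncomputable def RExp.eval (s : State) : RExp → ℝ
  | ofNat e => (e.eval s : ℝ)
  | get a i j => s.real a (i.eval s) (j.eval s)
  | add e f => e.eval s + f.eval s
  | sub e f => e.eval s - f.eval s
  | scale q e => (q : ℝ) * e.eval s

/-- The number of elementary operations in the evaluation of an expression. -/
def RExp.cost : RExp → ℕ
  | ofNat e => e.cost + 1
  | get _ i j => i.cost + j.cost + 1
  | add e f => e.cost + f.cost + 1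
  | sub e f => e.cost + f.cost + 1
  | scale _ e => e.cost + 1

/-- The test succeeds in a memory. -/
def BExp.Holds (s : State) : BExp → Prop
  | natLe e f => e.eval s ≤ f.eval s
  | realLe e f => e.eval s ≤ f.eval s
  | not b => ¬ b.Holds s
  | and b c => b.Holds s ∧ c.Holds s

/-- The number of elementary operations in the evaluation of a test. -/
def BExp.cost : BExp → ℕ
  | natLe e f => e.cost + f.cost + 1
  | realLe e f => e.cost + f.cost + 1
  | not b => b.cost + 1
  | and b c => b.cost + c.cost + 1

/-- Overwrite the cell `a[i][j]` of the natural-number memory. -/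
def State.setNat (s : State) (a i j x : ℕ) : State where
  nat a' i' j' := if a' = a ∧ i' = i ∧ j' = j then x else s.nat a' i' j'
  real := s.real

/-- Overwrite the cell `a[i][j]` of the real-number memory. -/
def State.setReal (s : State) (a i j : ℕ) (x : ℝ) : State where
  nat := s.nat
  real a' i' j' := if a' = a ∧ i' = i ∧ j' = j then x else s.real a' i' j'

/-- `Exec c s t s'`: the program `c`, started in the memory `s`, halts after exactly `t`
elementary steps with the memory `s'`. -/
inductive Exec : Cmd → State → ℕ → State → Prop
  | skip (s : State) : Exec .skip s 1 s
  | setNat (a : ℕ) (i j e : NExp) (s : State) :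
      Exec (.setNat a i j e) s (i.cost + j.cost + e.cost + 1)
        (s.setNat a (i.eval s) (j.eval s) (e.eval s))
  | setReal (a : ℕ) (i j : NExp) (e : RExp) (s : State) :
      Exec (.setReal a i j e) s (i.cost + j.cost + e.cost + 1)
        (s.setReal a (i.eval s) (j.eval s) (e.eval s))
  | seq {c d : Cmd} {s s' s'' : State} {t t' : ℕ} :
      Exec c s t s' → Exec d s' t' s'' → Exec (.seq c d) s (t + t') s''
  | iteTrue {b : BExp} {c d : Cmd} {s s' : State} {t : ℕ} :
      b.Holds s → Exec c s t s' → Exec (.ite b c d) s (b.cost + 1 + t) s'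
  | iteFalse {b : BExp} {c d : Cmd} {s s' : State} {t : ℕ} :
      ¬ b.Holds s → Exec d s t s' → Exec (.ite b c d) s (b.cost + 1 + t) s'
  | whileTrue {b : BExp} {c : Cmd} {s s' s'' : State} {t t' : ℕ} :
      b.Holds s → Exec c s t s' → Exec (.while b c) s' t' s'' →
        Exec (.while b c) s (b.cost + 1 + t + t') s''
  | whileFalse {b : BExp} {c : Cmd} {s : State} :
      ¬ b.Holds s → Exec (.while b c) s (b.cost + 1) s

/-- Programs are deterministic: the running time and the final memory are unique. -/
theorem Exec.unique {c : Cmd} {s s₁ s₂ : State} {t₁ t₂ : ℕ}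
    (h₁ : Exec c s t₁ s₁) (h₂ : Exec c s t₂ s₂) : t₁ = t₂ ∧ s₁ = s₂ := by
  induction h₁ generalizing t₂ s₂ with
  | skip => cases h₂; exact ⟨rfl, rfl⟩
  | setNat => cases h₂; exact ⟨rfl, rfl⟩
  | setReal => cases h₂; exact ⟨rfl, rfl⟩
  | seq _ _ ih ih' =>
    cases h₂ with
    | seq k k' =>
      obtain ⟨rfl, rfl⟩ := ih k
      obtain ⟨rfl, rfl⟩ := ih' k'
      exact ⟨rfl, rfl⟩
  | iteTrue hb _ ih =>
    cases h₂ with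
    | iteTrue _ k => obtain ⟨rfl, rfl⟩ := ih k; exact ⟨rfl, rfl⟩
    | iteFalse nb _ => exact absurd hb nb
  | iteFalse hb _ ih =>
    cases h₂ with
    | iteTrue nb _ => exact absurd nb hb
    | iteFalse _ k => obtain ⟨rfl, rfl⟩ := ih k; exact ⟨rfl, rfl⟩
  | whileTrue hb _ _ ih ih' =>
    cases h₂ with
    | whileTrue _ k k' =>
      obtain ⟨rfl, rfl⟩ := ih k
      obtain ⟨rfl, rfl⟩ := ih' k'
      exact ⟨rfl, rfl⟩
    | whileFalse nb => exact absurd hb nb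
  | whileFalse hb =>
    cases h₂ with
    | whileTrue nb _ _ => exact absurd nb hb
    | whileFalse _ => exact ⟨rfl, rfl⟩

/-! ## Group-fair matchings for vertices -/

/-- An instance with `k` groups and `n` vertices. -/
structure Input (k n : ℕ) where
  /-- the graph -/
  graph : SimpleGraph (Fin n)
  /-- the groups of vertices -/
  group : Fin k → Finset (Fin n)
  group_disjoint : ∀ i j, i ≠ j → Disjoint (group i) (group j)
  /-- the vertex weights -/
  weight : Fin n → ℝ
  /-- the lower bounds of the absolute constraints -/
  lower : Fin k → ℕ
  /-- the upper bounds of the absolute constraints -/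
  upper : Fin k → ℕ
  /-- the pairs of groups that have a relative constraint -/
  pairs : Finset (Fin k × Fin k)
  /-- the ratios of the relative constraints; only those of the pairs in `pairs` matter -/
  ratio : Fin k → Fin k → ℝ≥0

namespace Input

variable {k n : ℕ} (I : Input k n)

/-- The number of vertices of the `i`-th group that are covered by the matching `M`. -/
noncomputable def covered (M : I.graph.Subgraph) (i : Fin k) : ℕ :=
  (M.verts ∩ (I.group i : Set (Fin n))).ncard

/-- `M` is a matching that satisfies the absolute and the relative constraints. -/
def IsGroupFair (M : I.graph.Subgraph) : Prop :=
  M.IsMatching ∧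
  (∀ i, I.lower i ≤ I.covered M i ∧ I.covered M i ≤ I.upper i) ∧
  ∀ i j, (i, j) ∈ I.pairs → (I.covered M i : ℝ) ≤ I.ratio i j * I.covered M j

/-- The total weight of the vertices covered by `M`. -/
noncomputable def totalWeight (M : I.graph.Subgraph) : ℝ :=
  ∑ v, M.verts.indicator I.weight v

/-- `M` is a group-fair matching of maximum total vertex weight. -/
def IsOptimal (M : I.graph.Subgraph) : Prop :=
  I.IsGroupFair M ∧ ∀ M', I.IsGroupFair M' → I.totalWeight M' ≤ I.totalWeight M

open Classical in
/-- The initial memory. Natural numbers: `0[0][0]` is the number of vertices, array `1` the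
adjacency matrix, array `2` the incidence matrix of groups and vertices, arrays `3` and `4` the
lower and upper bounds, array `5` the indicator matrix of `pairs`. Real numbers: array `0` the
vertex weights, array `1` the ratios of the pairs in `pairs`. All other cells are zero. -/
noncomputable def initial : State where
  nat a i j :=
    match a with
    | 0 => if i = 0 ∧ j = 0 then n else 0
    | 1 => if ∃ u v : Fin n, u.val = i ∧ v.val = j ∧ I.graph.Adj u v then 1 else 0
    | 2 => if ∃ (g : Fin k) (v : Fin n), g.val = i ∧ v.val = j ∧ v ∈ I.group g then 1 else 0
    | 3 => if h : i < k ∧ j = 0 then I.lower ⟨i, h.1⟩ else 0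
    | 4 => if h : i < k ∧ j = 0 then I.upper ⟨i, h.1⟩ else 0
    | 5 => if ∃ p ∈ I.pairs, p.1.val = i ∧ p.2.val = j then 1 else 0
    | _ => 0
  real a i j :=
    match a with
    | 0 => if h : i < n ∧ j = 0 then I.weight ⟨i, h.1⟩ else 0
    | 1 => if h : ∃ (hi : i < k) (hj : j < k), (⟨i, hi⟩, ⟨j, hj⟩) ∈ I.pairs then
        (I.ratio ⟨i, h.1⟩ ⟨j, h.2.1⟩ : ℝ) else 0
    | _ => 0

open Classical in
/-- The final memory `s` answers the instance correctly: either the cell `6[0][0]` is `0` and no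
group-fair matching exists, or it is `1` and array `7` is the adjacency matrix of a group-fair
matching of maximum total vertex weight. -/
def Answers (s : State) : Prop :=
  (s.nat 6 0 0 = 0 ∧ ∀ M, ¬ I.IsGroupFair M) ∨
  (s.nat 6 0 0 = 1 ∧ ∃ M, I.IsOptimal M ∧
    ∀ u v : Fin n, s.nat 7 u v = if M.Adj u v then 1 else 0)

end Input

end GroupFair

/-! The weight and the constraints depend only on the set of covered vertices. Call a set feasible
if some matching covers exactly this set, and put the vertices into `k + 1` classes, the groups and
the remainder. Fairness is a property of the class counts, of which there are at most `(n + 1) ^ (k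
+ 1)` vectors. It therefore suffices to tabulate a heaviest feasible set for every realizable vector
and to choose the best fair entry.

The table grows with the cardinality of the sets. Deleting a matching edge turns a feasible set `Y`
into a feasible set `Y₀` with two vertices fewer, whose class counts differ by at most two in each
class. Let `F` be the tabulated optimum with the counts of `Y₀`. By `exists_exchange_bound` there is
a feasible `F'` with the counts of `Y`, at least the weight of `Y`, and a symmetric difference with
`F` of size at most a constant `C` that depends only on `k`. Hence it is enough to test the
polynomially many sets that arise from table entries by at most `C` exchanges.

The reason for the bound: the union of matchings for `F` and `F'` consists of paths and cycles, and
a vertex in exactly one of the two sets is an end of a path. So the symmetric difference splits into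
parts with at most two vertices that can be exchanged independently (`exists_exchange_setoid`). Each
exchange changes the class counts by a vector with entries in `[-2, 2]`, and so does the total of
all exchanges. By Dickson's lemma (`exists_bound_of_sum`), more than a constant number of such
vectors have a proper subfamily with the same total, so that the other exchanges have total zero.
Performing these others on `F` preserves the counts and, as `F` is optimal, does not increase the
weight. Undoing them in `F'` then does not decrease the weight, preserves the counts and moves `F'`
closer to `F`. A closest `F'` thus has bounded distance.

Whether a set is feasible is decided by Edmonds' blossom algorithm on the induced subgraph. The
alternating forest is a preorder whose classes are the blossoms, and every outer vertex `v` carries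
an explicit matching `N v` that leaves `v` uncovered in place of the root. This avoids contracted
graphs and path tracing: growing, shrinking and augmenting only splice these matchings. When the
search is stuck, a parity count (`Forest.barrier`) shows that no matching covers the root together
with the vertices covered so far.

All programs are built from counting loops whose bounds are fixed before the loops start, so the
running time is a polynomial in the loop bounds (`Prog.exec`), and these are polynomials in `n`. -/

namespace GroupFair

/-! ## Matchings as involutions and alternating forests -/

/-- A matching of the graph `G`, given as an involution that fixes the uncovered vertices. -/
structure IsMate {V : Type*} (G : V → V → Prop) (σ : V → V) : Prop where
  invol : ∀ z, σ (σ z) = z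
  adj : ∀ z, σ z ≠ z → G z (σ z)

/-- The data of Edmonds' search for an augmenting path of the matching `M` from the uncovered
vertex `r`. `T z y` says that `y` is below `z` in the forest, where vertices of the same
blossom are below each other; `O` is the set of outer vertices; the labelled vertices `z` are
those with `T z z`. For an outer vertex `v`, the matching `N v` covers `r` and the vertices covered
by `M`, except for `v`. -/
structure Forest {V : Type*} (G : V → V → Prop) (M : V → V) (r : V) (O : V → Prop)
    (T : V → V → Prop) (N : V → V → V) : Prop where
  root : O r
  lab_left : ∀ {z y}, T z y → T z z
  lab_right : ∀ {z y}, T z y → T y y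
  outer_lab : ∀ {z}, O z → T z z
  trans : ∀ {z y x}, T z y → T y x → T z x
  chain : ∀ {z x y}, T z x → T z y → T x y ∨ T y x
  root_le : ∀ {z}, T z z → T z r
  -- The classes of the preorder `T` on the labelled vertices are the blossoms; inner vertices have
  -- not been shrunk into any.
  single : ∀ {a y}, ¬ O a → T a y → T y a → y = a
  mate_lab : ∀ {z}, T z z → T (M z) (M z)
  mate_inner : ∀ {a}, T a a → ¬ O a → O (M a) ∧ T (M a) a
  mate_fix : ∀ {z}, T z z → M z = z → z = r
  closed : ∀ {v z}, O v → T v z → T v (M z)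
  -- The mate of a base other than the root is the only way down: below the base lie its own blossom
  -- and what is below the mate.
  cover : ∀ {z y}, O z → ¬ O (M z) → T z y → T (M z) y ∨ T y z
  -- The base of a blossom is recognized by its mate, which is inner, or by being the root. All
  -- other vertices of the blossom are matched within it.
  base_unique : ∀ {y z}, O y → O z → T y z → T z y → (y = r ∨ ¬ O (M y)) →
    (z = r ∨ ¬ O (M z)) → y = z
  base_exists : ∀ {z}, O z → ∃ b, O b ∧ T z b ∧ T b z ∧ (b = r ∨ ¬ O (M b))
  near_mate : ∀ {v}, O v → IsMate G (N v)
  near_fix : ∀ {v z}, O v → (N v z = z ↔ z = v ∨ (M z = z ∧ z ≠ r))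
  near_out : ∀ {v z}, O v → ¬ T v z → N v z = M z
  -- An inner vertex cuts its branch: `N v` matches no vertex strictly above `a`, apart from `v`,
  -- across the cut. This is what permits cutting two of these matchings at `a` and splicing them.
  near_in : ∀ {v a z}, O v → ¬ O a → T v a → T v z → ¬ T a z → z ≠ v → ¬ T a (N v z)

namespace Forest

variable {V : Type*} {G : V → V → Prop} {M : V → V} {r : V} {O : V → Prop}
  {T : V → V → Prop} {N : V → V → V}

/-- The forest that consists of the root. -/
theorem init (hM : IsMate G M) (hr : M r = r) :
    Forest G M r (fun z => z = r) (fun z y => z = r ∧ y = r) (fun _ => M) where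
  root := rfl
  lab_left := by grind
  lab_right := by grind
  outer_lab := by grind
  trans := by grind
  chain := by grind
  root_le := by grind
  single := by grind
  mate_lab := by grind
  mate_inner := by grind
  mate_fix := by grind
  closed := by grind
  cover := by grind
  base_unique := by grind
  base_exists := by grind
  near_mate := fun _ => hM
  near_fix := by grind
  near_out := by grind
  near_in := by grind

open Classical in
/-- Extend the forest by the edge `v u` and the matching edge of `u`. -/
theorem grow (hF : Forest G M r O T N) (hM : IsMate G M) (hG : ∀ x y, G x y → G y x)
    {v u : V} (hv : O v) (hvu : G v u) (hu : ¬ T u u) (hMu : M u ≠ u) :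
    Forest G M r (fun z => z = M u ∨ O z)
      (fun z y => if z = u then y = u ∨ T v y else if z = M u then y = u ∨ y = M u ∨ T v y
        else T z y)
      (fun x z => if x = M u then (if z = v then u else if z = u then v else if z = M u then M u
        else N v z) else N x z) := by
  have hw : ¬ T (M u) (M u) := fun h => hu (by simpa [hM.invol] using hF.mate_lab h)
  have hMMu := hM.invol u
  have hvv := hF.outer_lab hv
  have hinv := hM.invol
  have key1 : ∀ z y, T z y → z ≠ u ∧ z ≠ M u ∧ y ≠ u ∧ y ≠ M u := by
    intro z y h
    have h1 := hF.lab_left h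
    have h2 := hF.lab_right h
    grind
  have key2 : ∀ z, O z → z ≠ u ∧ z ≠ M u := fun z h => by
    have := hF.outer_lab h
    grind
  have hN := hF.near_mate hv
  -- Both `u` and `M u` lie off the branch of `v`, so `N v` contains their matching edge. Trading
  -- this edge for `v u` covers `v` and uncovers `M u`.
  have hNu : N v u = M u := hF.near_out hv (by grind)
  have hNw : N v (M u) = u := by rw [hF.near_out hv (by grind), hMMu]
  have hNv : N v v = v := (hF.near_fix hv).2 (Or.inl rfl)
  have hNinj : ∀ y z, N v y = z → N v z = y := fun y z h => by rw [← h, hN.invol]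
  constructor
  case root => exact Or.inr hF.root
  case lab_left => grind [hF.lab_left]
  case lab_right => grind [hF.lab_right]
  case outer_lab => grind [hF.outer_lab]
  case trans => grind [hF.trans]
  case chain => grind [hF.chain, hF.lab_right]
  case root_le => grind [hF.root_le]
  case single => grind [hF.single]
  case mate_lab => grind [hF.mate_lab]
  case mate_inner => grind [hF.mate_inner]
  case mate_fix => grind [hF.mate_fix]
  case closed => grind [hF.closed]
  case cover => grind [hF.cover, hF.mate_lab, hF.outer_lab]
  case base_unique => grind [hF.base_unique]
  case base_exists =>
    intro z hz
    by_cases hzw : z = M u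
    · exact ⟨z, by grind⟩
    · obtain ⟨b, hb⟩ := hF.base_exists (hz.resolve_left hzw)
      have := hF.mate_lab (hF.outer_lab hb.1)
      exact ⟨b, by grind⟩
  case near_mate =>
    intro x hx
    by_cases hxw : x = M u
    · have hG' := hG _ _ hvu
      refine ⟨fun z => ?_, fun z => ?_⟩
      · have := hN.invol z
        simp only [hxw, if_true]
        grind
      · have := hN.adj z
        simp only [hxw, if_true]
        grind
    · simpa [hxw] using hF.near_mate (hx.resolve_left hxw)
  case near_fix =>
    have h1 := hF.outer_lab hF.root
    have h2 := hF.mate_fix hvv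
    grind [hF.near_fix]
  case near_out => grind [hF.near_out]
  case near_in => grind [hF.near_in, hF.single]

/-- The last common vertex of two outer vertices. -/
theorem exists_meet [Finite V] (hF : Forest G M r O T N) {u v : V} (hu : O u) (hv : O v) :
    ∃ c, O c ∧ T u c ∧ T v c ∧ ∀ z, T u z → T v z → T c z := by
  classical
  obtain ⟨_⟩ := nonempty_fintype V
  let S : Finset V := Finset.univ.filter fun z => T u z ∧ T v z
  have hrS : r ∈ S := by
    simp [S, hF.root_le (hF.outer_lab hu), hF.root_le (hF.outer_lab hv)]
  -- The common vertices lie on one branch, hence form a chain; the highest of them has the most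
  -- common vertices below it.
  obtain ⟨c, hcS, hc⟩ := S.exists_max_image (fun z => (S.filter fun y => T z y).card) ⟨r, hrS⟩
  have hcS' : T u c ∧ T v c := by simpa [S] using hcS
  have hmax : ∀ z, T u z → T v z → T c z := by
    intro z hz1 hz2
    by_contra hcz
    have hzc : T z c := (hF.chain hcS'.1 hz1).resolve_left hcz
    have hlt : (S.filter fun y => T c y) ⊂ (S.filter fun y => T z y) := by
      refine Finset.ssubset_iff_of_subset (fun y hy => ?_) |>.2 ⟨z, ?_, ?_⟩
      · simp only [Finset.mem_filter] at hy ⊢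
        exact ⟨hy.1, hF.trans hzc hy.2⟩
      · simp [S, hz1, hz2, hF.lab_left hzc]
      · simp [hcz]
    exact absurd (Finset.card_lt_card hlt) (not_lt.2 (hc z (by simp [S, hz1, hz2])))
  refine ⟨c, ?_, hcS'.1, hcS'.2, hmax⟩
  -- The mate of an inner meeting point would be a common vertex above it.
  by_contra hOc
  obtain ⟨h1, h2⟩ := hF.mate_inner (hF.lab_right hcS'.1) hOc
  have h3 := hmax _ (hF.closed hu hcS'.1) (hF.closed hv hcS'.2)
  exact hOc (hF.single hOc h3 h2 ▸ h1)

/-- The part of a branch above an inner vertex is closed under the matching. -/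
theorem mate_above (hF : Forest G M r O T N) (hM : IsMate G M) {u a z : V}
    (ha : ¬ O a) (hua : T u a) (hz : T u z) (haz : ¬ T a z) (hne : M z ≠ a) : ¬ T a (M z) := by
  intro h
  have h1 := hM.invol z
  by_cases hy : O (M z)
  · have h2 := hF.closed hy (hF.outer_lab hy)
    rw [h1] at h2
    exact haz (hF.trans h h2)
  · obtain ⟨h2, h3⟩ := hF.mate_inner (hF.lab_right h) hy
    rw [h1] at h2 h3
    rcases hF.chain hua hz with h4 | h4
    · exact haz h4
    · rcases hF.cover h2 hy h4 with h5 | h5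
      · exact hne (hF.single ha h h5)
      · exact haz h5

open Classical in
/-- The matching that leaves the inner vertex `a` of a new blossom uncovered: it passes through the
edge `v u` and follows the branch of `u` down to `a`. -/
noncomputable def blossomMate (T : V → V → Prop) (N : V → V → V) (v u a z : V) : V :=
  if z = u then v else if z = v then u else if z = a then a
  else if T u z ∧ ¬ T a z then N u z else N v z

/-- Let `R` be the part of the branch of `u` strictly above `a`. By `near_in`, `N u` preserves `R`
without `u`. As `R` misses the branch of `v`, a vertex of `R` matched by `N v` is matched as in `M`,
and `mate_above` shows that `M` leaves `R` only through the edge from `M a` to `a`. So `N u` on `R`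
and `N v` outside fit together: `a` becomes uncovered, and the edge `v u` joins the vertices left
uncovered by the two pieces. -/
theorem blossomMate_spec (hF : Forest G M r O T N) (hM : IsMate G M)
    (hG : ∀ x y, G x y → G y x) {v u c a : V} (hv : O v) (hu : O u) (hvu : G v u)
    (hcu : T u c) (hcv : T v c) (hc : ∀ z, T u z → T v z → T c z) (hlab : T a a) (ha : ¬ O a)
    (hua : T u a) (hva : ¬ T v a) :
    IsMate G (blossomMate T N v u a) ∧
    (∀ z, blossomMate T N v u a z = z ↔ z = a ∨ (M z = z ∧ z ≠ r)) ∧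
    (∀ z, ¬ T u z → ¬ T v z → blossomMate T N v u a z = M z) ∧
    (∀ a' z, ¬ O a' → T u a' → T v a' → (T u z ∨ T v z) → ¬ T a' z → z ≠ a →
      ¬ T a' (blossomMate T N v u a z)) := by
  have hca : T a c := (hF.chain hcu hua).resolve_left fun h => hva (hF.trans hcv h)
  have huu := hF.outer_lab hu
  have hvv := hF.outer_lab hv
  have hau : ¬ T a u := fun h => ha (hF.single ha h hua ▸ hu)
  have hne : u ≠ a := fun h => ha (h ▸ hu)
  have hnev : v ≠ a := fun h => ha (h ▸ hv)
  have hnuv : u ≠ v := fun h => hva (h ▸ hua)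
  have hdisj : ∀ z, T u z → ¬ T a z → ¬ T v z := fun z h1 h2 h3 =>
    h2 (hF.trans hca (hc z h1 h3))
  obtain ⟨hMa, hMaa⟩ := hF.mate_inner hlab ha
  have huMa := hF.closed hu hua
  have hMa' : ¬ T a (M a) := fun h => ha (hF.single ha h hMaa ▸ hMa)
  have hRM : ∀ z, T u z → ¬ T a z → T u (M z) ∧ (M z = a ∨ ¬ T a (M z)) := fun z h1 h2 =>
    ⟨hF.closed hu h1, or_iff_not_imp_left.2 (hF.mate_above hM ha hua h1 h2)⟩
  have hNv := hF.near_mate hv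
  have hNu := hF.near_mate hu
  have hinv := hM.invol
  have hinvu := hNu.invol
  have hinvv := hNv.invol
  have huv : ¬ T v u := hdisj u huu hau
  have hav : ¬ (T u v ∧ ¬ T a v) := fun h => hdisj v h.1 h.2 hvv
  have hNuu : N u u = u := (hF.near_fix hu).2 (Or.inl rfl)
  have hNvv : N v v = v := (hF.near_fix hv).2 (Or.inl rfl)
  have hRN : ∀ z, T u z → ¬ T a z → z ≠ u → T u (N u z) ∧ ¬ T a (N u z) ∧ N u z ≠ u := by
    intro z h1 h2 h3
    refine ⟨?_, hF.near_in hu ha hua h1 h2 h3, fun h => h3 ?_⟩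
    · by_contra h4
      have h5 := hF.near_out hu h4
      rw [hinvu] at h5
      exact h4 (by have := hF.closed hu h1; rwa [h5, hinv] at this)
    · rw [← hinvu z, h, hNuu]
  have hCN : ∀ z, ¬ (T u z ∧ ¬ T a z) → z ≠ a → z ≠ v →
      ¬ (T u (N v z) ∧ ¬ T a (N v z)) ∧ N v z ≠ a ∧ N v z ≠ v := by
    intro z h1 h2 h3
    have h4 : ∀ y, ¬ T v y → N v z = y → z = M y := fun y h5 h6 => by
      rw [← hF.near_out hv h5, ← h6, hinvv]
    refine ⟨fun h => ?_, fun h => ?_, fun h => h3 ?_⟩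
    · have h5 := h4 _ (hdisj _ h.1 h.2) rfl
      have := hRM _ h.1 h.2
      grind
    · have h5 := h4 _ hva h
      grind
    · rw [← hinvv z, h, hNvv]
  have hru : T a r := hF.root_le hlab
  refine ⟨⟨fun z => ?_, fun z => ?_⟩, fun z => ?_, fun z h1 h2 => ?_, ?_⟩
  · unfold blossomMate
    have := hRN z
    have := hCN z
    grind
  · unfold blossomMate
    have := hNv.adj z
    have := hNu.adj z
    have := hG _ _ hvu
    grind
  · unfold blossomMate
    have h1 := hF.near_fix (z := z) hu
    have h2 := hF.near_fix (z := z) hv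
    have h3 := hF.mate_fix huu
    have h4 := hF.mate_fix hvv
    have h6 := hF.mate_fix hlab
    grind
  · unfold blossomMate
    have := hF.near_out hv h2
    grind
  · intro a' z h1 h2 h3 h4 h5 h6
    have e1 : ¬ T a' v := fun h => h1 (hF.single h1 h h3 ▸ hv)
    have e2 : ¬ T a' u := fun h => h1 (hF.single h1 h h2 ▸ hu)
    have e3 := hF.near_in (z := z) hu h1 h2
    have e4 := hF.near_in (z := z) hv h1 h3
    have e5 : ¬ T v z → T a' (M z) → False := fun e6 e7 =>
      e6 (by have := hF.closed hv (hF.trans h3 e7); rwa [hinv] at this)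
    have e6 := hF.near_out (z := z) hv
    unfold blossomMate
    grind

open Classical in
/-- Shrink the blossom that the edge `v u` closes. -/
theorem blossom [Finite V] (hF : Forest G M r O T N) (hM : IsMate G M) (hG : ∀ x y, G x y → G y x)
    {v u : V} (hv : O v) (hu : O u) (hvu : G v u) :
    Forest G M r (fun z => O z ∨ ((T u z ∨ T v z) ∧ ¬ (T u z ∧ T v z)))
      (fun z y => T z y ∨ (T z z ∧ (∀ x, T u x → T v x → T z x) ∧ (T u y ∨ T v y)))
      (fun a => if O a then N a else if T u a then blossomMate T N v u a
        else blossomMate T N u v a) := by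
  obtain ⟨c, hOc, hcu, hcv, hc⟩ := hF.exists_meet hu hv
  have hcc := hF.outer_lab hOc
  -- Everything common to the two branches lies below the meeting point `c`, so having all common
  -- vertices below means being above `c`.
  have hcz : ∀ z, (T z z ∧ ∀ x, T u x → T v x → T z x) ↔ T z c := fun z =>
    ⟨fun h => h.2 c hcu hcv, fun h => ⟨hF.lab_left h, fun x h1 h2 => hF.trans h (hc x h1 h2)⟩⟩
  simp only [← and_assoc, hcz]
  have hinv := hM.invol
  have huu := hF.outer_lab hu
  have hvv := hF.outer_lab hv
  have hc' : ∀ z, T v z → T u z → T c z := fun z h1 h2 => hc z h2 h1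
  have hup : ∀ {z}, T u z → ¬ T v z → T z c := fun {z} h1 h2 =>
    (hF.chain h1 hcu).resolve_right fun h => h2 (hF.trans hcv h)
  have hvp : ∀ {z}, T v z → ¬ T u z → T z c := fun {z} h1 h2 =>
    (hF.chain h1 hcv).resolve_right fun h => h2 (hF.trans hcu h)
  constructor
  case root => exact Or.inl hF.root
  case lab_left => grind [hF.lab_left]
  case lab_right => grind [hF.lab_right]
  case outer_lab => grind [hF.outer_lab, hF.lab_right]
  case trans => grind [hF.trans]
  case chain =>
    have h1 : ∀ {y}, T u y → T y c ∨ T c y := fun h => hF.chain h hcu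
    have h2 : ∀ {y}, T v y → T y c ∨ T c y := fun h => hF.chain h hcv
    have h3 : ∀ {z y}, T z c → T z y → T y c ∨ T c y := fun h h' => hF.chain h' h
    have h4 : ∀ {y}, T c y → T u y ∧ T v y := fun h => ⟨hF.trans hcu h, hF.trans hcv h⟩
    intro z x y hx hy
    rcases hx with hx | ⟨hz, hx⟩ <;> rcases hy with hy | ⟨hz', hy⟩
    · have := hF.chain hx hy
      grind
    · have := h3 hz' hx
      have := @hF.chain u x y
      have := @hF.chain v x y
      grind
    · have := h3 hz hy
      have := @hF.chain u x y
      have := @hF.chain v x y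
      grind
    · have := @hF.chain u x y
      have := @hF.chain v x y
      have := @h1 x
      have := @h2 x
      grind
  case root_le => grind [hF.root_le, hF.lab_right]
  case single =>
    intro a y ha h1 h2
    have h3 := @hF.single a y
    have h4 : T c a → ¬ T a c := fun h h' => ha (Or.inl (hF.single (by grind) h' h ▸ hOc))
    have h5 := @hF.trans y a c
    have h6 := @hF.trans u y a
    have h7 := @hF.trans v y a
    have h8 := hc a
    have h9 := @hF.trans a y c
    grind
  case mate_lab => grind [hF.mate_lab, hF.lab_right]
  case mate_inner => grind [hF.mate_inner, hF.lab_right]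
  case mate_fix => grind [hF.mate_fix, hF.lab_right]
  case closed =>
    intro w z hw hz
    have h1 := @hF.closed u z hu
    have h2 := @hF.closed v z hv
    have h3 := @hF.closed w z
    have h4 := @hF.trans u w z
    have h5 := @hF.trans v w z
    have h6 := @hup w
    have h7 := @hvp w
    grind
  case cover =>
    intro z y hz ha hy
    have hMz : T (M z) (M z) := hF.mate_lab (by grind [hF.outer_lab, hF.lab_right])
    have hOz : O z := by
      by_contra h
      have := hF.mate_inner (a := z) (by grind [hF.outer_lab, hF.lab_right]) h
      grind
    have h1 := @hF.cover z y hOz (by grind)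
    have h2 := @hF.cover z c hOz (by grind)
    have h3 := @hF.trans y c z
    have h4 := @hF.trans z c y
    have h5 := @hF.chain u y c
    have h6 := @hF.chain v y c
    grind
  case base_unique =>
    -- A base of the new forest was a base before. If it lies in the new blossom, it belongs to the
    -- old blossom of `c`: strictly above `c` the mate of a base has just become outer.
    have key : ∀ {y}, (O y ∨ (T u y ∨ T v y) ∧ ¬ (T u y ∧ T v y)) →
        (y = r ∨ ¬ (O (M y) ∨ (T u (M y) ∨ T v (M y)) ∧ ¬ (T u (M y) ∧ T v (M y)))) →
        O y ∧ (y = r ∨ ¬ O (M y)) ∧ (T y c → (T u y ∨ T v y) → T c y) := by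
      intro y hy h
      have hyy : T y y := by grind [hF.outer_lab, hF.lab_right]
      have h1 := @hF.mate_inner y hyy
      have hOy : O y := by
        by_contra h
        have := hF.root
        grind
      refine ⟨hOy, by grind, fun h2 h3 => ?_⟩
      rcases h with rfl | h
      · exact hF.root_le hcc
      · have h4 := hF.mate_lab hyy
        have h5 := @hF.closed u y hu
        have h6 := @hF.closed v y hv
        have h7 : T c (M y) → T c y := fun h8 => by
          have := hF.closed hOc h8
          rwa [hinv] at this
        have h8 := hc (M y)
        grind
    intro y z hy hz h1 h2 h3 h4
    obtain ⟨a1, a2, a3⟩ := key hy h3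
    obtain ⟨b1, b2, b3⟩ := key hz h4
    have e1 := @hF.base_unique y z a1 b1
    have e2 := @hF.trans y c z
    have e3 := @hF.trans z c y
    have e4 := @hF.trans y z c
    have e5 := @hF.trans z y c
    have e6 := @hF.trans u y z
    have e7 := @hF.trans u z y
    have e8 := @hF.trans v y z
    have e9 := @hF.trans v z y
    grind
  case base_exists =>
    obtain ⟨b, hb, hcb, hbc, hbb⟩ := hF.base_exists hOc
    have hub := hF.trans hcu hcb
    have hvb := hF.trans hcv hcb
    have hb1 := hF.closed hu hub
    have hb2 := hF.closed hv hvb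
    intro z hz
    by_cases hK : T z c ∧ (T u z ∨ T v z)
    · exact ⟨b, by grind⟩
    · have hOz : O z := by grind
      obtain ⟨d, hd, hzd, hdz, hdd⟩ := hF.base_exists hOz
      refine ⟨d, by grind, by grind, by grind, ?_⟩
      rcases hdd with h | h
      · exact Or.inl h
      · right
        have h1 := @hF.closed u (M d) hu
        have h2 := @hF.closed v (M d) hv
        have h3 := @hup (M d)
        have h4 := @hvp (M d)
        have h5 := (hF.mate_inner (hF.mate_lab (hF.outer_lab hd)) h).2
        rw [hinv] at h1 h2 h5
        have h6 := @hF.trans d (M d) c h5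
        have h7 := @hF.trans z d c hzd
        have h8 := @hF.trans u d z
        have h9 := @hF.trans v d z
        grind
  case near_mate =>
    intro w hw
    by_cases hOw : O w
    · simpa [hOw] using hF.near_mate hOw
    · have h1 : T w w := by grind [hF.lab_right]
      by_cases h2 : T u w
      · simpa [hOw, h2] using
          (hF.blossomMate_spec hM hG hv hu hvu hcu hcv hc h1 hOw h2 (by grind)).1
      · simpa [hOw, h2] using
          (hF.blossomMate_spec hM hG hu hv (hG _ _ hvu) hcv hcu hc' h1 hOw (by grind) h2).1
  case near_fix =>
    intro w z hw
    by_cases hOw : O w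
    · simpa [hOw] using hF.near_fix hOw
    · have h1 : T w w := by grind [hF.lab_right]
      by_cases h2 : T u w
      · simpa [hOw, h2] using
          (hF.blossomMate_spec hM hG hv hu hvu hcu hcv hc h1 hOw h2 (by grind)).2.1 z
      · simpa [hOw, h2] using
          (hF.blossomMate_spec hM hG hu hv (hG _ _ hvu) hcv hcu hc' h1 hOw (by grind) h2).2.1 z
  case near_out =>
    intro w z hw hz
    by_cases hOw : O w
    · simpa [hOw] using hF.near_out hOw (by grind)
    · have h1 : T w w := by grind [hF.lab_right]
      have h3 := @hup w
      have h4 := @hvp w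
      by_cases h2 : T u w
      · simpa [hOw, h2] using
          (hF.blossomMate_spec hM hG hv hu hvu hcu hcv hc h1 hOw h2 (by grind)).2.2.1 z
            (by grind) (by grind)
      · simpa [hOw, h2] using
          (hF.blossomMate_spec hM hG hu hv (hG _ _ hvu) hcv hcu hc' h1 hOw (by grind) h2).2.2.1 z
            (by grind) (by grind)
  case near_in =>
    intro w a z hw ha hwa hwz haz hzw
    have hOa : ¬ O a := by grind
    have haa : T a a := by grind [hF.lab_right]
    have hac : T c a → ¬ T a c := fun h h' => hOa (hF.single hOa h' h ▸ hOc)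
    have hca := hc a
    by_cases hOw : O w
    · have hwa' : T w a := by
        have := @hF.trans w c a
        grind
      by_cases hwz' : T w z
      · have h1 := hF.near_in hOw hOa hwa' hwz' (by grind) hzw
        have h2 : T w (N w z) := by
          by_contra h4
          have h5 := hF.near_out hOw h4
          rw [(hF.near_mate hOw).invol] at h5
          exact h4 (by have := hF.closed hOw hwz'; rwa [h5, hinv] at this)
        have h3 := hF.chain hwa' h2
        have h4 := @hF.trans u (N w z) a
        have h5 := @hF.trans v (N w z) a
        simp only [hOw, if_true]
        grind
      · have h1 := hF.near_out hOw hwz'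
        have h2 : ¬ T a (M z) := fun h => hwz' (by
          have := hF.closed hOw (hF.trans hwa' h)
          rwa [hinv] at this)
        simp only [hOw, if_true, h1]
        grind
    · have h1 : T w w := by grind [hF.lab_right]
      have h3 := @hup w
      have h4 := @hvp w
      have h5 := @hF.trans u w a
      have h6 := @hF.trans v w a
      have hua : T u a ∧ T v a := by grind
      have h7 : ¬ T a c := hac (hca hua.1 hua.2)
      have h8 := @hF.trans u w z
      have h9 := @hF.trans v w z
      by_cases h2 : T u w
      · have := (hF.blossomMate_spec hM hG hv hu hvu hcu hcv hc h1 hOw h2 (by grind)).2.2.2 a z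
          hOa hua.1 hua.2 (by grind) (by grind) hzw
        simp only [hOw, h2, if_true, if_false]
        grind
      · have :=
          (hF.blossomMate_spec hM hG hu hv (hG _ _ hvu) hcv hcu hc' h1 hOw (by grind) h2).2.2.2 a z
          hOa hua.2 hua.1 (by grind) (by grind) hzw
        simp only [hOw, h2, if_false]
        grind

/-- Shrinking a blossom makes some inner vertex outer. -/
theorem exists_new_outer [Finite V] (hF : Forest G M r O T N) (hM : IsMate G M) {v u : V}
    (hv : O v) (hu : O u) (hne : ¬ (T u v ∧ T v u)) :
    ∃ a, ¬ O a ∧ T a a ∧ ((T u a ∨ T v a) ∧ ¬ (T u a ∧ T v a)) := by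
  obtain ⟨c, hOc, hcu, hcv, hc⟩ := hF.exists_meet hu hv
  -- The base of the blossom of `x` is strictly above `c`, hence not the root; its mate is inner and
  -- still not below `c`.
  have key : ∀ {x}, O x → T x c → ¬ T c x → ∃ a, ¬ O a ∧ T a a ∧ T x a ∧ ¬ T c a := by
    intro x hx h1 h2
    obtain ⟨b, hb, hxb, hbx, hbb⟩ := hF.base_exists hx
    have hcb : ¬ T c b := fun h => h2 (hF.trans h hbx)
    rcases hbb with rfl | h
    · exact absurd (hF.root_le (hF.outer_lab hOc)) hcb
    · refine ⟨M b, h, hF.mate_lab (hF.outer_lab hb), hF.closed hx hxb, fun h3 => hcb ?_⟩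
      have := hF.closed hOc h3
      rwa [hM.invol] at this
  by_cases h : T c u
  · have h' : ¬ T c v := fun h' => hne ⟨hF.trans hcu h', hF.trans hcv h⟩
    obtain ⟨a, ha⟩ := key hv hcv h'
    have := hc a
    exact ⟨a, by grind⟩
  · obtain ⟨a, ha⟩ := key hu hcu h
    have := hc a
    exact ⟨a, by grind⟩

/-! ### Augmentation, and the barrier when no augmentation exists -/

/-- An edge from an outer vertex to an uncovered unlabelled vertex augments the matching. -/
theorem augment [DecidableEq V] (hF : Forest G M r O T N) (hG : ∀ x y, G x y → G y x)
    {v u : V} (hv : O v) (hvu : G v u) (hu : ¬ T u u) (hMu : M u = u) :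
    IsMate G (fun z => if z = v then u else if z = u then v else N v z) ∧
      ∀ z, (if z = v then u else if z = u then v else N v z) ≠ z ↔ M z ≠ z ∨ z = r ∨ z = u := by
  have hvv := hF.outer_lab hv
  have huv : u ≠ v := fun h => hu (h ▸ hvv)
  have hur : u ≠ r := fun h => hu (h ▸ hF.outer_lab hF.root)
  -- The matching `N v` leaves both ends of the edge `v u` uncovered, so the edge can simply be
  -- added.
  have hNv : N v v = v := (hF.near_fix hv).2 (Or.inl rfl)
  have hNu : N v u = u := (hF.near_fix hv).2 (Or.inr ⟨hMu, hur⟩)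
  have hN := hF.near_mate hv
  have hfix := hF.mate_fix hvv
  refine ⟨⟨fun z => ?_, fun z => ?_⟩, fun z => ?_⟩
  · have := hN.invol z
    grind
  · have := hN.adj z
    have := hG _ _ hvu
    grind
  · have := hF.near_fix (z := z) hv
    grind

/-- A finite set with a fixed-point-free involution has even cardinality. -/
theorem _root_.GroupFair.even_card_of_involution (B : Finset V) (f : V → V)
    (hf : ∀ z ∈ B, f z ∈ B ∧ f z ≠ z ∧ f (f z) = z) : Even B.card := by
  have h := Finset.sum_involution (s := B) (f := fun _ => (1 : ZMod 2)) (fun z _ => f z)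
    (fun _ _ => by decide) (fun z hz _ => (hf z hz).2.1) (fun z hz => (hf z hz).1)
    (fun z hz => (hf z hz).2.2)
  rw [Finset.sum_const, nsmul_one] at h
  exact (ZMod.natCast_eq_zero_iff_even).1 h

/-- If the search is stuck, then no matching covers `r` and the vertices covered by `M`. -/
theorem barrier [Fintype V] (hF : Forest G M r O T N) (hM : IsMate G M) (hr : M r = r)
    (hlab : ∀ v u, O v → G v u → T u u) (hsame : ∀ v u, O v → O u → G v u → T u v ∧ T v u)
    {σ : V → V} (hσ : IsMate G σ) (hcov : ∀ z, M z ≠ z ∨ z = r → σ z ≠ z) : False := by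
  classical
  let base : Finset V := Finset.univ.filter fun b => O b ∧ (b = r ∨ ¬ O (M b))
  let inner : Finset V := Finset.univ.filter fun a => T a a ∧ ¬ O a
  have hcov' : ∀ z, T z z → σ z ≠ z := fun z h => hcov z (by
    by_cases h' : M z = z
    · exact Or.inr (hF.mate_fix h h')
    · exact Or.inl h')
  -- A blossom `B` is odd: `M` pairs its vertices apart from the base. Hence `σ`, which covers `B`,
  -- matches some vertex of `B` outside `B`; its partner is labelled, and it is inner because
  -- adjacent outer vertices share a blossom.
  have hexit : ∀ b ∈ base, ∃ z, T b z ∧ T z b ∧ O z ∧ σ z ∈ inner := by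
    intro b hb
    obtain ⟨hOb, hbb⟩ : O b ∧ (b = r ∨ ¬ O (M b)) := by simpa [base] using hb
    by_contra hno
    push Not at hno
    let B : Finset V := Finset.univ.filter fun z => T b z ∧ T z b
    have hBO : ∀ z ∈ B, T b z ∧ T z b ∧ O z := by
      intro z hz
      obtain ⟨h1, h2⟩ : T b z ∧ T z b := by simpa [B] using hz
      refine ⟨h1, h2, ?_⟩
      by_contra h3
      exact h3 (hF.single h3 h2 h1 ▸ hOb)
    have hbB : b ∈ B := by simp [B, hF.outer_lab hOb]
    have h1 : Even B.card := by
      refine even_card_of_involution B σ fun z hz => ?_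
      obtain ⟨h1, h2, h3⟩ := hBO z hz
      have h4 := hcov' z (hF.outer_lab h3)
      have h5 := hσ.adj z h4
      have h6 := hno z h1 h2 h3
      have h7 : O (σ z) := by
        by_contra h8
        exact h6 (by simp [inner, h8, hlab z _ h3 h5])
      obtain ⟨h8, h9⟩ := hsame z _ h3 h7 h5
      exact ⟨by simp [B, hF.trans h1 h9, hF.trans h8 h2], h4, hσ.invol z⟩
    have h2 : Even (B.erase b).card := by
      refine even_card_of_involution _ M fun z hz => ?_
      obtain ⟨hzb, hzB⟩ := Finset.mem_erase.1 hz
      obtain ⟨h1, h2, h3⟩ := hBO z hzB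
      have h4 : ¬ (z = r ∨ ¬ O (M z)) := fun h => hzb (hF.base_unique h3 hOb h2 h1 h hbb)
      push Not at h4
      have h5 := hF.closed h3 (hF.outer_lab h3)
      have h6 := hF.closed h4.2 (hF.outer_lab h4.2)
      rw [hM.invol] at h6
      refine ⟨Finset.mem_erase.2 ⟨fun h => ?_, ?_⟩, fun h => h4.1 (hF.mate_fix
        (hF.outer_lab h3) h), hM.invol z⟩
      · have h7 : M b = z := by rw [← h, hM.invol]
        rcases hbb with h8 | h8
        · rw [h8, hr] at h7
          exact h4.1 h7.symm
        · exact h8 (h7 ▸ h3)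
      · simp [B, hF.trans h1 h5, hF.trans h6 h2]
    rw [Finset.card_erase_of_mem hbB] at h2
    have := Finset.card_pos.2 ⟨b, hbB⟩
    rw [Nat.even_iff] at h1 h2
    omega
  choose! e he using hexit
  -- Different blossoms are disjoint, so their exits use different inner vertices.
  have hle : base.card ≤ inner.card := by
    refine Finset.card_le_card_of_injOn (fun b => σ (e b)) (fun b hb => (he b hb).2.2.2) ?_
    intro b hb b' hb' h
    have h1 : e b = e b' := by
      have := congrArg σ h
      simpa [hσ.invol] using this
    obtain ⟨a1, a2, a3, -⟩ := he b hb
    obtain ⟨c1, c2, c3, -⟩ := he b' hb'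
    simp only [base, Finset.coe_filter, Finset.mem_univ, true_and, Set.mem_ofPred_eq] at hb hb'
    rw [← h1] at c1 c2
    exact hF.base_unique hb.1 hb'.1 (hF.trans a1 c2) (hF.trans c1 a2) hb.2 hb'.2
  -- The mates of the inner vertices are distinct bases, none of them the root. This contradicts the
  -- previous count.
  have hle' : inner.card ≤ (base.erase r).card := by
    refine Finset.card_le_card_of_injOn M (fun a ha => ?_) (fun a _ a' _ h => ?_)
    · obtain ⟨h1, h2⟩ : T a a ∧ ¬ O a := by simpa [inner] using ha
      have h3 := (hF.mate_inner h1 h2).1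
      have h4 : M a ≠ r := fun h => h2 (by
        have h5 : a = r := by rw [← hM.invol a, h, hr]
        exact h5 ▸ hF.root)
      simp [base, h3, h4, hM.invol, h2]
    · have := congrArg M h
      simpa [hM.invol] using this
  have hrb : r ∈ base := by simp [base, hF.root]
  rw [Finset.card_erase_of_mem hrb] at hle'
  have := Finset.card_pos.2 ⟨r, hrb⟩
  omega

end Forest
/-! ## Exchange between vertex sets of matchings -/

/-- Three integers modulo the period of a reflection: at most two classes of fixed points. -/
theorem dvd_of_reflection {d i j : ℤ} (hi : d ∣ 2 * i ∨ d ∣ 2 * i - 1)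
    (hj : d ∣ 2 * j ∨ d ∣ 2 * j - 1) : d ∣ i ∨ d ∣ j ∨ d ∣ i - j := by
  have hodd : ∀ {l : ℤ}, d ∣ 2 * l - 1 → IsCoprime d 2 := by
    rintro l ⟨m, hm⟩
    exact ⟨-m, l, by linarith⟩
  -- For odd `d` the factor 2 can be cancelled. For even `d` only `2 * i` and `2 * j` can be
  -- divisible, so `i` and `j` are multiples of `d / 2`, and modulo `d` there are just two such
  -- classes.
  rcases hi with hi | hi
  · rcases hj with hj | hj
    · rcases Int.even_or_odd' d with ⟨e, he | he⟩
      · subst he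
        obtain ⟨a, ha⟩ := (mul_dvd_mul_iff_left (two_ne_zero)).1 hi
        obtain ⟨b, hb⟩ := (mul_dvd_mul_iff_left (two_ne_zero)).1 hj
        rcases Int.even_or_odd' a with ⟨a', h | h⟩
        · exact Or.inl ⟨a', by rw [ha, h]; ring⟩
        · rcases Int.even_or_odd' b with ⟨b', h' | h'⟩
          · exact Or.inr (Or.inl ⟨b', by rw [hb, h']; ring⟩)
          · exact Or.inr (Or.inr ⟨a' - b', by rw [ha, hb, h, h']; ring⟩)
      · have hco : IsCoprime d 2 := ⟨1, -e, by rw [he]; ring⟩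
        exact Or.inl (hco.dvd_of_dvd_mul_left hi)
    · exact Or.inl ((hodd hj).dvd_of_dvd_mul_left hi)
  · rcases hj with hj | hj
    · exact Or.inr (Or.inl ((hodd hi).dvd_of_dvd_mul_left hj))
    · refine Or.inr (Or.inr ((hodd hi).dvd_of_dvd_mul_left ?_))
      have := dvd_sub hi hj
      have e : 2 * i - 1 - (2 * j - 1) = 2 * (i - j) := by ring
      rwa [e] at this

/-! ### Fixed points of two involutions in a common orbit -/

section Orbits

variable {V : Type*} {σ τ : Equiv.Perm V}

/-- Among three points of an orbit of two involutions, each of them fixed by one of the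
involutions and the first fixed by only one, two coincide. -/
theorem orbit_fixed_points (hσ : ∀ z, σ (σ z) = z) (hτ : ∀ z, τ (τ z) = z) {x y z : V}
    (hy : y ∈ MulAction.orbit (Subgroup.closure {σ, τ}) x)
    (hz : z ∈ MulAction.orbit (Subgroup.closure {σ, τ}) x)
    (hx : σ x = x) (hy' : σ y = y ∨ τ y = y) (hz' : σ z = z ∨ τ z = z) :
    x = y ∨ x = z ∨ y = z := by
  -- The orbit of `x` consists of the points `(ρ ^ j) x`; on the exponents `σ` acts as `j ↦ -j` and
  -- `τ` as `j ↦ 1 - j`. Fixed points are the solutions of `2 * j = 0` or `2 * j = 1` modulo the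
  -- period, where period zero stands for an infinite orbit.
  set ρ : Equiv.Perm V := τ * σ with hρ
  have h1 : ∀ (i : ℤ) (w : V), σ ((ρ ^ i) w) = (ρ ^ (-i)) (σ w) := by
    have hconj : σ * ρ * σ⁻¹ = ρ⁻¹ := by
      ext w
      have e1 : σ⁻¹ w = σ w := by rw [Equiv.Perm.inv_eq_iff_eq, hσ]
      have e2 : ρ⁻¹ w = σ (τ w) := by
        rw [Equiv.Perm.inv_eq_iff_eq]; simp [hρ, hσ, hτ]
      rw [Equiv.Perm.mul_apply, Equiv.Perm.mul_apply, e1, e2, hρ, Equiv.Perm.mul_apply, hσ]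
    intro i w
    have h2 : σ * ρ ^ i * σ⁻¹ = ρ ^ (-i) := by rw [← conj_zpow, hconj, inv_zpow, zpow_neg]
    rw [← h2]
    simp
  have h2 : ∀ i : ℤ, σ ((ρ ^ i) x) = (ρ ^ (-i)) x := fun i => by rw [h1, hx]
  have h3 : ∀ i : ℤ, τ ((ρ ^ i) x) = (ρ ^ (1 - i)) x := fun i => by
    have e : τ ((ρ ^ i) x) = ρ (σ ((ρ ^ i) x)) := by simp [hρ, hσ]
    rw [e, h2, sub_eq_add_neg, zpow_add, zpow_one, Equiv.Perm.mul_apply ρ]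
  have horb : ∀ g ∈ Subgroup.closure {σ, τ}, ∀ w,
      (∃ j : ℤ, g w = (ρ ^ j) x) ↔ ∃ j : ℤ, w = (ρ ^ j) x := by
    intro g hg
    induction hg using Subgroup.closure_induction with
    | mem g hg =>
      rcases hg with rfl | rfl
      · refine fun w => ⟨fun ⟨j, hj⟩ => ⟨-j, ?_⟩, fun ⟨j, hj⟩ => ⟨-j, by rw [hj, h2]⟩⟩
        rw [← h2, ← hj, hσ]
      · refine fun w => ⟨fun ⟨j, hj⟩ => ⟨1 - j, ?_⟩, fun ⟨j, hj⟩ => ⟨1 - j, by rw [hj, h3]⟩⟩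
        rw [← h3, ← hj, hτ]
    | one => exact fun w => Iff.rfl
    | mul g h _ _ ihg ihh => exact fun w => (ihg (h w)).trans (ihh w)
    | inv g hg ih =>
      intro w
      rw [← ih]
      simp
  have hper : ∀ i : ℤ, (ρ ^ i) x = x ↔ (Function.minimalPeriod (ρ • ·) x : ℤ) ∣ i := fun i =>
    MulAction.zpow_smul_eq_iff_minimalPeriod_dvd (a := ρ) (b := x) (n := i)
  have hfix : ∀ i : ℤ, (σ ((ρ ^ i) x) = (ρ ^ i) x ∨ τ ((ρ ^ i) x) = (ρ ^ i) x) →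
      (Function.minimalPeriod (ρ • ·) x : ℤ) ∣ 2 * i ∨
      (Function.minimalPeriod (ρ • ·) x : ℤ) ∣ 2 * i - 1 := by
    intro i h
    rw [← hper, ← hper]
    rcases h with h | h
    · left
      rw [h2] at h
      rw [two_mul, zpow_add, Equiv.Perm.mul_apply, ← h, ← Equiv.Perm.mul_apply, ← zpow_add]
      simp
    · right
      rw [h3] at h
      have e : 2 * i - 1 = (i - 1) + i := by ring
      rw [e, zpow_add, Equiv.Perm.mul_apply, ← h, ← Equiv.Perm.mul_apply, ← zpow_add]
      simp
  obtain ⟨⟨g, hg⟩, rfl⟩ := hy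
  obtain ⟨⟨g', hg'⟩, rfl⟩ := hz
  obtain ⟨i, hi'⟩ := (horb g hg x).2 ⟨0, rfl⟩
  obtain ⟨j, hj'⟩ := (horb g' hg' x).2 ⟨0, rfl⟩
  change (σ (g x) = g x ∨ τ (g x) = g x) at hy'
  change (σ (g' x) = g' x ∨ τ (g' x) = g' x) at hz'
  change x = g x ∨ x = g' x ∨ g x = g' x
  rw [hi'] at hy' ⊢
  rw [hj'] at hz' ⊢
  rcases dvd_of_reflection (hfix i hy') (hfix j hz') with h | h | h
  · exact Or.inl ((hper i).2 h).symm
  · exact Or.inr (Or.inl ((hper j).2 h).symm)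
  · right; right
    have h4 := (hper _).2 h
    have e : i = j + (i - j) := by ring
    rw [e, zpow_add, Equiv.Perm.mul_apply, h4]

end Orbits

/-! ### Feasible sets and exchanges of bounded size -/

section Exchange

variable {V : Type*} [Fintype V] [DecidableEq V] {G : V → V → Prop}

/-- `F` is the set of vertices covered by some matching. -/
def Feasible (G : V → V → Prop) (F : Finset V) : Prop :=
  ∃ σ, IsMate G σ ∧ ∀ z, σ z ≠ z ↔ z ∈ F

open Classical in
/-- The set that agrees with `F'` where `p` holds and with `F` elsewhere. -/
noncomputable def mix (p : V → Prop) (F F' : Finset V) : Finset V :=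
  Finset.univ.filter fun z => if p z then z ∈ F' else z ∈ F

theorem mem_mix {p : V → Prop} {F F' : Finset V} {z : V} :
    z ∈ mix p F F' ↔ (p z ∧ z ∈ F') ∨ (¬ p z ∧ z ∈ F) := by
  by_cases h : p z <;> simp [mix, h]

/-- The symmetric difference of two feasible sets falls into pairs that can be exchanged
independently. -/
theorem exists_exchange_setoid {F F' : Finset V} (hF : Feasible G F) (hF' : Feasible G F') :
    ∃ S : Setoid V,
      (∀ p : V → Prop, (∀ x y, S x y → (p x ↔ p y)) →
        Feasible G (mix p F F') ∧ Feasible G (mix p F' F)) ∧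
      ∀ T ⊆ symmDiff F F', (∀ x ∈ T, ∀ y ∈ T, S x y) → T.card ≤ 2 := by
  classical
  obtain ⟨σ, hσ, hσF⟩ := hF
  obtain ⟨τ, hτ, hτF⟩ := hF'
  let s : Equiv.Perm V := Function.Involutive.toPerm σ hσ.invol
  let t : Equiv.Perm V := Function.Involutive.toPerm τ hτ.invol
  have hs : s ∈ Subgroup.closure {s, t} := Subgroup.subset_closure (by simp)
  have ht : t ∈ Subgroup.closure {s, t} := Subgroup.subset_closure (by simp)
  have hmix : ∀ {α β : V → V} {A B : Finset V} {p : V → Prop}, IsMate G α → IsMate G β →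
      (∀ z, α z ≠ z ↔ z ∈ A) → (∀ z, β z ≠ z ↔ z ∈ B) → (∀ z, p (α z) ↔ p z) →
      (∀ z, p (β z) ↔ p z) → Feasible G (mix p A B) := by
    intro α β A B p hα hβ hA hB hpα hpβ
    refine ⟨fun z => if p z then β z else α z, ⟨fun z => ?_, fun z => ?_⟩, fun z => ?_⟩
    · by_cases h : p z <;> simp [h, hpα, hpβ, hα.invol, hβ.invol]
    · by_cases h : p z <;> simp only [h, if_true, if_false]
      · exact hβ.adj z
      · exact hα.adj z
    · by_cases h : p z <;> simp [h, mem_mix, hA, hB]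
  -- The orbits are the components of the union of the two matchings. A vertex of the symmetric
  -- difference is fixed by exactly one of the involutions, so it is an end of a path.
  refine ⟨MulAction.orbitRel (Subgroup.closure {s, t}) V, fun p hp => ?_, fun T hT hS => ?_⟩
  · have h1 : ∀ z, p (σ z) ↔ p z := fun z => hp _ _ ⟨⟨s, hs⟩, rfl⟩
    have h2 : ∀ z, p (τ z) ↔ p z := fun z => hp _ _ ⟨⟨t, ht⟩, rfl⟩
    exact ⟨hmix hσ hτ hσF hτF h1 h2, hmix hτ hσ hτF hσF h2 h1⟩
  · by_contra hcard
    obtain ⟨x, hx, y, hy, z, hz, hxy, hxz, hyz⟩ := Finset.two_lt_card.1 (not_le.1 hcard)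
    have hfix : ∀ w ∈ T, s w = w ∨ t w = w := by
      intro w hw
      have h1 := Finset.mem_symmDiff.1 (hT hw)
      have h2 := hσF w
      have h3 := hτF w
      change σ w = w ∨ τ w = w
      tauto
    have h1 := hS y hy x hx
    have h2 := hS z hz x hx
    rw [MulAction.orbitRel_apply] at h1 h2
    rcases hfix x hx with h | h
    · rcases orbit_fixed_points hσ.invol hτ.invol h1 h2 h (hfix y hy) (hfix z hz) with e | e | e
      exacts [hxy e, hxz e, hyz e]
    · rw [Set.pair_comm] at h1 h2
      rcases orbit_fixed_points hτ.invol hσ.invol h1 h2 h (hfix y hy).symm (hfix z hz).symm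
        with e | e | e
      exacts [hxy e, hxz e, hyz e]

/-- The number of elements of `F` in the class `i`. -/
def classCount {W ι : Type*} [DecidableEq ι] (cl : W → ι) (F : Finset W) (i : ι) : ℕ :=
  (F.filter fun z => cl z = i).card

/-- The change of a sum when `F` is replaced by `F'` on `P`. -/
def change {W R : Type*} [DecidableEq W] [AddCommGroup R] (F F' P : Finset W) (g : W → R) : R :=
  ∑ z ∈ P, ((if z ∈ F' then g z else 0) - if z ∈ F then g z else 0)

/-- The two mixtures trade the same part of the vertices, so one sum gains exactly what the other
loses. -/
theorem sum_mix {R : Type*} [AddCommGroup R] (p : V → Prop) [DecidablePred p] (F F' : Finset V)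
    (g : V → R) :
    ∑ z ∈ mix p F F', g z = ∑ z ∈ F, g z + change F F' (Finset.univ.filter p) g ∧
    ∑ z ∈ mix p F' F, g z = ∑ z ∈ F', g z - change F F' (Finset.univ.filter p) g := by
  have h : ∀ A : Finset V, ∑ z ∈ A, g z = ∑ z, if z ∈ A then g z else 0 := fun A => by
    simp
  constructor
  · rw [h, h, change, Finset.sum_filter, ← Finset.sum_add_distrib]
    refine Finset.sum_congr rfl fun z _ => ?_
    by_cases hp : p z <;> simp [mem_mix, hp]
  · rw [h, h, change, Finset.sum_filter, ← Finset.sum_sub_distrib]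
    refine Finset.sum_congr rfl fun z _ => ?_
    by_cases hp : p z <;> simp [mem_mix, hp]

/-- A family of vectors from a finite set with a bounded sum is small or has a proper subfamily
with the same sum. -/
theorem exists_bound_of_sum (ι : Type*) [Fintype ι] [DecidableEq ι] :
    ∃ C : ℕ, ∀ (s : ι → Set.Icc (-2 : ℤ) 2) (c : (ι → Set.Icc (-2 : ℤ) 2) → ℕ),
      (∀ i, ∑ δ, (c δ : ℤ) * δ i = s i) → ∑ δ, c δ ≤ C ∨
      ∃ c' ≤ c, c' ≠ c ∧ ∀ i, ∑ δ, (c' δ : ℤ) * δ i = s i := by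
  have h1 : ∀ s : ι → Set.Icc (-2 : ℤ) 2, ∃ C : ℕ, ∀ c : (ι → Set.Icc (-2 : ℤ) 2) → ℕ,
      (∀ i, ∑ δ, (c δ : ℤ) * δ i = s i) → ∑ δ, c δ ≤ C ∨
      ∃ c' ≤ c, c' ≠ c ∧ ∀ i, ∑ δ, (c' δ : ℤ) * δ i = s i := by
    intro s
    let X : Set ((ι → Set.Icc (-2 : ℤ) 2) → ℕ) := {c | ∀ i, ∑ δ, (c δ : ℤ) * δ i = s i}
    -- Dickson's lemma: the minimal solutions form an antichain in a finite power of `ℕ`.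
    have hfin : {c | Minimal (· ∈ X) c}.Finite := by
      exact WellQuasiOrderedLE.finite_of_isAntichain (setOfPred_minimal_antichain (· ∈ X))
    obtain ⟨C, hC⟩ := (hfin.image fun c => ∑ δ, c δ).bddAbove
    refine ⟨C, fun c hc => ?_⟩
    by_cases hmin : Minimal (· ∈ X) c
    · exact Or.inl (hC ⟨c, hmin, rfl⟩)
    · right
      rw [not_minimal_iff (show c ∈ X from hc)] at hmin
      obtain ⟨c', h1, h2⟩ := hmin
      exact ⟨c', h2.1, fun h => h2.2 h.ge, h1⟩
  choose C hC using h1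
  refine ⟨∑ s, C s, fun s c hc => ?_⟩
  rcases hC s c hc with h | h
  · exact Or.inl (h.trans (Finset.single_le_sum (fun _ _ => Nat.zero_le _) (Finset.mem_univ s)))
  · exact Or.inr h

theorem classCount_eq_sum {W ι : Type*} [DecidableEq ι] (cl : W → ι) (F : Finset W) (i : ι) :
    (classCount cl F i : ℤ) = ∑ z ∈ F, if cl z = i then 1 else 0 := by
  simp [classCount]

theorem change_union {R Q : Type*} [AddCommGroup R] [DecidableEq Q] (F F' : Finset V) (q : V → Q)
    (S : Finset Q) (g : V → R) :
    change F F' (Finset.univ.filter fun z => q z ∈ S) g =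
      ∑ x ∈ S, change F F' (Finset.univ.filter fun z => q z = x) g := by
  unfold change
  rw [← Finset.sum_fiberwise_of_maps_to (g := q) (t := S) (by simp)]
  refine Finset.sum_congr rfl fun x hx => Finset.sum_congr ?_ fun _ _ => rfl
  ext z
  simp only [Finset.mem_filter, Finset.mem_univ, true_and, and_iff_right_iff_imp]
  rintro rfl
  exact hx

/-- Only vertices of the symmetric difference contribute, each at most one in absolute value. A part
with at most two of them therefore has a change vector with entries in `[-2, 2]`. -/
theorem abs_change_le {W : Type*} [DecidableEq W] {F F' P : Finset W} (p : W → Prop)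
    [DecidablePred p] :
    |change F F' P fun z => if p z then (1 : ℤ) else 0| ≤ (P ∩ symmDiff F F').card := by
  unfold change
  refine (Finset.abs_sum_le_sum_abs _ _).trans ?_
  rw [Finset.card_eq_sum_ones, Nat.cast_sum, ← Finset.filter_mem_eq_inter, Finset.sum_filter]
  refine Finset.sum_le_sum fun z _ => ?_
  by_cases h1 : z ∈ F <;> by_cases h2 : z ∈ F' <;> by_cases h3 : p z <;>
    simp [h1, h2, h3, Finset.mem_symmDiff]

/-- Given a set of maximum weight among the feasible sets with its class counts, every feasible set
with nearby class counts is dominated by one with a bounded number of exchanges. -/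
theorem exists_exchange_bound (ι : Type*) [Fintype ι] [DecidableEq ι] :
    ∃ C : ℕ, ∀ {V : Type} [Fintype V] [DecidableEq V] (G : V → V → Prop) (cl : V → ι)
      (w : V → ℝ) (F F₁ : Finset V), Feasible G F → Feasible G F₁ →
      (∀ F₂, Feasible G F₂ → classCount cl F₂ = classCount cl F →
        ∑ z ∈ F₂, w z ≤ ∑ z ∈ F, w z) →
      (∀ i, |(classCount cl F₁ i : ℤ) - classCount cl F i| ≤ 2) →
      ∃ F', Feasible G F' ∧ classCount cl F' = classCount cl F₁ ∧
        ∑ z ∈ F₁, w z ≤ ∑ z ∈ F', w z ∧ (symmDiff F F').card ≤ C := by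
  classical
  obtain ⟨C, hC⟩ := exists_bound_of_sum ι
  refine ⟨2 * C, ?_⟩
  intro V _ _ G cl w F F₁ hF hF₁ hopt hnear
  let cand : Finset (Finset V) := Finset.univ.filter fun F' =>
    Feasible G F' ∧ classCount cl F' = classCount cl F₁ ∧ ∑ z ∈ F₁, w z ≤ ∑ z ∈ F', w z
  -- Among the feasible sets that dominate `F₁`, take one closest to `F`; any shortening of the
  -- exchange contradicts this choice.
  obtain ⟨F', hF'c, hmin⟩ := cand.exists_min_image (fun F' => (symmDiff F F').card)
    ⟨F₁, by simp [cand, hF₁]⟩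
  obtain ⟨hF', hcount, hw⟩ : Feasible G F' ∧ classCount cl F' = classCount cl F₁ ∧
    ∑ z ∈ F₁, w z ≤ ∑ z ∈ F', w z := by simpa [cand] using hF'c
  refine ⟨F', hF', hcount, hw, ?_⟩
  obtain ⟨S, hS1, hS2⟩ := exists_exchange_setoid hF hF'
  let q : V → Quotient S := Quotient.mk S
  let D := symmDiff F F'
  let Q := D.image q
  have hpart : ∀ x : Quotient S, (Finset.univ.filter (fun z => q z = x) ∩ D).card ≤ 2 := by
    intro x
    refine hS2 _ Finset.inter_subset_right fun y hy z hz => ?_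
    simp only [Finset.mem_inter, Finset.mem_filter, Finset.mem_univ, true_and] at hy hz
    exact Quotient.exact (hy.1.trans hz.1.symm)
  let ind : ι → V → ℤ := fun i z => if cl z = i then 1 else 0
  let δ : Quotient S → ι → Set.Icc (-2 : ℤ) 2 := fun x i =>
    ⟨change F F' (Finset.univ.filter fun z => q z = x) (ind i), abs_le.1
      ((abs_change_le (fun z => cl z = i)).trans (by exact_mod_cast hpart x))⟩
  let c : (ι → Set.Icc (-2 : ℤ) 2) → ℕ := fun d => (Q.filter fun x => δ x = d).card
  have hsum : ∀ (R : Finset (Quotient S)) (i : ι),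
      change F F' (Finset.univ.filter fun z => q z ∈ R) (ind i) =
        ∑ d, ((R.filter fun x => δ x = d).card : ℤ) * d i := by
    intro R i
    rw [change_union, ← Finset.sum_fiberwise R δ]
    refine Finset.sum_congr rfl fun d _ => ?_
    rw [Finset.sum_congr rfl (g := fun _ => (d i : ℤ)), Finset.sum_const, nsmul_eq_mul]
    intro x hx
    rw [← (Finset.mem_filter.1 hx).2]
  have hcard : D.card ≤ 2 * Q.card := by
    refine Finset.card_le_mul_card_image (f := q) D 2 fun x _ => ?_
    refine le_trans (Finset.card_le_card fun z hz => ?_) (hpart x)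
    simp only [Finset.mem_inter, Finset.mem_filter, Finset.mem_univ, true_and] at hz ⊢
    exact ⟨hz.2, hz.1⟩
  have hQc : Q.card = ∑ d, c d := Finset.card_eq_sum_card_fiberwise
    (f := δ) (t := Finset.univ) (fun _ _ => by simp)
  have htot : ∀ i, ∑ d, (c d : ℤ) * d i = (classCount cl F₁ i : ℤ) - classCount cl F i := by
    intro i
    rw [← hsum, ← hcount, classCount_eq_sum, classCount_eq_sum]
    have h1 := (sum_mix (fun z => q z ∈ Q) F F' (ind i)).1
    have h2 : mix (fun z => q z ∈ Q) F F' = F' := by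
      ext z
      rw [mem_mix]
      by_cases hz : q z ∈ Q
      · simp [hz]
      · have h3 : z ∉ D := fun h => hz (Finset.mem_image_of_mem q h)
        rw [Finset.mem_symmDiff] at h3
        tauto
    rw [h2] at h1
    linarith
  rcases hC (fun i => ⟨_, abs_le.1 (hnear i)⟩) c htot with h | ⟨c', hle, hne, hc'⟩
  · exact hcard.trans (by omega)
  exfalso
  -- The subfamily `c'` already has the full sum, so the exchanges in excess of `c'`, chosen as `R
  -- d` for each change vector `d`, have sum zero.
  have hsub : ∀ d, ∃ R ⊆ Q.filter (fun x => δ x = d), R.card = c d - c' d := fun d =>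
    Finset.exists_subset_card_eq (Nat.sub_le _ _)
  choose R hR hRc using hsub
  let U := Finset.univ.biUnion R
  have hUd : ∀ d, U.filter (fun x => δ x = d) = R d := by
    intro d
    ext x
    simp only [U, Finset.mem_filter, Finset.mem_biUnion, Finset.mem_univ, true_and]
    constructor
    · rintro ⟨⟨d', hd'⟩, rfl⟩
      have := (Finset.mem_filter.1 (hR d' hd')).2
      rwa [this]
    · exact fun h => ⟨⟨d, h⟩, (Finset.mem_filter.1 (hR d h)).2⟩
  have hzero : ∀ i, change F F' (Finset.univ.filter fun z => q z ∈ U) (ind i) = 0 := by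
    intro i
    rw [hsum]
    have h1 : ∀ d, ((U.filter fun x => δ x = d).card : ℤ) * d i =
        (c d : ℤ) * d i - (c' d : ℤ) * d i := fun d => by
      rw [hUd, hRc, Nat.cast_sub (hle d), sub_mul]
    rw [Finset.sum_congr rfl fun d _ => h1 d, Finset.sum_sub_distrib, htot, hc']
    simp
  obtain ⟨hfe1, hfe2⟩ := hS1 (fun z => q z ∈ U) fun x y h => by
    rw [show q x = q y from Quotient.sound h]
  have hc1 : classCount cl (mix (fun z => q z ∈ U) F F') = classCount cl F := by
    ext i
    have := (sum_mix (fun z => q z ∈ U) F F' (ind i)).1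
    rw [hzero, add_zero, ← classCount_eq_sum, ← classCount_eq_sum] at this
    exact_mod_cast this
  have hc2 : classCount cl (mix (fun z => q z ∈ U) F' F) = classCount cl F' := by
    ext i
    have := (sum_mix (fun z => q z ∈ U) F F' (ind i)).2
    rw [hzero, sub_zero, ← classCount_eq_sum, ← classCount_eq_sum] at this
    exact_mod_cast this
  -- Optimality of `F` bounds the weight change over `U` by zero; reverting `U` in `F'` thus loses
  -- no weight.
  have hw1 := hopt _ hfe1 hc1
  rw [(sum_mix (fun z => q z ∈ U) F F' w).1] at hw1
  have hw2 := (sum_mix (fun z => q z ∈ U) F F' w).2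
  have hle' := hmin (mix (fun z => q z ∈ U) F' F) (by
    simp only [cand, Finset.mem_filter, Finset.mem_univ, true_and]
    exact ⟨hfe2, hc2.trans hcount, by linarith⟩)
  refine absurd hle' (not_le.2 (Finset.card_lt_card ?_))
  obtain ⟨d, hd⟩ : ∃ d, c' d ≠ c d := Function.ne_iff.1 hne
  have hpos : 0 < (R d).card := by
    rw [hRc]
    exact Nat.sub_pos_of_lt (lt_of_le_of_ne (hle d) hd)
  obtain ⟨x, hx⟩ := Finset.card_pos.1 hpos
  obtain ⟨z, hzD, hzx⟩ := Finset.mem_image.1 (Finset.mem_filter.1 (hR d hx)).1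
  have hzU : q z ∈ U := by
    rw [hzx]
    exact Finset.mem_biUnion.2 ⟨d, Finset.mem_univ d, hx⟩
  refine Finset.ssubset_iff_of_subset (fun y hy => ?_) |>.2 ⟨z, hzD, ?_⟩
  · rw [Finset.mem_symmDiff, mem_mix] at hy
    rw [Finset.mem_symmDiff]
    tauto
  · rw [Finset.mem_symmDiff, mem_mix]
    tauto

end Exchange
/-! ## Loop programs -/

/-- Programs whose only loops are counting loops: `loop x b c` executes `c` with the counter
`x[0][0]` running from `0` to the value of the cell `8[b][0]`. -/
inductive Prog : Type
  | skip
  | setNat (a : ℕ) (i j e : NExp)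
  | setReal (a : ℕ) (i j : NExp) (e : RExp)
  | seq (c d : Prog)
  | ite (b : BExp) (c d : Prog)
  | loop (x b : ℕ) (c : Prog)

/-- The scalar variable `x[0][0]`. -/
def var (x : ℕ) : NExp := .get x (.const 0) (.const 0)

/-- The bound of a loop. -/
def loopBound (b : ℕ) : NExp := .get 8 (.const b) (.const 0)

theorem State.setNat_nat_of_ne {s : State} {a b i j x : ℕ} (h : b ≠ a) :
    (s.setNat a i j x).nat b = s.nat b := by
  funext i' j'
  simp [State.setNat, h]

theorem State.setNat_nat_self {s : State} {a i j x : ℕ} : (s.setNat a i j x).nat a i j = x := by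
  simp [State.setNat]

theorem State.setNat_real {s : State} {a i j x : ℕ} : (s.setNat a i j x).real = s.real := rfl

theorem State.setReal_real_self {s : State} {a i j : ℕ} {x : ℝ} :
    (s.setReal a i j x).real a i j = x := by
  simp [State.setReal]

theorem State.setReal_real_of_ne {s : State} {a b i j : ℕ} {x : ℝ} (h : b ≠ a) :
    (s.setReal a i j x).real b = s.real b := by
  funext i' j'
  simp [State.setReal, h]

namespace Prog

/-- Assignment to a scalar variable. -/
def set (x : ℕ) (e : NExp) : Prog := .setNat x (.const 0) (.const 0) e

/-- The translation into the machine language. -/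
def toCmd : Prog → Cmd
  | skip => .skip
  | setNat a i j e => .setNat a i j e
  | setReal a i j e => .setReal a i j e
  | seq c d => .seq c.toCmd d.toCmd
  | ite b c d => .ite b c.toCmd d.toCmd
  | loop x b c => .seq (.setNat x (.const 0) (.const 0) (.const 0))
      (.while (.not (.natLe (loopBound b) (var x)))
        (.seq c.toCmd (.setNat x (.const 0) (.const 0) (.add (var x) (.const 1)))))

open Classical in
/-- The effect of a program. -/
noncomputable def run : Prog → State → State
  | skip, s => s
  | setNat a i j e, s => s.setNat a (i.eval s) (j.eval s) (e.eval s)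
  | setReal a i j e, s => s.setReal a (i.eval s) (j.eval s) (e.eval s)
  | seq c d, s => d.run (c.run s)
  | ite b c d, s => if b.Holds s then c.run s else d.run s
  -- The bound is read once, at the start. The machine rereads it before every iteration; `WF` makes
  -- the two agree.
  | loop x b c, s => Nat.rec (s.setNat x 0 0 0)
      (fun j t => (c.run t).setNat x 0 0 (j + 1)) (s.nat 8 b 0)

/-- The arrays of natural numbers that a program may change. -/
def writes : Prog → List ℕ
  | skip => []
  | setNat a _ _ _ => [a]
  | setReal _ _ _ _ => []
  | seq c d => c.writes ++ d.writes
  | ite _ c d => c.writes ++ d.writes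
  | loop x _ c => x :: c.writes

/-- The arrays of real numbers that a program may change. -/
def writesReal : Prog → List ℕ
  | skip => []
  | setNat _ _ _ _ => []
  | setReal a _ _ _ => [a]
  | seq c d => c.writesReal ++ d.writesReal
  | ite _ c d => c.writesReal ++ d.writesReal
  | loop _ _ c => c.writesReal

/-- No loop changes its own counter or a loop bound. -/
def WF : Prog → Prop
  | skip => True
  | setNat _ _ _ _ => True
  | setReal _ _ _ _ => True
  | seq c d => c.WF ∧ d.WF
  | ite _ c d => c.WF ∧ d.WF
  | loop x _ c => x ≠ 8 ∧ x ∉ c.writes ∧ 8 ∉ c.writes ∧ c.WF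

/-- A bound for the running time, as a polynomial in a bound for the number of iterations of every
loop. -/
noncomputable def cost : Prog → Polynomial ℕ
  | skip => 1
  | setNat _ i j e => .C (i.cost + j.cost + e.cost + 1)
  | setReal _ i j e => .C (i.cost + j.cost + e.cost + 1)
  | seq c d => c.cost + d.cost
  | ite b c d => .C (b.cost + 1) + c.cost + d.cost
  -- Resetting the counter costs 4 and a test, with the branching, costs 9, which gives 13 for the
  -- reset and the failing test. An iteration adds a test and the increment, which costs 8.
  | loop _ _ c => 13 + .X * (17 + c.cost)

/-- The frame rule on which all later verifications rest: array names are literals in the programs,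
so for most programs the side condition is decidable by computation. -/
theorem run_nat {c : Prog} {a : ℕ} (h : a ∉ c.writes) (s : State) :
    (c.run s).nat a = s.nat a := by
  induction c generalizing s with
  | skip => rfl
  | setNat a' i j e =>
    funext i' j'
    simp only [writes, List.mem_singleton] at h
    simp [run, State.setNat, h]
  | setReal => rfl
  | seq c d ihc ihd =>
    simp only [writes, List.mem_append, not_or] at h
    rw [run, ihd h.2, ihc h.1]
  | ite b c d ihc ihd =>
    simp only [writes, List.mem_append, not_or] at h
    rw [run]
    split
    · exact ihc h.1 s
    · exact ihd h.2 s
  | loop x b c ih =>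
    simp only [writes, List.mem_cons, not_or] at h
    rw [run]
    induction s.nat 8 b 0 with
    | zero => exact State.setNat_nat_of_ne h.1
    | succ j hj => rw [State.setNat_nat_of_ne h.1, ih h.2, hj]

theorem run_real {c : Prog} {a : ℕ} (h : a ∉ c.writesReal) (s : State) :
    (c.run s).real a = s.real a := by
  induction c generalizing s with
  | skip => rfl
  | setNat a' i j e => rfl
  | setReal a' i j e =>
    funext i' j'
    simp only [writesReal, List.mem_singleton] at h
    simp [run, State.setReal, h]
  | seq c d ihc ihd =>
    simp only [writesReal, List.mem_append, not_or] at h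
    rw [run, ihd h.2, ihc h.1]
  | ite b c d ihc ihd =>
    simp only [writesReal, List.mem_append, not_or] at h
    rw [run]
    split
    · exact ihc h.1 s
    · exact ihd h.2 s
  | loop x b c ih =>
    simp only [writesReal] at h
    rw [run]
    induction s.nat 8 b 0 with
    | zero => rfl
    | succ j hj =>
      rw [State.setNat_real, ih h, hj]

/-- A loop program halts within its time bound. -/
theorem exec {c : Prog} (hc : c.WF) (h8 : 8 ∉ c.writes) {B : ℕ} {s : State}
    (hB : ∀ b, s.nat 8 b 0 ≤ B) : ∃ t ≤ c.cost.eval B, Exec c.toCmd s t (c.run s) := by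
  induction c generalizing s with
  | skip => exact ⟨1, by simp [cost], .skip s⟩
  | setNat a i j e => exact ⟨_, by simp [cost], .setNat a i j e s⟩
  | setReal a i j e => exact ⟨_, by simp [cost], .setReal a i j e s⟩
  | seq c d ihc ihd =>
    simp only [writes, List.mem_append, not_or] at h8
    obtain ⟨t, ht, h⟩ := ihc hc.1 h8.1 hB
    obtain ⟨t', ht', h'⟩ := ihd (s := c.run s) hc.2 h8.2 (by rwa [run_nat h8.1])
    exact ⟨t + t', by simp only [cost, Polynomial.eval_add]; omega, .seq h h'⟩
  | ite b c d ihc ihd =>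
    simp only [writes, List.mem_append, not_or] at h8
    obtain ⟨t, ht, h⟩ := ihc hc.1 h8.1 hB
    obtain ⟨t', ht', h'⟩ := ihd hc.2 h8.2 hB
    rw [run]
    by_cases hb : b.Holds s
    · rw [if_pos hb]
      exact ⟨_, by simp only [cost, Polynomial.eval_add, Polynomial.eval_C]; omega, .iteTrue hb h⟩
    · rw [if_neg hb]
      exact ⟨_, by simp only [cost, Polynomial.eval_add, Polynomial.eval_C]; omega,
        .iteFalse hb h'⟩
  | loop x b c ih =>
    obtain ⟨hx8, hxc, h8c, hwf⟩ := hc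
    let st : ℕ → State := fun m => Nat.rec (s.setNat x 0 0 0)
      (fun j t => (c.run t).setNat x 0 0 (j + 1)) m
    have hst8 : ∀ j, (st j).nat 8 = s.nat 8 := by
      intro j
      induction j with
      | zero => exact State.setNat_nat_of_ne hx8.symm
      | succ j hj =>
        change ((c.run (st j)).setNat x 0 0 (j + 1)).nat 8 = _
        rw [State.setNat_nat_of_ne hx8.symm, run_nat h8c, hj]
    have hstx : ∀ j, (st j).nat x 0 0 = j := by
      rintro (_ | j) <;> simp [st, State.setNat]
    let w : Cmd := .while (.not (.natLe (loopBound b) (var x)))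
        (.seq c.toCmd (.setNat x (.const 0) (.const 0) (.add (var x) (.const 1))))
    -- Induction on the number `m` of iterations that remain.
    have hw : ∀ m j, j + m = s.nat 8 b 0 →
        ∃ t ≤ 9 + m * (17 + c.cost.eval B), Exec w (st j) t (st (s.nat 8 b 0)) := by
      intro m
      induction m with
      | zero =>
        intro j hj
        rw [Nat.add_zero] at hj
        subst hj
        refine ⟨_, ?_, Exec.whileFalse ?_⟩
        · simp [BExp.cost, loopBound, var, NExp.cost]
        · simp [BExp.Holds, loopBound, var, NExp.eval, hst8, hstx]
      | succ m ihm =>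
        intro j hj
        obtain ⟨t, ht, h⟩ := ih (s := st j) hwf h8c (by rwa [hst8])
        obtain ⟨t', ht', h'⟩ := ihm (j + 1) (by omega)
        have h1 : Exec (.setNat x (.const 0) (.const 0) (.add (var x) (.const 1)))
            (c.run (st j)) 8 (st (j + 1)) := by
          have h2 := Exec.setNat x (.const 0) (.const 0) (.add (var x) (.const 1)) (c.run (st j))
          have h3 : NExp.eval (c.run (st j)) (.add (var x) (.const 1)) = j + 1 := by
            simp [var, NExp.eval, run_nat hxc, hstx]
          rw [h3] at h2
          exact h2
        refine ⟨_, ?_, .whileTrue ?_ (.seq h h1) h'⟩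
        · simp only [BExp.cost, loopBound, var, NExp.cost]
          rw [add_mul]
          omega
        · simp only [BExp.Holds, loopBound, var, NExp.eval, hst8, hstx]
          omega
    obtain ⟨t, ht, h⟩ := hw (s.nat 8 b 0) 0 (by omega)
    refine ⟨4 + t, ?_, .seq (.setNat x (.const 0) (.const 0) (.const 0) s) h⟩
    have := Nat.mul_le_mul_right (17 + c.cost.eval B) (hB b)
    simp only [cost, Polynomial.eval_add, Polynomial.eval_mul, Polynomial.eval_X,
      Polynomial.eval_ofNat]
    omega

/-! ### Rules for loops, sums and array assignments -/

/-- Memories that agree outside the arrays that a program may change. -/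
def Frame (W W' : List ℕ) (s t : State) : Prop :=
  (∀ a ∉ W, t.nat a = s.nat a) ∧ ∀ a ∉ W', t.real a = s.real a

/-- The induction rule for loops. -/
theorem loop_induct {x b : ℕ} {c : Prog} {s : State} (P : ℕ → State → Prop)
    (h0 : P 0 (s.setNat x 0 0 0))
    (hs : ∀ j t, j < s.nat 8 b 0 → t.nat x 0 0 = j → Frame (x :: c.writes) c.writesReal s t →
      P j t → P (j + 1) ((c.run t).setNat x 0 0 (j + 1))) :
    P (s.nat 8 b 0) ((loop x b c).run s) := by
  let st : ℕ → State := fun m => Nat.rec (s.setNat x 0 0 0)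
    (fun j t => (c.run t).setNat x 0 0 (j + 1)) m
  have key : ∀ j, j ≤ s.nat 8 b 0 →
      (st j).nat x 0 0 = j ∧ Frame (x :: c.writes) c.writesReal s (st j) ∧ P j (st j) := by
    intro j
    induction j with
    | zero =>
      refine fun _ => ⟨by simp [st, State.setNat], ⟨fun a ha => ?_, fun a ha => rfl⟩, h0⟩
      simp only [List.mem_cons, not_or] at ha
      funext i j
      simp [st, State.setNat, ha.1]
    | succ j ih =>
      intro hj
      obtain ⟨h1, h2, h3⟩ := ih (by omega)
      refine ⟨by simp [st, State.setNat], ⟨fun a ha => ?_, fun a ha => ?_⟩, hs j _ hj h1 h2 h3⟩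
      · rw [← h2.1 a ha]
        simp only [List.mem_cons, not_or] at ha
        funext i j'
        change ((c.run (st j)).setNat x 0 0 (j + 1)).nat a i j' = _
        simp only [State.setNat, ha.1, false_and, if_false]
        rw [run_nat ha.2]
      · rw [← h2.2 a ha]
        change ((c.run (st j)).setNat x 0 0 (j + 1)).real a = _
        exact run_real ha _
  exact (key _ le_rfl).2.2

/-- A loop whose iterations overwrite parts of the array `A`. -/
theorem loop_write {x b A : ℕ} {c : Prog} {s : State} (hA : A ≠ x) (R : ℕ → ℕ → ℕ → Prop)
    [∀ j i' j', Decidable (R j i' j')] (f : ℕ → ℕ → ℕ)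
    (hc : ∀ j t, j < s.nat 8 b 0 → t.nat x 0 0 = j → Frame (x :: c.writes) c.writesReal s t →
      ∀ i' j', (c.run t).nat A i' j' = if R j i' j' then f i' j' else t.nat A i' j')
    (i' j' : ℕ) : ((loop x b c).run s).nat A i' j' =
      if ∃ j < s.nat 8 b 0, R j i' j' then f i' j' else s.nat A i' j' := by
  refine loop_induct (fun m t => t.nat A i' j' =
    if ∃ j < m, R j i' j' then f i' j' else s.nat A i' j') ?_ ?_
  · simp [State.setNat_nat_of_ne hA]
  · intro j t hj hx hF hP
    rw [State.setNat_nat_of_ne hA, hc j t hj hx hF, hP]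
    by_cases h1 : R j i' j'
    · rw [if_pos h1, if_pos ⟨j, by omega, h1⟩]
    · rw [if_neg h1]
      congr 1
      refine propext ⟨fun ⟨l, hl, h⟩ => ⟨l, by omega, h⟩, fun ⟨l, hl, h⟩ => ⟨l, ?_, h⟩⟩
      rcases Nat.lt_succ_iff_lt_or_eq.1 hl with h2 | rfl
      exacts [h2, absurd h h1]

/-- The conjunction of tests over a loop. -/
def all (y x b : ℕ) (c : Prog) : Prog := .seq (set y (.const 1)) (.loop x b c)

theorem all_spec {y x b : ℕ} {c : Prog} {s : State} (hyx : y ≠ x) (hy : y ≠ 8) (P : ℕ → Prop)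
    [DecidablePred P]
    (hc : ∀ j t, j < s.nat 8 b 0 → t.nat x 0 0 = j → Frame (y :: x :: c.writes) c.writesReal s t →
      (c.run t).nat y 0 0 = if P j then t.nat y 0 0 else 0) :
    ((all y x b c).run s).nat y 0 0 = if ∀ j < s.nat 8 b 0, P j then 1 else 0 := by
  have h8 : (s.setNat y 0 0 1).nat 8 b 0 = s.nat 8 b 0 := by rw [State.setNat_nat_of_ne hy.symm]
  rw [← h8]
  refine loop_induct (s := s.setNat y 0 0 1) (fun m t => t.nat y 0 0 =
    if ∀ j < m, P j then 1 else 0) ?_ ?_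
  · simp [State.setNat_nat_of_ne hyx, State.setNat_nat_self]
  · intro j t hj hx hF hP
    rw [State.setNat_nat_of_ne hyx, hc j t (h8 ▸ hj) hx ?_, hP]
    · by_cases h : P j
      · rw [if_pos h]
        congr 1
        refine propext ⟨fun h' l hl => ?_, fun h' l hl => h' l (by omega)⟩
        rcases Nat.lt_succ_iff_lt_or_eq.1 hl with h2 | rfl
        exacts [h' l h2, h]
      · rw [if_neg h, if_neg fun h' => h (h' j (by omega))]
    · refine ⟨fun a ha => ?_, fun a ha => hF.2 a ha⟩
      simp only [List.mem_cons, not_or] at ha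
      rw [hF.1 a (by simp [ha]), State.setNat_nat_of_ne ha.1]

/-- Summation over a loop. -/
def sum (y x b : ℕ) (c : Prog) : Prog := .seq (set y (.const 0)) (.loop x b c)

theorem sum_spec {y x b : ℕ} {c : Prog} {s : State} (hyx : y ≠ x) (hy : y ≠ 8) (f : ℕ → ℕ)
    (hc : ∀ j t, j < s.nat 8 b 0 → t.nat x 0 0 = j → Frame (y :: x :: c.writes) c.writesReal s t →
      (c.run t).nat y 0 0 = t.nat y 0 0 + f j) :
    ((sum y x b c).run s).nat y 0 0 = ∑ j ∈ Finset.range (s.nat 8 b 0), f j := by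
  have h8 : (s.setNat y 0 0 0).nat 8 b 0 = s.nat 8 b 0 := by rw [State.setNat_nat_of_ne hy.symm]
  rw [← h8]
  refine loop_induct (s := s.setNat y 0 0 0) (fun m t => t.nat y 0 0 =
    ∑ j ∈ Finset.range m, f j) ?_ ?_
  · simp [State.setNat_nat_of_ne hyx, State.setNat_nat_self]
  · intro j t hj hx hF hP
    rw [State.setNat_nat_of_ne hyx, hc j t (h8 ▸ hj) hx ?_, hP, Finset.sum_range_succ]
    refine ⟨fun a ha => ?_, fun a ha => hF.2 a ha⟩
    simp only [List.mem_cons, not_or] at ha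
    rw [hF.1 a (by simp [ha]), State.setNat_nat_of_ne ha.1]

/-- Summation of real numbers over a loop. -/
def sumReal (y x b : ℕ) (c : Prog) : Prog :=
  .seq (.setReal y (.const 0) (.const 0) (.ofNat (.const 0))) (.loop x b c)

theorem sumReal_spec {y x b : ℕ} {c : Prog} {s : State} (f : ℕ → ℝ)
    (hc : ∀ j t, j < s.nat 8 b 0 → t.nat x 0 0 = j → Frame (x :: c.writes) (y :: c.writesReal) s t →
      (c.run t).real y 0 0 = t.real y 0 0 + f j) :
    ((sumReal y x b c).run s).real y 0 0 = ∑ j ∈ Finset.range (s.nat 8 b 0), f j := by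
  refine loop_induct (s := s.setReal y 0 0 ((0 : ℕ) : ℝ)) (fun m t => t.real y 0 0 =
    ∑ j ∈ Finset.range m, f j) ?_ ?_
  · simp [State.setNat_real, State.setReal_real_self]
  · intro j t hj hx hF hP
    rw [State.setNat_real, hc j t hj hx ?_, hP, Finset.sum_range_succ]
    refine ⟨fun a ha => hF.1 a ha, fun a ha => ?_⟩
    simp only [List.mem_cons, not_or] at ha
    rw [hF.2 a ha.2, State.setReal_real_of_ne ha.1]

/-- Return a value in the scalar variable `23`. -/
def ret (e : NExp) : Prog := set 23 e

/-- Simultaneous assignment to the row `r` of the array `A`; the program `c` computes the new value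
of the entry with the index in the variable `21`. -/
def assignRow (A : ℕ) (r : NExp) (c : Prog) : Prog :=
  .seq (.loop 21 0 (.seq c (.setNat 22 (.const 0) (var 21) (var 23))))
    (.loop 21 0 (.setNat A r (var 21) (.get 22 (.const 0) (var 21))))

/-- The new row is collected in the buffer `22` before `A` is touched, so `c` may read the old
contents of `A`. Accordingly the frame for `c` keeps `A`, while the row index `r` must also be
stable during the copying, when `A` changes. -/
theorem assignRow_spec {A : ℕ} {r : NExp} {c : Prog} {s : State} (row : ℕ) (f : ℕ → ℕ)
    (hA : A ∉ [8, 21, 22, 23]) (hw : ∀ a ∈ [A, 8, 21, 22], a ∉ c.writes)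
    (hr : ∀ t, Frame (A :: 21 :: 22 :: c.writes) c.writesReal s t → r.eval t = row)
    (hc : ∀ j t, j < s.nat 8 0 0 → t.nat 21 0 0 = j →
      Frame (21 :: 22 :: c.writes) c.writesReal s t → (c.run t).nat 23 0 0 = f j) (i' j' : ℕ) :
    ((assignRow A r c).run s).nat A i' j' =
      if i' = row ∧ j' < s.nat 8 0 0 then f j' else s.nat A i' j' := by
  simp only [List.mem_cons, List.not_mem_nil, or_false, not_or, forall_eq_or_imp,
    forall_eq] at hA hw
  set d : Prog := .seq c (.setNat 22 (.const 0) (var 21) (var 23))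
  set s1 := (loop 21 0 d).run s
  have hd : d.writes = c.writes ++ [22] := rfl
  have hfr : Frame (21 :: 22 :: c.writes) c.writesReal s s1 := by
    refine ⟨fun a ha => run_nat ?_ s, fun a ha => run_real ?_ s⟩
    · simp only [List.mem_cons, not_or] at ha
      simp [writes, hd, ha]
    · simpa [writesReal, d] using ha
  have h8 : s1.nat 8 = s.nat 8 := hfr.1 8 (by simp [hw])
  have h22 : ∀ j < s.nat 8 0 0, s1.nat 22 0 j = f j := by
    intro j hj
    have h := loop_write (x := 21) (b := 0) (A := 22) (c := d) (s := s) (by simp)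
      (fun j i' j' => i' = 0 ∧ j' = j) (fun _ j' => f j') ?_ 0 j
    · rw [h, if_pos ⟨j, hj, rfl, rfl⟩]
    · intro j t hj hx hF i' j'
      have h1 := hc j t hj hx ⟨fun a ha => hF.1 a (by
        simp only [List.mem_cons, not_or] at ha; simp [hd, ha]), fun a ha => hF.2 a (by
        simpa [writesReal, d] using ha)⟩
      have h2 : (c.run t).nat 21 = t.nat 21 := run_nat hw.2.2.1 t
      have h3 : (c.run t).nat 22 = t.nat 22 := run_nat hw.2.2.2 t
      simp only [d, run, NExp.eval, var, State.setNat, true_and, h1, h2, hx, h3]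
      grind
  have h := loop_write (x := 21) (b := 0) (A := A)
    (c := .setNat A r (var 21) (.get 22 (.const 0) (var 21))) (s := s1) (by tauto)
    (fun j i' j' => i' = row ∧ j' = j) (fun _ j' => f j') ?_ i' j'
  · change ((loop 21 0 _).run s1).nat A i' j' = _
    rw [h, h8, hfr.1 A (by simp [hA, hw])]
    congr 1
    simp only [eq_iff_iff]
    exact ⟨fun ⟨j, h1, h2, h3⟩ => ⟨h2, h3 ▸ h1⟩, fun ⟨h1, h2⟩ => ⟨j', h2, h1, rfl⟩⟩
  · intro j t hj hx hF i' j'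
    rw [h8] at hj
    have hF' : ∀ a, a ≠ A → a ≠ 21 → t.nat a = s1.nat a := fun a h1 h2 =>
      hF.1 a (by simp [writes, h1, h2])
    have h1 : r.eval t = row := hr t ⟨fun a ha => by
      simp only [List.mem_cons, not_or] at ha
      rw [hF' a ha.1 ha.2.1, hfr.1 a (by simp [ha])], fun a ha => by
      rw [hF.2 a (by simp [writesReal]), hfr.2 a ha]⟩
    simp only [run, NExp.eval, var, State.setNat, true_and, h1, hx,
      hF' 22 (Ne.symm hA.2.2.1) (by simp), h22 j hj]
    grind

/-- Simultaneous assignment to the array `A`; the program `c` computes the new value of the entry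
with the indices in the variables `20` and `21`. -/
def assign (A : ℕ) (c : Prog) : Prog :=
  .seq (.loop 20 0 (.loop 21 0 (.seq c (.setNat 22 (var 20) (var 21) (var 23)))))
    (.loop 20 0 (.loop 21 0 (.setNat A (var 20) (var 21) (.get 22 (var 20) (var 21)))))

/-- A double loop that overwrites an array. -/
theorem loop_loop_write {A : ℕ} {c : Prog} {s : State} (hA : A ∉ [8, 20, 21])
    (h8 : 8 ∉ c.writes) (h20 : 20 ∉ c.writes) (f : ℕ → ℕ → ℕ)
    (hc : ∀ i j t, i < s.nat 8 0 0 → j < s.nat 8 0 0 → t.nat 20 0 0 = i → t.nat 21 0 0 = j →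
      Frame (20 :: 21 :: c.writes) c.writesReal s t →
      ∀ i' j', (c.run t).nat A i' j' = if i' = i ∧ j' = j then f i' j' else t.nat A i' j')
    (i' j' : ℕ) : ((loop 20 0 (loop 21 0 c)).run s).nat A i' j' =
      if i' < s.nat 8 0 0 ∧ j' < s.nat 8 0 0 then f i' j' else s.nat A i' j' := by
  simp only [List.mem_cons, List.not_mem_nil, or_false, not_or] at hA
  rw [loop_write (A := A) (by tauto) (fun i i' j' => i' = i ∧ j' < s.nat 8 0 0) f]
  · congr 1
    simp only [eq_iff_iff]
    exact ⟨fun ⟨j, h1, h2, h3⟩ => ⟨h2 ▸ h1, h3⟩, fun ⟨h1, h2⟩ => ⟨i', h1, rfl, h2⟩⟩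
  · intro i t hi hx hF i'' j''
    have ht8 : t.nat 8 = s.nat 8 := hF.1 8 (by simp [writes, h8])
    rw [loop_write (A := A) (by tauto) (fun j i' j' => i' = i ∧ j' = j) f]
    · rw [ht8]
      congr 1
      simp only [eq_iff_iff]
      exact ⟨fun ⟨j, h1, h2, h3⟩ => ⟨h2, h3 ▸ h1⟩, fun ⟨h1, h2⟩ => ⟨j'', h2, h1, rfl⟩⟩
    · intro j t' hj hx' hF'
      refine hc i j t' hi (ht8 ▸ hj) ?_ hx' ⟨fun a ha => ?_, fun a ha => ?_⟩
      · rw [hF'.1 20 (by simp [h20]), hx]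
      · simp only [List.mem_cons, not_or] at ha
        rw [hF'.1 a (by simp [ha]), hF.1 a (by simp [writes, ha])]
      · rw [hF'.2 a ha, hF.2 a (by simpa [writesReal] using ha)]

theorem assign_spec {A : ℕ} {c : Prog} {s : State} (f : ℕ → ℕ → ℕ)
    (hA : A ∉ [8, 20, 21, 22, 23]) (hw : ∀ a ∈ [A, 8, 20, 21, 22], a ∉ c.writes)
    (hc : ∀ i j t, i < s.nat 8 0 0 → j < s.nat 8 0 0 → t.nat 20 0 0 = i → t.nat 21 0 0 = j →
      Frame (20 :: 21 :: 22 :: c.writes) c.writesReal s t → (c.run t).nat 23 0 0 = f i j)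
    (i' j' : ℕ) :
    ((assign A c).run s).nat A i' j' =
      if i' < s.nat 8 0 0 ∧ j' < s.nat 8 0 0 then f i' j' else s.nat A i' j' := by
  simp only [List.mem_cons, List.not_mem_nil, or_false, not_or, forall_eq_or_imp,
    forall_eq] at hA hw
  set d : Prog := .seq c (.setNat 22 (var 20) (var 21) (var 23))
  set s1 := (loop 20 0 (loop 21 0 d)).run s
  have hd : d.writes = c.writes ++ [22] := rfl
  have hdr : d.writesReal = c.writesReal := by simp [writesReal, d]
  have hfr : ∀ a ∉ 20 :: 21 :: 22 :: c.writes, s1.nat a = s.nat a := by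
    refine fun a ha => run_nat ?_ s
    simp only [List.mem_cons, not_or] at ha
    simp [writes, hd, ha]
  have h8 : s1.nat 8 = s.nat 8 := hfr 8 (by simp [hw])
  have h22 : ∀ i < s.nat 8 0 0, ∀ j < s.nat 8 0 0, s1.nat 22 i j = f i j := by
    intro i hi j hj
    have h := loop_loop_write (A := 22) (c := d) (s := s) (by simp) (by simp [hd, hw])
      (by simp [hd, hw]) f ?_ i j
    · rw [h, if_pos ⟨hi, hj⟩]
    · intro i j t hi hj hx hy hF i' j'
      have h1 := hc i j t hi hj hx hy ⟨fun a ha => hF.1 a (by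
        simp only [List.mem_cons, not_or] at ha; simp [hd, ha]), fun a ha => hF.2 a (by
        rwa [hdr])⟩
      have h2 : (c.run t).nat 21 = t.nat 21 := run_nat hw.2.2.2.1 t
      have h3 : (c.run t).nat 22 = t.nat 22 := run_nat hw.2.2.2.2 t
      have h4 : (c.run t).nat 20 = t.nat 20 := run_nat hw.2.2.1 t
      simp only [d, run, NExp.eval, var, State.setNat, true_and, h1, h2, hx, hy, h3, h4]
      grind
  have h := loop_loop_write (A := A)
    (c := .setNat A (var 20) (var 21) (.get 22 (var 20) (var 21))) (s := s1) (by simp; tauto)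
    (by simp [writes]; tauto) (by simp [writes]; tauto) f ?_ i' j'
  · change ((loop 20 0 (loop 21 0 _)).run s1).nat A i' j' = _
    rw [h, h8, hfr A (by simp [hA, hw])]
  · intro i j t hi hj hx hy hF i' j'
    rw [h8] at hi hj
    have h22' : t.nat 22 = s1.nat 22 := hF.1 22 (by simp [writes]; tauto)
    simp only [run, NExp.eval, var, State.setNat, true_and, hx, hy, h22', h22 i hi j hj]
    grind

end Prog
/-! ## The search for an augmenting path as a program -/

namespace Prog

/-- Equality of natural numbers. -/
def eqN (e f : NExp) : BExp := .and (.natLe e f) (.natLe f e)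

/-- Disjunction. -/
def orB (b c : BExp) : BExp := .not (.and (.not b) (.not c))

/-- The entry `e` of the first row of the array `A`. -/
def entry (A : ℕ) (e : NExp) : NExp := .get A (.const 0) e

theorem eqN_holds {s : State} {e f : NExp} : (eqN e f).Holds s ↔ e.eval s = f.eval s := by
  simp [eqN, BExp.Holds, le_antisymm_iff]

theorem orB_holds {s : State} {b c : BExp} : (orB b c).Holds s ↔ b.Holds s ∨ c.Holds s := by
  simp only [orB, BExp.Holds]
  tauto

theorem ite_nat {p : Prop} [Decidable p] {s t : State} {a i j : ℕ} :
    (if p then s else t).nat a i j = if p then s.nat a i j else t.nat a i j := by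
  split <;> rfl

theorem ite_one_iff {p : Prop} [Decidable p] : (if p then 1 else 0 : ℕ) = 1 ↔ p := by
  split <;> simp [*]

theorem run_seq {c d : Prog} {s : State} : (seq c d).run s = d.run (c.run s) := rfl

theorem ret_nat {s : State} {e : NExp} : ((ret e).run s).nat 23 0 0 = e.eval s :=
  State.setNat_nat_self

/-- Extend the forest by the edge from the vertex in `30` to the vertex in `31`. -/
def growProg : Prog :=
  let v := var 30
  let u := var 31
  let w := entry 41 u
  .seq (assign 44 (.ite (eqN (var 20) w)
      (.ite (eqN (var 21) v) (ret u) (.ite (eqN (var 21) u) (ret v)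
        (.ite (eqN (var 21) w) (ret w) (ret (.get 44 v (var 21))))))
      (ret (.get 44 (var 20) (var 21)))))
    (.seq (assignRow 43 (.const 0)
        (.ite (eqN (var 21) w) (ret (.const 1)) (ret (entry 43 (var 21)))))
      (assign 42 (.ite (eqN (var 20) u)
        (.ite (eqN (var 21) u) (ret (.const 1)) (ret (.get 42 v (var 21))))
        (.ite (eqN (var 20) w)
          (.ite (orB (eqN (var 21) u) (eqN (var 21) w)) (ret (.const 1))
            (ret (.get 42 v (var 21))))
          (ret (.get 42 (var 20) (var 21)))))))

/-- The entries are those of the extended forest in `Forest.grow`, with `w` in the role of the mate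
of `u`. -/
theorem growProg_spec {s : State} {n v u w : ℕ} (hn : s.nat 8 0 0 = n) (hv : s.nat 30 0 0 = v)
    (hu : s.nat 31 0 0 = u) (hw : s.nat 41 0 u = w) :
    (∀ a < n, ∀ z < n, (growProg.run s).nat 44 a z = if a = w then (if z = v then u else
      if z = u then v else if z = w then w else s.nat 44 v z) else s.nat 44 a z) ∧
    (∀ z < n, (growProg.run s).nat 43 0 z = if z = w then 1 else s.nat 43 0 z) ∧
    (∀ z < n, ∀ y < n, (growProg.run s).nat 42 z y = if z = u then (if y = u then 1 else
      s.nat 42 v y) else if z = w then (if y = u ∨ y = w then 1 else s.nat 42 v y)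
      else s.nat 42 z y) := by
  rw [growProg]
  simp only [run]
  generalize h1 : Prog.run (assign 44 _) s = s1
  generalize h2 : Prog.run (assignRow 43 _ _) s1 = s2
  have e1 : ∀ a ∉ [44, 20, 21, 22, 23], s1.nat a = s.nat a := fun a ha => by
    rw [← h1]
    refine run_nat ?_ s
    simp [assign, writes, ret, set] at ha ⊢
    tauto
  have e2 : ∀ a ∉ [43, 21, 22, 23], s2.nat a = s1.nat a := fun a ha => by
    rw [← h2]
    refine run_nat ?_ s1
    simp [assignRow, writes, ret, set] at ha ⊢
    tauto
  refine ⟨fun a ha z hz => ?_, fun z hz => ?_, fun z hz y hy => ?_⟩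
  · rw [run_nat (by decide), e2 44 (by decide), ← h1, assign_spec (fun a z => if a = w then
      (if z = v then u else if z = u then v else if z = w then w else s.nat 44 v z)
      else s.nat 44 a z) (by decide) (by decide), if_pos (by omega)]
    intro i j t hi hj hx hy hF
    have f1 : t.nat 44 = s.nat 44 := hF.1 44 (by decide)
    have f2 : t.nat 30 = s.nat 30 := hF.1 30 (by decide)
    have f3 : t.nat 31 = s.nat 31 := hF.1 31 (by decide)
    have f4 : t.nat 41 = s.nat 41 := hF.1 41 (by decide)
    simp only [run, eqN_holds, ite_nat, ret_nat, NExp.eval, var, entry, f1, f2, f3, f4,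
      hx, hy, hv, hu, hw]
  · rw [run_nat (by decide), ← h2, assignRow_spec 0 (fun z => if z = w then 1 else s.nat 43 0 z)
      (by decide) (by decide) (fun _ _ => rfl), if_pos (by rw [e1 8 (by decide)]; omega)]
    intro j t hj hx hF
    have f1 : t.nat 43 = s.nat 43 := by rw [hF.1 43 (by decide), e1 43 (by decide)]
    have f3 : t.nat 31 = s.nat 31 := by rw [hF.1 31 (by decide), e1 31 (by decide)]
    have f4 : t.nat 41 = s.nat 41 := by rw [hF.1 41 (by decide), e1 41 (by decide)]
    simp only [run, eqN_holds, ite_nat, ret_nat, NExp.eval, var, entry, f1, f3, f4,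
      hx, hu, hw]
  · rw [assign_spec (fun z y => if z = u then (if y = u then 1 else
      s.nat 42 v y) else if z = w then (if y = u ∨ y = w then 1 else s.nat 42 v y)
      else s.nat 42 z y) (by decide) (by decide),
      if_pos (by rw [e2 8 (by decide), e1 8 (by decide)]; omega)]
    intro i j t hi hj hx hy hF
    have f1 : t.nat 42 = s.nat 42 := by
      rw [hF.1 42 (by decide), e2 42 (by decide), e1 42 (by decide)]
    have f2 : t.nat 30 = s.nat 30 := by
      rw [hF.1 30 (by decide), e2 30 (by decide), e1 30 (by decide)]
    have f3 : t.nat 31 = s.nat 31 := by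
      rw [hF.1 31 (by decide), e2 31 (by decide), e1 31 (by decide)]
    have f4 : t.nat 41 = s.nat 41 := by
      rw [hF.1 41 (by decide), e2 41 (by decide), e1 41 (by decide)]
    simp only [run, eqN_holds, orB_holds, ite_nat, ret_nat, NExp.eval, var, entry, f1,
      f2, f3, f4, hx, hy, hv, hu, hw]

/-- The test whether the entry `A[i][j]` is one. -/
def isOne (A : ℕ) (i j : NExp) : BExp := eqN (.get A i j) (.const 1)

theorem isOne_holds {s : State} {A : ℕ} {i j : NExp} :
    (isOne A i j).Holds s ↔ s.nat A (i.eval s) (j.eval s) = 1 := eqN_holds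

/-- The entry of the matching of a new outer vertex in a blossom. -/
def blossomEntry (v u : NExp) : Prog :=
  .ite (eqN (var 21) u) (ret v) (.ite (eqN (var 21) v) (ret u)
    (.ite (eqN (var 21) (var 20)) (ret (var 20))
      (.ite (.and (isOne 42 u (var 21)) (.not (isOne 42 (var 20) (var 21))))
        (ret (.get 44 u (var 21))) (ret (.get 44 v (var 21))))))

/-- Shrink the blossom closed by the edge from the vertex in `30` to the vertex in `31`. -/
def blossomProg : Prog :=
  let v := var 30
  let u := var 31
  -- The order matters: the matchings are updated from the old outer set and the old preorder, the
  -- outer set from the old preorder, and the preorder changes last. Row `47` marks in advance the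
  -- vertices that lie above the meeting point.
  .seq (assign 44 (.ite (isOne 43 (.const 0) (var 20)) (ret (.get 44 (var 20) (var 21)))
      (.ite (isOne 42 u (var 20)) (blossomEntry v u) (blossomEntry u v))))
    (.seq (assignRow 43 (.const 0) (.ite (orB (isOne 43 (.const 0) (var 21))
        (.and (orB (isOne 42 u (var 21)) (isOne 42 v (var 21)))
          (.not (.and (isOne 42 u (var 21)) (isOne 42 v (var 21))))))
        (ret (.const 1)) (ret (.const 0))))
      (.seq (assignRow 47 (.const 0) (.seq (all 35 34 0
          (.ite (.and (.and (isOne 42 u (var 34)) (isOne 42 v (var 34)))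
            (.not (isOne 42 (var 21) (var 34)))) (set 35 (.const 0)) .skip)) (ret (var 35))))
        (assign 42 (.ite (orB (isOne 42 (var 20) (var 21))
          (.and (isOne 42 (var 20) (var 20)) (.and (isOne 47 (.const 0) (var 20))
            (orB (isOne 42 u (var 21)) (isOne 42 v (var 21))))))
          (ret (.const 1)) (ret (.const 0))))))

theorem blossomProg_spec {s : State} {n v u : ℕ} (hn : s.nat 8 0 0 = n) (hv : s.nat 30 0 0 = v)
    (hu : s.nat 31 0 0 = u) :
    (∀ a < n, ∀ z < n, (blossomProg.run s).nat 44 a z = if s.nat 43 0 a = 1 then s.nat 44 a z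
      else if s.nat 42 u a = 1 then
        (if z = u then v else if z = v then u else if z = a then a else
          if s.nat 42 u z = 1 ∧ ¬ s.nat 42 a z = 1 then s.nat 44 u z else s.nat 44 v z)
      else (if z = v then u else if z = u then v else if z = a then a else
          if s.nat 42 v z = 1 ∧ ¬ s.nat 42 a z = 1 then s.nat 44 v z else s.nat 44 u z)) ∧
    (∀ z < n, (blossomProg.run s).nat 43 0 z = 1 ↔ s.nat 43 0 z = 1 ∨
      ((s.nat 42 u z = 1 ∨ s.nat 42 v z = 1) ∧ ¬ (s.nat 42 u z = 1 ∧ s.nat 42 v z = 1))) ∧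
    (∀ z < n, ∀ y < n, (blossomProg.run s).nat 42 z y = 1 ↔ s.nat 42 z y = 1 ∨
      (s.nat 42 z z = 1 ∧ (∀ x < n, s.nat 42 u x = 1 → s.nat 42 v x = 1 → s.nat 42 z x = 1) ∧
        (s.nat 42 u y = 1 ∨ s.nat 42 v y = 1))) := by
  classical
  rw [blossomProg]
  simp only [run]
  generalize h1 : Prog.run (assign 44 _) s = s1
  generalize h2 : Prog.run (assignRow 43 _ _) s1 = s2
  generalize h3 : Prog.run (assignRow 47 _ _) s2 = s3
  have e1 : ∀ a ∉ [44, 20, 21, 22, 23], s1.nat a = s.nat a := fun a ha => by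
    rw [← h1]
    refine run_nat ?_ s
    simp [assign, writes, ret, set, blossomEntry] at ha ⊢
    tauto
  have e2 : ∀ a ∉ [43, 21, 22, 23], s2.nat a = s1.nat a := fun a ha => by
    rw [← h2]
    refine run_nat ?_ s1
    simp [assignRow, writes, ret, set] at ha ⊢
    tauto
  have e3 : ∀ a ∉ [47, 21, 22, 23, 34, 35], s3.nat a = s2.nat a := fun a ha => by
    rw [← h3]
    refine run_nat ?_ s2
    simp [assignRow, writes, ret, set, all] at ha ⊢
    tauto
  have q8 : s2.nat 8 = s.nat 8 := by rw [e2 8 (by decide), e1 8 (by decide)]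
  have q42 : s2.nat 42 = s.nat 42 := by rw [e2 42 (by decide), e1 42 (by decide)]
  have q30 : s2.nat 30 = s.nat 30 := by rw [e2 30 (by decide), e1 30 (by decide)]
  have q31 : s2.nat 31 = s.nat 31 := by rw [e2 31 (by decide), e1 31 (by decide)]
  refine ⟨fun a ha z hz => ?_, fun z hz => ?_, fun z hz y hy => ?_⟩
  · rw [run_nat (by decide), e3 44 (by decide), e2 44 (by decide), ← h1,
      assign_spec (fun a z => if s.nat 43 0 a = 1 then s.nat 44 a z
      else if s.nat 42 u a = 1 then
        (if z = u then v else if z = v then u else if z = a then a else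
          if s.nat 42 u z = 1 ∧ ¬ s.nat 42 a z = 1 then s.nat 44 u z else s.nat 44 v z)
      else (if z = v then u else if z = u then v else if z = a then a else
          if s.nat 42 v z = 1 ∧ ¬ s.nat 42 a z = 1 then s.nat 44 v z else s.nat 44 u z))
      (by decide) (by decide), if_pos (by omega)]
    intro i j t hi hj hx hy hF
    have f1 : t.nat 44 = s.nat 44 := hF.1 44 (by decide)
    have f2 : t.nat 30 = s.nat 30 := hF.1 30 (by decide)
    have f3 : t.nat 31 = s.nat 31 := hF.1 31 (by decide)
    have f4 : t.nat 43 = s.nat 43 := hF.1 43 (by decide)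
    have f5 : t.nat 42 = s.nat 42 := hF.1 42 (by decide)
    simp only [run, blossomEntry, BExp.Holds, isOne_holds, eqN_holds, ite_nat, ret_nat, NExp.eval,
      var, f1, f2, f3, f4, f5, hx, hy, hv, hu]
  · rw [run_nat (by decide), e3 43 (by decide), ← h2, assignRow_spec 0 (fun z =>
      if s.nat 43 0 z = 1 ∨ ((s.nat 42 u z = 1 ∨ s.nat 42 v z = 1) ∧
        ¬ (s.nat 42 u z = 1 ∧ s.nat 42 v z = 1)) then 1 else 0)
      (by decide) (by decide) (fun _ _ => rfl), if_pos (by rw [e1 8 (by decide)]; omega)]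
    · exact ite_one_iff
    intro j t hj hx hF
    have f2 : t.nat 30 = s.nat 30 := by rw [hF.1 30 (by decide), e1 30 (by decide)]
    have f1 : t.nat 43 = s.nat 43 := by rw [hF.1 43 (by decide), e1 43 (by decide)]
    have f3 : t.nat 31 = s.nat 31 := by rw [hF.1 31 (by decide), e1 31 (by decide)]
    have f4 : t.nat 42 = s.nat 42 := by rw [hF.1 42 (by decide), e1 42 (by decide)]
    simp only [run, BExp.Holds, orB_holds, isOne_holds, ite_nat, ret_nat, NExp.eval, var,
      f1, f2, f3, f4, hx, hu, hv]
  -- The condition with a quantifier over all vertices needs a loop of its own.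
  · have h47 : ∀ z < n, s3.nat 47 0 z =
        if ∀ x < n, s.nat 42 u x = 1 → s.nat 42 v x = 1 → s.nat 42 z x = 1 then 1 else 0 := by
      intro z hz
      rw [← h3, assignRow_spec 0 (fun z =>
        if ∀ x < n, s.nat 42 u x = 1 → s.nat 42 v x = 1 → s.nat 42 z x = 1 then 1 else 0)
        (by decide) (by decide) (fun _ _ => rfl), if_pos (by rw [q8]; omega)]
      intro j t hj hx hF
      have f8 : t.nat 8 = s.nat 8 := by rw [hF.1 8 (by decide), q8]
      have f2 : t.nat 30 = s.nat 30 := by rw [hF.1 30 (by decide), q30]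
      have f3 : t.nat 31 = s.nat 31 := by rw [hF.1 31 (by decide), q31]
      have f4 : t.nat 42 = s.nat 42 := by rw [hF.1 42 (by decide), q42]
      have h := all_spec (y := 35) (x := 34) (b := 0) (s := t)
        (c := .ite (.and (.and (isOne 42 (var 31) (var 34)) (isOne 42 (var 30) (var 34)))
            (.not (isOne 42 (var 21) (var 34)))) (set 35 (.const 0)) .skip) (by decide) (by decide)
        (fun x => s.nat 42 u x = 1 → s.nat 42 v x = 1 → s.nat 42 j x = 1) ?_
      · rw [f8, hn] at h
        simp only [run, ret_nat, NExp.eval, var]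
        exact h
      · intro x t' hx' hx'' hF'
        have g1 : t'.nat 21 = t.nat 21 := hF'.1 21 (by decide)
        have g2 : t'.nat 30 = s.nat 30 := by rw [hF'.1 30 (by decide), f2]
        have g3 : t'.nat 31 = s.nat 31 := by rw [hF'.1 31 (by decide), f3]
        have g4 : t'.nat 42 = s.nat 42 := by rw [hF'.1 42 (by decide), f4]
        simp only [run, BExp.Holds, isOne_holds, ite_nat, set, State.setNat_nat_self, NExp.eval,
          var, g1, g2, g3, g4, hx, hx'', hu, hv]
        grind
    have p42 : s3.nat 42 = s.nat 42 := by rw [e3 42 (by decide), q42]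
    rw [assign_spec (fun z y => if s.nat 42 z y = 1 ∨ (s.nat 42 z z = 1 ∧ s3.nat 47 0 z = 1 ∧
        (s.nat 42 u y = 1 ∨ s.nat 42 v y = 1)) then 1 else 0) (by decide) (by decide),
      if_pos (by rw [e3 8 (by decide), q8]; omega)]
    · rw [h47 z hz, ite_one_iff, ite_one_iff]
    intro i j t hi hj hx hy hF
    have f1 : t.nat 42 = s.nat 42 := by rw [hF.1 42 (by decide), p42]
    have f2 : t.nat 30 = s.nat 30 := by rw [hF.1 30 (by decide), e3 30 (by decide), q30]
    have f3 : t.nat 31 = s.nat 31 := by rw [hF.1 31 (by decide), e3 31 (by decide), q31]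
    have f4 : t.nat 47 = s3.nat 47 := hF.1 47 (by decide)
    simp only [run, BExp.Holds, orB_holds, isOne_holds, ite_nat, ret_nat, NExp.eval, var,
      f1, f2, f3, f4, hx, hy, hu, hv]

/-- Store the matching augmented by the edge from the vertex in `30` to the vertex in `31`. -/
def augmentProg : Prog :=
  .seq (assignRow 46 (.const 0) (.ite (eqN (var 21) (var 30)) (ret (var 31))
    (.ite (eqN (var 21) (var 31)) (ret (var 30)) (ret (.get 44 (var 30) (var 21))))))
    (set 45 (.const 1))

theorem augmentProg_spec {s : State} {n v u : ℕ} (hn : s.nat 8 0 0 = n) (hv : s.nat 30 0 0 = v)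
    (hu : s.nat 31 0 0 = u) : (augmentProg.run s).nat 45 0 0 = 1 ∧
    ∀ z < n, (augmentProg.run s).nat 46 0 z =
      if z = v then u else if z = u then v else s.nat 44 v z := by
  rw [augmentProg]
  refine ⟨State.setNat_nat_self, fun z hz => ?_⟩
  simp only [run]
  rw [run_nat (by decide), assignRow_spec 0 (fun z =>
    if z = v then u else if z = u then v else s.nat 44 v z) (by decide) (by decide)
    (fun _ _ => rfl), if_pos (by omega)]
  intro j t hj hx hF
  have f1 : t.nat 44 = s.nat 44 := hF.1 44 (by decide)
  have f2 : t.nat 30 = s.nat 30 := hF.1 30 (by decide)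
  have f3 : t.nat 31 = s.nat 31 := hF.1 31 (by decide)
  simp only [run, eqN_holds, ite_nat, ret_nat, NExp.eval, var, f1, f2, f3, hx, hu, hv]

/-! ### Correctness and termination of the search -/

/-- One step of the search, for the edge from the vertex in `30` to the vertex in `31`. -/
def stepProg : Prog :=
  let v := var 30
  let u := var 31
  .ite (.and (eqN (var 45) (.const 0)) (.and (isOne 43 (.const 0) v) (.and (isOne 1 v u)
      (.and (isOne 40 (.const 0) v) (isOne 40 (.const 0) u)))))
    (.ite (isOne 42 u u)
      (.ite (.and (isOne 43 (.const 0) u) (.not (.and (isOne 42 u v) (isOne 42 v u))))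
        blossomProg .skip)
      (.ite (eqN (entry 41 u) u) augmentProg growProg))
    .skip

/-- The search for an augmenting path from the vertex in `33`. -/
def searchProg : Prog :=
  .seq (assign 42 (.ite (.and (eqN (var 20) (var 33)) (eqN (var 21) (var 33)))
      (ret (.const 1)) (ret (.const 0))))
    (.seq (assignRow 43 (.const 0) (.ite (eqN (var 21) (var 33)) (ret (.const 1)) (ret (.const 0))))
      (.seq (assign 44 (ret (entry 41 (var 21))))
        (.seq (set 45 (.const 0)) (.loop 32 1 (.loop 30 0 (.loop 31 0 stepProg))))))

/-- The input of a search. -/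
structure SearchEnv {n : ℕ} (G : Fin n → Fin n → Prop) (M : Fin n → Fin n) (r : Fin n)
    (s : State) : Prop where
  size : s.nat 8 0 0 = n
  adj : ∀ u v : Fin n, G u v ↔ s.nat 1 u v = 1 ∧ s.nat 40 0 u = 1 ∧ s.nat 40 0 v = 1
  mate : ∀ z : Fin n, s.nat 41 0 z = M z
  root : s.nat 33 0 0 = r

/-- The memory holds an alternating forest. -/
def Searching {n : ℕ} (G : Fin n → Fin n → Prop) (M : Fin n → Fin n) (r : Fin n)
    (s : State) : Prop :=
  s.nat 45 0 0 = 0 ∧ ∃ O T N, Forest G M r O T N ∧ (∀ z : Fin n, s.nat 43 0 z = 1 ↔ O z) ∧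
    (∀ z y : Fin n, s.nat 42 z y = 1 ↔ T z y) ∧ ∀ v z : Fin n, s.nat 44 v z = N v z

/-- The memory holds a matching that covers more than `M`. -/
def Augmented {n : ℕ} (G : Fin n → Fin n → Prop) (M : Fin n → Fin n) (r : Fin n)
    (s : State) : Prop :=
  s.nat 45 0 0 = 1 ∧ ∃ σ : Fin n → Fin n, (∀ z : Fin n, s.nat 46 0 z = σ z) ∧ IsMate G σ ∧
    ∀ z, M z ≠ z ∨ z = r → σ z ≠ z

/-- The number of labels in the forest. -/
def labels (n : ℕ) (s : State) : ℕ :=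
  (Finset.univ.filter fun z : Fin n => s.nat 42 z z = 1).card +
    (Finset.univ.filter fun z : Fin n => s.nat 43 0 z = 1).card

/-- The edge from `v` to `u` admits a step of the search. -/
def Eligible {n : ℕ} (G : Fin n → Fin n → Prop) (s : State) (v u : Fin n) : Prop :=
  s.nat 43 0 v = 1 ∧ G v u ∧ (s.nat 42 u u = 1 → s.nat 43 0 u = 1 ∧
    ¬ (s.nat 42 u v = 1 ∧ s.nat 42 v u = 1))

/-- Growing and shrinking both create an outer vertex and remove no label, so this measure covers
both. -/
theorem labels_lt {n : ℕ} {s t : State}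
    (h1 : ∀ z : Fin n, s.nat 42 z z = 1 → t.nat 42 z z = 1)
    (h2 : ∀ z : Fin n, s.nat 43 0 z = 1 → t.nat 43 0 z = 1)
    (h3 : ∃ z : Fin n, t.nat 43 0 z = 1 ∧ ¬ s.nat 43 0 z = 1) : labels n s < labels n t := by
  refine Nat.add_lt_add_of_le_of_lt (Finset.card_le_card fun z => ?_) (Finset.card_lt_card ?_)
  · simpa using h1 z
  · obtain ⟨z, hz⟩ := h3
    exact Finset.ssubset_iff_of_subset (fun z => by simpa using h2 z) |>.2 ⟨z, by simpa using hz.1,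
      by simpa using hz.2⟩

/-- The tests follow the cases of Edmonds' algorithm for an edge from an outer `v`: an unlabelled
`u` augments or grows, an outer `u` of another blossom shrinks, and every other edge is not
eligible. -/
theorem stepProg_spec {n : ℕ} {G : Fin n → Fin n → Prop} {M : Fin n → Fin n} {r : Fin n}
    {s : State} {v u : Fin n} (hG : ∀ x y, G x y → G y x) (hM : IsMate G M)
    (hs : SearchEnv G M r s) (hS : Searching G M r s) (hv : s.nat 30 0 0 = v)
    (hu : s.nat 31 0 0 = u) :
    Augmented G M r (stepProg.run s) ∨ (Searching G M r (stepProg.run s) ∧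
      ((labels n s < labels n (stepProg.run s) ∧ Eligible G s v u) ∨
        (stepProg.run s = s ∧ ¬ Eligible G s v u))) := by
  classical
  obtain ⟨h0, O, T, N, hF, hO, hT, hN⟩ := hS
  have hadj := hs.adj v u
  have hmu := hs.mate u
  simp only [stepProg, run, BExp.Holds, eqN_holds, isOne_holds, NExp.eval, var, entry, hv, hu, h0,
    true_and, ← hadj, hO, hT, hmu]
  by_cases hc : O v ∧ G v u
  swap
  · rw [if_neg hc]
    exact Or.inr ⟨⟨h0, O, T, N, hF, hO, hT, hN⟩, Or.inr ⟨rfl, fun h => hc ⟨(hO v).1 h.1, h.2.1⟩⟩⟩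
  rw [if_pos hc]
  by_cases hTu : T u u
  · rw [if_pos hTu]
    by_cases hb : O u ∧ ¬ (T u v ∧ T v u)
    · rw [if_pos hb]
      obtain ⟨b1, b2, b3⟩ := blossomProg_spec hs.size hv hu
      have hF' := hF.blossom hM hG hc.1 hb.1 hc.2
      refine Or.inr ⟨⟨?_, _, _, _, hF', fun z => ?_, fun z y => ?_, fun a z => ?_⟩, Or.inl ⟨?_,
        (hO v).2 hc.1, hc.2, fun _ => by rwa [hO, hT, hT]⟩⟩
      · rw [run_nat (by decide), h0]
      · rw [b2 z z.2, hO, hT, hT]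
      · rw [b3 z z.2 y y.2]
        simp only [hT]
        have : (∀ x < n, s.nat 42 u x = 1 → s.nat 42 v x = 1 → s.nat 42 z x = 1) ↔
            ∀ x, T u x → T v x → T z x := by
          simp only [← hT]
          exact ⟨fun h x => h x x.2, fun h x hx => h ⟨x, hx⟩⟩
        rw [this]
      · rw [b1 a a.2 z z.2]
        simp only [hO, hT, hN, Fin.val_inj]
        by_cases h1 : O a
        · simp only [if_pos h1]
        · by_cases h2 : T u a
          · simp only [if_neg h1, if_pos h2, Forest.blossomMate]
            split_ifs <;> rfl
          · simp only [if_neg h1, if_neg h2, Forest.blossomMate]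
            split_ifs <;> rfl
      · refine labels_lt (fun z hz => ?_) (fun z hz => ?_) ?_
        · exact (b3 z z.2 z z.2).2 (Or.inl hz)
        · exact (b2 z z.2).2 (Or.inl hz)
        · obtain ⟨a, h1, h2, h3⟩ := hF.exists_new_outer hM hc.1 hb.1 hb.2
          refine ⟨a, (b2 a a.2).2 (Or.inr ?_), by rwa [hO]⟩
          rwa [hT, hT]
    · rw [if_neg hb]
      refine Or.inr ⟨⟨h0, O, T, N, hF, hO, hT, hN⟩, Or.inr ⟨rfl, fun h => hb ?_⟩⟩
      have := h.2.2 ((hT u u).2 hTu)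
      rwa [hO, hT, hT] at this
  rw [if_neg hTu]
  by_cases hMu : M u = u
  · rw [if_pos (by rw [hMu])]
    obtain ⟨b1, b2⟩ := augmentProg_spec hs.size hv hu
    obtain ⟨c1, c2⟩ := hF.augment hG hc.1 hc.2 hTu hMu
    refine Or.inl ⟨b1, _, fun z => ?_, c1, fun z hz => (c2 z).2 (by tauto)⟩
    rw [b2 z z.2]
    simp only [hN, Fin.val_inj]
    split_ifs <;> rfl
  · rw [if_neg (by rwa [Fin.val_inj])]
    obtain ⟨b1, b2, b3⟩ := growProg_spec hs.size hv hu hmu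
    have hw : ¬ T (M u) (M u) := fun h => hTu (by simpa [hM.invol] using hF.mate_lab h)
    refine Or.inr ⟨⟨?_, _, _, _, hF.grow hM hG hc.1 hc.2 hTu hMu, fun z => ?_, fun z y => ?_,
      fun a z => ?_⟩, Or.inl ⟨?_, (hO v).2 hc.1, hc.2, fun h => absurd ((hT u u).1 h) hTu⟩⟩
    · rw [run_nat (by decide), h0]
    · rw [b2 z z.2]
      simp only [Fin.val_inj]
      by_cases hz : z = M u <;> simp [hz, hO]
    · rw [b3 z z.2 y y.2]
      simp only [Fin.val_inj]
      split_ifs <;> (try rw [hT]) <;> tauto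
    · rw [b1 a a.2 z z.2]
      simp only [hN, Fin.val_inj]
      split_ifs <;> rfl
    · refine labels_lt (fun z hz => ?_) (fun z hz => ?_) ⟨M u, ?_, ?_⟩
      · have h1 : z ≠ u := fun h => hTu (by rw [← h, ← hT]; exact hz)
        have h2 : z ≠ M u := fun h => hw (by rw [← h, ← hT]; exact hz)
        rw [b3 z z.2 z z.2]
        simp only [Fin.val_inj]
        rw [if_neg h1, if_neg h2, hz]
      · rw [b2 z z.2, hz]
        simp
      · rw [b2 _ (M u).2, if_pos rfl]
      · exact fun h => hw (hF.outer_lab ((hO _).1 h))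

theorem SearchEnv.congr {n : ℕ} {G : Fin n → Fin n → Prop} {M : Fin n → Fin n} {r : Fin n}
    {s t : State} (hs : SearchEnv G M r s) (h : ∀ a ∈ [1, 8, 33, 40, 41], t.nat a = s.nat a) :
    SearchEnv G M r t := by
  simp only [List.mem_cons, List.not_mem_nil, or_false, forall_eq_or_imp, forall_eq] at h
  obtain ⟨h1, h2, h3, h4, h5⟩ := h
  exact ⟨by rw [h2, hs.size], by rw [h1, h4]; exact hs.adj, by rw [h5]; exact hs.mate,
    by rw [h3, hs.root]⟩

theorem Searching.congr {n : ℕ} {G : Fin n → Fin n → Prop} {M : Fin n → Fin n} {r : Fin n}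
    {s t : State} (hs : Searching G M r s) (h : ∀ a ∈ [42, 43, 44, 45], t.nat a = s.nat a) :
    Searching G M r t := by
  simp only [List.mem_cons, List.not_mem_nil, or_false, forall_eq_or_imp, forall_eq] at h
  obtain ⟨h1, h2, h3, h4⟩ := h
  unfold Searching at hs ⊢
  rwa [h1, h2, h3, h4]

theorem Augmented.congr {n : ℕ} {G : Fin n → Fin n → Prop} {M : Fin n → Fin n} {r : Fin n}
    {s t : State} (hs : Augmented G M r s) (h : ∀ a ∈ [45, 46], t.nat a = s.nat a) :
    Augmented G M r t := by
  simp only [List.mem_cons, List.not_mem_nil, or_false, forall_eq_or_imp, forall_eq] at h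
  obtain ⟨h1, h2⟩ := h
  unfold Augmented at hs ⊢
  rwa [h1, h2]

/-- Loops cannot be left early, so after an augmentation the remaining iterations must run idle. -/
theorem stepProg_of_augmented {s : State} (h : s.nat 45 0 0 = 1) : stepProg.run s = s := by
  simp [stepProg, run, BExp.Holds, eqN_holds, var, NExp.eval, h]

/-- The outcome of a part of the search that started in `s` and looked at the pairs `Q`: it
augmented the matching, or it added labels, or it found no eligible pair. -/
def Progress {n : ℕ} (G : Fin n → Fin n → Prop) (M : Fin n → Fin n) (r : Fin n) (s : State)
    (Q : Fin n → Fin n → Prop) (t : State) : Prop :=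
  Augmented G M r t ∨ (Searching G M r s ∧ Searching G M r t ∧
    ((labels n s < labels n t ∧ ∃ v u, Eligible G s v u) ∨
      ((∀ a ∈ [42, 43], t.nat a = s.nat a) ∧ ∀ v u, Q v u → ¬ Eligible G s v u)))

theorem labels_congr {n : ℕ} {s t : State} (h : ∀ a ∈ [42, 43], t.nat a = s.nat a) :
    labels n t = labels n s := by
  simp only [List.mem_cons, List.not_mem_nil, or_false, forall_eq_or_imp, forall_eq] at h
  simp only [labels, h.1, h.2]

theorem Progress.congr {n : ℕ} {G : Fin n → Fin n → Prop} {M : Fin n → Fin n} {r : Fin n}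
    {s t t' : State} {Q Q' : Fin n → Fin n → Prop} (h : Progress G M r s Q t)
    (ht : ∀ a ∈ [42, 43, 44, 45, 46], t'.nat a = t.nat a) (hQ : ∀ v u, Q' v u → Q v u) :
    Progress G M r s Q' t' := by
  have h1 : ∀ a ∈ [42, 43], t'.nat a = t.nat a := fun a ha => ht a (by simp at ha ⊢; tauto)
  rcases h with h | ⟨h0, h, h'⟩
  · exact Or.inl (h.congr fun a ha => ht a (by simp at ha ⊢; tauto))
  · refine Or.inr ⟨h0, h.congr fun a ha => ht a (by simp at ha ⊢; tauto), ?_⟩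
    rcases h' with h' | ⟨h', h''⟩
    · exact Or.inl (by rwa [labels_congr h1])
    · exact Or.inr ⟨fun a ha => (h1 a ha).trans (h' a ha), fun v u h => h'' v u (hQ v u h)⟩

/-- As long as no label has been added, the arrays that define eligibility are as in `s`, so a
failed test now is a failed test at the start of the pass. After a label has been added, nothing
about the remaining pairs has to be remembered. -/
theorem progress_step {n : ℕ} {G : Fin n → Fin n → Prop} {M : Fin n → Fin n} {r : Fin n}
    {s t : State} {Q : Fin n → Fin n → Prop} (hG : ∀ x y, G x y → G y x) (hM : IsMate G M)
    (hs : SearchEnv G M r t) (h : Progress G M r s Q t) {v u : Fin n} (hv : t.nat 30 0 0 = v)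
    (hu : t.nat 31 0 0 = u) :
    Progress G M r s (fun v' u' => Q v' u' ∨ (v' = v ∧ u' = u)) (stepProg.run t) := by
  rcases h with h | ⟨h0, h, h'⟩
  · rw [stepProg_of_augmented h.1]
    exact Or.inl h
  rcases stepProg_spec hG hM hs h hv hu with h1 | ⟨h1, h2⟩
  · exact Or.inl h1
  refine Or.inr ⟨h0, h1, ?_⟩
  rcases h' with h' | ⟨h', h''⟩
  · left
    rcases h2 with h2 | ⟨h2, -⟩
    · exact ⟨h'.1.trans h2.1, h'.2⟩
    · rwa [h2]
  · have h4 : ∀ v u, Eligible G t v u ↔ Eligible G s v u := by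
      intro v u
      simp only [List.mem_cons, List.not_mem_nil, or_false, forall_eq_or_imp, forall_eq] at h'
      unfold Eligible
      rw [h'.1, h'.2]
    rcases h2 with h2 | ⟨h2, h3⟩
    · exact Or.inl ⟨by rw [← labels_congr h']; exact h2.1, v, u, (h4 v u).1 h2.2⟩
    · refine Or.inr ⟨by rwa [h2], ?_⟩
      rintro v' u' (h4 | ⟨rfl, rfl⟩)
      · exact h'' v' u' h4
      · rwa [← h4]

theorem pass_spec {n : ℕ} {G : Fin n → Fin n → Prop} {M : Fin n → Fin n} {r : Fin n}
    {s : State} (hG : ∀ x y, G x y → G y x) (hM : IsMate G M) (hs : SearchEnv G M r s)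
    (h : Augmented G M r s ∨ Searching G M r s) :
    Progress G M r s (fun _ _ => True) ((loop 30 0 (loop 31 0 stepProg)).run s) := by
  have key := loop_induct (x := 30) (b := 0) (c := loop 31 0 stepProg) (s := s)
    (fun j t => Progress G M r s (fun v _ => v.val < j) t) ?_ ?_
  · rw [hs.size] at key
    exact key.congr (fun _ _ => rfl) fun v u _ => v.2
  · have h0 : Progress G M r s (fun v _ => v.val < 0) s := by
      rcases h with h | h
      · exact Or.inl h
      · exact Or.inr ⟨h, h, Or.inr ⟨fun _ _ => rfl, fun v u h => absurd h (by omega)⟩⟩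
    refine h0.congr (fun a ha => State.setNat_nat_of_ne ?_) fun _ _ h => h
    rintro rfl
    revert ha
    decide
  · intro j t hj hx hF hP
    rw [hs.size] at hj
    have ht : SearchEnv G M r t := hs.congr fun a ha => hF.1 a (by revert a; decide)
    -- The pairs examined so far are those that precede `(j, i)` lexicographically.
    have key2 := loop_induct (x := 31) (b := 0) (c := stepProg) (s := t)
      (fun i t' => Progress G M r s (fun v u => v.val < j ∨ (v.val = j ∧ u.val < i)) t') ?_ ?_
    · rw [ht.size] at key2
      refine key2.congr (fun a ha => State.setNat_nat_of_ne ?_) fun v u hv => ?_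
      · rintro rfl
        revert ha
        decide
      · rcases Nat.lt_succ_iff_lt_or_eq.1 hv with h | h
        exacts [Or.inl h, Or.inr ⟨h, u.2⟩]
    · refine hP.congr (fun a ha => State.setNat_nat_of_ne ?_) fun v u hv => by omega
      rintro rfl
      revert ha
      decide
    · intro i t' hi hx' hF' hP'
      rw [ht.size] at hi
      have ht' : SearchEnv G M r t' := ht.congr fun a ha => hF'.1 a (by revert a; decide)
      have h30 : t'.nat 30 0 0 = j := by rw [hF'.1 30 (by decide), hx]
      have := progress_step hG hM ht' hP' (v := ⟨j, hj⟩) (u := ⟨i, hi⟩) h30 hx'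
      refine this.congr (fun a ha => State.setNat_nat_of_ne ?_) fun v u hv => ?_
      · rintro rfl
        revert ha
        decide
      · simp only [Fin.ext_iff]
        omega

/-- A pass over all pairs that starts with an eligible pair augments or adds a label. There are at
most `2 * n` labels, so after `2 * n + 1` passes without augmentation no pair is eligible, and
`Forest.barrier` applies. -/
theorem searchProg_spec {n : ℕ} {G : Fin n → Fin n → Prop} {M : Fin n → Fin n} {r : Fin n}
    {s : State} (hG : ∀ x y, G x y → G y x) (hM : IsMate G M) (hr : M r = r)
    (hs : SearchEnv G M r s) (hb : s.nat 8 1 0 = 2 * n + 1) :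
    Augmented G M r (searchProg.run s) ∨ ((searchProg.run s).nat 45 0 0 = 0 ∧
      ∀ σ, IsMate G σ → ∃ z, (M z ≠ z ∨ z = r) ∧ σ z = z) := by
  classical
  rw [searchProg]
  simp only [run_seq]
  generalize h1 : Prog.run (assign 42 _) s = s1
  generalize h2 : Prog.run (assignRow 43 _ _) s1 = s2
  generalize h3 : Prog.run (assign 44 _) s2 = s3
  generalize h4 : Prog.run (set 45 _) s3 = s4
  have e1 : ∀ a ∉ [42, 20, 21, 22, 23], s1.nat a = s.nat a := fun a ha => by
    rw [← h1]
    refine run_nat ?_ s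
    simp [assign, writes, ret, set] at ha ⊢
    tauto
  have e2 : ∀ a ∉ [43, 21, 22, 23], s2.nat a = s1.nat a := fun a ha => by
    rw [← h2]
    refine run_nat ?_ s1
    simp [assignRow, writes, ret, set] at ha ⊢
    tauto
  have e3 : ∀ a ∉ [44, 20, 21, 22, 23], s3.nat a = s2.nat a := fun a ha => by
    rw [← h3]
    refine run_nat ?_ s2
    simp [assign, writes, ret, set] at ha ⊢
    tauto
  have e4 : ∀ a ∉ [45], s4.nat a = s3.nat a := fun a ha => by
    rw [← h4]
    exact run_nat ha s3
  have e : ∀ a ∈ [1, 8, 33, 40, 41], s4.nat a = s.nat a := fun a ha => by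
    rw [e4 a (by revert a; decide), e3 a (by revert a; decide), e2 a (by revert a; decide),
      e1 a (by revert a; decide)]
  have hs4 : SearchEnv G M r s4 := hs.congr e
  have hinit : Searching G M r s4 := by
    refine ⟨by rw [← h4]; exact State.setNat_nat_self, _, _, _, Forest.init hM hr, fun z => ?_,
      fun z y => ?_, fun v z => ?_⟩
    · rw [e4 43 (by decide), e3 43 (by decide), ← h2, assignRow_spec 0 (fun z => if z = r then 1
        else 0) (by decide) (by decide) (fun _ _ => rfl),
        if_pos ⟨rfl, by rw [e1 8 (by decide), hs.size]; exact z.2⟩, ite_one_iff, Fin.val_inj]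
      intro j t hj hx hF
      have f1 : t.nat 33 = s.nat 33 := by rw [hF.1 33 (by decide), e1 33 (by decide)]
      simp only [run, eqN_holds, ite_nat, ret_nat, NExp.eval, var, f1, hx, hs.root]
    · rw [e4 42 (by decide), e3 42 (by decide), e2 42 (by decide), ← h1, assign_spec
        (fun z y => if z = r ∧ y = r then 1 else 0) (by decide) (by decide),
        if_pos (by rw [hs.size]; exact ⟨z.2, y.2⟩), ite_one_iff, Fin.val_inj, Fin.val_inj]
      intro i j t hi hj hx hy hF
      have f1 : t.nat 33 = s.nat 33 := hF.1 33 (by decide)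
      simp only [run, BExp.Holds, eqN_holds, ite_nat, ret_nat, NExp.eval, var, f1, hx, hy, hs.root]
    · have h8 : s2.nat 8 0 0 = n := by rw [e2 8 (by decide), e1 8 (by decide), hs.size]
      rw [e4 44 (by decide), ← h3, assign_spec (fun _ z => s.nat 41 0 z) (by decide) (by decide),
        if_pos (by rw [h8]; exact ⟨v.2, z.2⟩), hs.mate]
      intro i j t hi hj hx hy hF
      have f1 : t.nat 41 = s.nat 41 := by
        rw [hF.1 41 (by decide), e2 41 (by decide), e1 41 (by decide)]
      simp only [ret_nat, NExp.eval, var, entry, f1, hy]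
  have hb4 : s4.nat 8 1 0 = 2 * n + 1 := by rw [e 8 (by decide), hb]
  have key := loop_induct (x := 32) (b := 1) (c := loop 30 0 (loop 31 0 stepProg)) (s := s4)
    (fun j t => Augmented G M r t ∨ (Searching G M r t ∧
      (j ≤ labels n t ∨ ∀ v u, ¬ Eligible G t v u))) ?_ ?_
  · rcases key with h | ⟨h, h'⟩
    · exact Or.inl h
    right
    generalize Prog.run (loop 32 1 _) s4 = t at h h'
    have hle : labels n t ≤ 2 * n := by
      have h5 := Finset.card_le_univ (Finset.univ.filter fun z : Fin n => t.nat 42 z z = 1)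
      have h6 := Finset.card_le_univ (Finset.univ.filter fun z : Fin n => t.nat 43 0 z = 1)
      rw [Fintype.card_fin] at h5 h6
      unfold labels
      omega
    -- The number of passes, `2 * n + 1`, exceeds the number of labels.
    have hel : ∀ v u, ¬ Eligible G t v u := h'.resolve_left (by omega)
    obtain ⟨h0, O, T, N, hF, hO, hT, hN⟩ := h
    refine ⟨h0, fun σ hσ => ?_⟩
    by_contra hno
    push Not at hno
    simp only [Eligible, hO, hT] at hel
    refine hF.barrier hM hr (fun v u hv hvu => ?_) (fun v u hv hu hvu => ?_) hσ hno
    · by_contra hc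
      exact hel v u ⟨hv, hvu, fun h => absurd h hc⟩
    · by_contra hc
      exact hel v u ⟨hv, hvu, fun _ => ⟨hu, hc⟩⟩
  · exact Or.inr ⟨hinit.congr fun a ha => State.setNat_nat_of_ne (by rintro rfl; revert ha; decide),
      Or.inl (Nat.zero_le _)⟩
  · intro j t hj hx hF hP
    have ht : SearchEnv G M r t := hs4.congr fun a ha => hF.1 a (by revert a; decide)
    have hP' : Augmented G M r t ∨ Searching G M r t := by tauto
    have h5 := (pass_spec hG hM ht hP').congr (t' := ((loop 30 0 (loop 31 0 stepProg)).run t).setNat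
      32 0 0 (j + 1)) (fun a ha => State.setNat_nat_of_ne (by rintro rfl; revert ha; decide))
      (fun _ _ h => h)
    generalize ((loop 30 0 (loop 31 0 stepProg)).run t).setNat 32 0 0 (j + 1) = t' at h5
    rcases h5 with h5 | ⟨h0, h5, h6⟩
    · exact Or.inl h5
    refine Or.inr ⟨h5, ?_⟩
    rcases h6 with ⟨h6, v, u, h7⟩ | ⟨h6, h7⟩
    · left
      rcases hP with h8 | ⟨-, h8 | h8⟩
      · exact absurd (h8.1.symm.trans h0.1) (by decide)
      · omega
      · exact absurd h7 (h8 v u)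
    · right
      intro v u
      have := h7 v u trivial
      simp only [List.mem_cons, List.not_mem_nil, or_false, forall_eq_or_imp, forall_eq] at h6
      unfold Eligible at this ⊢
      rwa [h6.1, h6.2]

/-! ### Perfect matchings of induced subgraphs -/

/-- Find a perfect matching of the subgraph induced by the set in the array `40`. -/
def matchProg : Prog :=
  .seq (assignRow 41 (.const 0) (ret (var 21))) (.seq (set 48 (.const 1)) (.loop 33 0
    (.ite (.and (isOne 48 (.const 0) (.const 0)) (.and (isOne 40 (.const 0) (var 33))
      (eqN (entry 41 (var 33)) (var 33))))
      (.seq searchProg (.ite (isOne 45 (.const 0) (.const 0))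
        (assignRow 41 (.const 0) (ret (entry 46 (var 21)))) (set 48 (.const 0)))) .skip)))

/-- Augmentation keeps all covered vertices covered, so each vertex of `X` needs to be a root only
once. A failed search rules out every matching that covers the root and the vertices covered so far,
all of which lie in `X`; a perfect matching of `X` would be one. -/
theorem matchProg_spec {n : ℕ} {G : Fin n → Fin n → Prop} {s : State} (X : Finset (Fin n))
    (hG : ∀ x y, G x y → G y x) (hn : s.nat 8 0 0 = n) (hb : s.nat 8 1 0 = 2 * n + 1)
    (hadj : ∀ u v : Fin n, G u v ↔ s.nat 1 u v = 1)
    (hX : ∀ v : Fin n, v ∈ X ↔ s.nat 40 0 v = 1) :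
    ((matchProg.run s).nat 48 0 0 = 1 ∧ ∃ σ : Fin n → Fin n, IsMate G σ ∧
      (∀ z, σ z ≠ z ↔ z ∈ X) ∧ ∀ z : Fin n, (matchProg.run s).nat 41 0 z = σ z) ∨
    ((matchProg.run s).nat 48 0 0 = 0 ∧ ¬ Feasible G X) := by
  classical
  let H : Fin n → Fin n → Prop := fun u v => G u v ∧ u ∈ X ∧ v ∈ X
  have hH : ∀ x y, H x y → H y x := fun x y h => ⟨hG x y h.1, h.2.2, h.2.1⟩
  rw [matchProg]
  simp only [run_seq]
  generalize h1 : Prog.run (assignRow 41 _ _) s = s1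
  generalize h2 : Prog.run (set 48 _) s1 = s2
  generalize hbody : Prog.ite _ (Prog.seq searchProg _) _ = body
  have e2 : ∀ a ∉ [41, 21, 22, 23, 48], s2.nat a = s.nat a := fun a ha => by
    rw [← h2, ← h1, run_nat, run_nat]
    · simp [assignRow, writes, ret, set] at ha ⊢
      tauto
    · simp [writes, set] at ha ⊢
      tauto
  have hw : ∀ a ∈ body.writes, a ∉ [1, 8, 33, 40] := by
    rw [← hbody]
    decide
  let P : ℕ → State → Prop := fun j t =>
    (t.nat 48 0 0 = 1 ∧ ∃ σ : Fin n → Fin n, IsMate H σ ∧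
      (∀ z : Fin n, z.val < j → z ∈ X → σ z ≠ z) ∧ ∀ z : Fin n, t.nat 41 0 z = σ z) ∨
    (t.nat 48 0 0 = 0 ∧ ¬ Feasible G X)
  have hP : ∀ {j t t'}, (∀ a ∈ [41, 48], t'.nat a = t.nat a) → P j t → P j t' := by
    intro j t t' h hP
    simp only [List.mem_cons, List.not_mem_nil, or_false, forall_eq_or_imp, forall_eq] at h
    simp only [P] at hP ⊢
    rwa [h.1, h.2]
  have key := loop_induct (x := 33) (b := 0) (c := body) (s := s2) P ?_ ?_
  · rcases key with ⟨h3, σ, h4, h5, h6⟩ | h3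
    · refine Or.inl ⟨h3, σ, ⟨h4.invol, fun z hz => (h4.adj z hz).1⟩, fun z =>
        ⟨fun hz => (h4.adj z hz).2.1, fun hz => h5 z ?_ hz⟩, h6⟩
      rw [e2 8 (by decide), hn]
      exact z.2
    · exact Or.inr h3
  · refine hP (t := s2) (fun a ha => State.setNat_nat_of_ne (by rintro rfl; revert ha; decide)) ?_
    refine Or.inl ⟨by rw [← h2]; exact State.setNat_nat_self, id, ⟨fun _ => rfl, fun z h =>
      absurd rfl h⟩, fun z h => absurd h (by omega), fun z => ?_⟩
    rw [← h2, run_nat (by decide), ← h1, assignRow_spec 0 (fun z => z) (by decide) (by decide)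
      (fun _ _ => rfl), if_pos ⟨rfl, by rw [hn]; exact z.2⟩, id]
    intro j t hj hx hF
    simp only [ret_nat, NExp.eval, var, hx]
  · intro j t hj hx hF hPj
    have f : ∀ a ∈ [1, 8, 40], t.nat a = s.nat a := fun a ha => by
      rw [hF.1 a ?_, e2 a (by revert a; decide)]
      simp only [List.mem_cons, not_or]
      exact ⟨by revert a; decide, fun h => hw a h (by clear h; revert a; decide)⟩
    rw [e2 8 (by decide), hn] at hj
    refine hP (t := body.run t) (fun a ha => State.setNat_nat_of_ne (by
      rintro rfl; revert ha; decide)) ?_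
    rw [← hbody]
    simp only [run, BExp.Holds, isOne_holds, eqN_holds, NExp.eval, var, entry, hx]
    rcases hPj with ⟨h3, σ, h4, h5, h6⟩ | h3
    swap
    · rw [if_neg (by rw [h3.1]; simp)]
      exact Or.inr h3
    have h7 := h6 ⟨j, hj⟩
    have h8 := hX ⟨j, hj⟩
    simp only at h7 h8
    by_cases hc : (⟨j, hj⟩ : Fin n) ∈ X ∧ σ ⟨j, hj⟩ = ⟨j, hj⟩
    swap
    · rw [if_neg]
      · refine Or.inl ⟨h3, σ, h4, fun z hz hzX => ?_, h6⟩
        rcases Nat.lt_succ_iff_lt_or_eq.1 hz with h | h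
        · exact h5 z h hzX
        · obtain rfl : z = ⟨j, hj⟩ := Fin.ext h
          tauto
      · rw [f 40 (by decide), h7, ← h8]
        rintro ⟨-, h9, h10⟩
        exact hc ⟨h9, Fin.ext h10⟩
    rw [if_pos ⟨h3, by rw [f 40 (by decide)]; exact h8.1 hc.1, by rw [h7, hc.2]⟩]
    have henv : SearchEnv H σ ⟨j, hj⟩ t := by
      refine ⟨by rw [f 8 (by decide), hn], fun u v => ?_, h6, hx⟩
      rw [f 1 (by decide), f 40 (by decide), ← hadj, ← hX, ← hX]
    have h8' : t.nat 8 = s.nat 8 := f 8 (by decide)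
    rcases searchProg_spec hH h4 hc.2 henv (by rw [h8', hb]) with ⟨h9, τ, h10, h11, h12⟩ | ⟨h9, h10⟩
    · rw [if_pos h9]
      left
      have h8s : (searchProg.run t).nat 8 0 0 = n := by rw [run_nat (by decide), h8', hn]
      refine ⟨by rw [run_nat (by decide), run_nat (by decide), h3], τ, h11, fun z hz hzX =>
        h12 z ?_, fun z => ?_⟩
      · rcases Nat.lt_succ_iff_lt_or_eq.1 hz with h | h
        · exact Or.inl (h5 z h hzX)
        · exact Or.inr (Fin.ext h)
      · rw [assignRow_spec 0 (fun z => (searchProg.run t).nat 46 0 z) (by decide) (by decide)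
          (fun _ _ => rfl), if_pos ⟨rfl, by rw [h8s]; exact z.2⟩, h10]
        intro j' t' hj' hx' hF'
        have f1 : t'.nat 46 = (searchProg.run t).nat 46 := hF'.1 46 (by decide)
        rw [ret_nat, ← f1, ← hx']
        rfl
    · rw [if_neg (by rw [h9]; decide)]
      refine Or.inr ⟨State.setNat_nat_self, ?_⟩
      rintro ⟨τ, h11, h12⟩
      obtain ⟨z, h13, h14⟩ := h10 τ ⟨h11.invol, fun z hz => ⟨h11.adj z hz, (h12 z).1 hz,
        (h12 _).1 (by rw [h11.invol]; exact Ne.symm hz)⟩⟩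
      have h15 : z ∉ X := fun h => (h12 z).2 h h14
      rcases h13 with h13 | h13
      · exact h15 (h4.adj z h13).2.1
      · exact h15 (h13 ▸ hc.1)

end Prog
/-! ## Codes of vertex sets -/

theorem sum_digits_lt {b : ℕ} (f : ℕ → ℕ) (hf : ∀ i, f i < b) (m : ℕ) :
    ∑ i ∈ Finset.range m, f i * b ^ i < b ^ m := by
  induction m with
  | zero => simp
  | succ m ih =>
    rw [Finset.sum_range_succ, pow_succ]
    have := Nat.mul_le_mul_right (b ^ m) (Nat.succ_le_of_lt (hf m))
    rw [Nat.succ_mul] at this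
    rw [mul_comm (b ^ m) b]
    omega

theorem digits_eq_of_sum_eq {b : ℕ} {f g : ℕ → ℕ} (hf : ∀ i, f i < b) (hg : ∀ i, g i < b) {m : ℕ}
    (h : ∑ i ∈ Finset.range m, f i * b ^ i = ∑ i ∈ Finset.range m, g i * b ^ i) :
    ∀ i < m, f i = g i := by
  induction m with
  | zero => simp
  | succ m ih =>
    have hb : 0 < b ^ m := pow_pos ((Nat.zero_le _).trans_lt (hf 0)) m
    rw [Finset.sum_range_succ, Finset.sum_range_succ] at h
    have h1 := sum_digits_lt f hf m
    have h2 := sum_digits_lt g hg m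
    -- The lower digits sum to less than `b ^ m`, so division isolates the leading digit.
    have h3 := congrArg (· / b ^ m) h
    simp only [Nat.add_mul_div_right _ _ hb, Nat.div_eq_of_lt h1, Nat.div_eq_of_lt h2,
      zero_add] at h3
    rw [h3] at h
    intro i hi
    rcases Nat.lt_succ_iff_lt_or_eq.1 hi with h4 | rfl
    · exact ih (by omega) i h4
    · exact h3

namespace Input

variable {k n : ℕ} (I : Input k n)

open Classical in
/-- The class of a vertex: its group, or one further class for the vertices without a group. -/
noncomputable def cls (v : Fin n) : Fin (k + 1) :=
  if h : ∃ g, v ∈ I.group g then h.choose.castSucc else Fin.last k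

theorem cls_eq_castSucc_iff {v : Fin n} {g : Fin k} : I.cls v = g.castSucc ↔ v ∈ I.group g := by
  unfold cls
  split
  · rename_i h
    rw [Fin.castSucc_inj]
    refine ⟨fun h' => h' ▸ h.choose_spec, fun h' => ?_⟩
    by_contra hne
    exact Finset.disjoint_left.1 (I.group_disjoint _ _ hne) h.choose_spec h'
  · rename_i h
    exact ⟨fun h' => absurd h' (Fin.castSucc_lt_last g).ne', fun h' => absurd ⟨g, h'⟩ h⟩

/-- The class counts of a set of vertices, as one number. -/
noncomputable def code (F : Finset (Fin n)) : ℕ := ∑ v ∈ F, (n + 1) ^ (I.cls v : ℕ)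

/-- The class count as a function on the natural numbers. -/
noncomputable def digit (F : Finset (Fin n)) (i : ℕ) : ℕ :=
  (F.filter fun v => (I.cls v : ℕ) = i).card

theorem digit_lt (F : Finset (Fin n)) (i : ℕ) : I.digit F i < n + 1 :=
  Nat.lt_succ_of_le ((Finset.card_le_univ _).trans (by simp))

theorem code_eq_sum (F : Finset (Fin n)) :
    I.code F = ∑ i ∈ Finset.range (k + 1), I.digit F i * (n + 1) ^ i := by
  unfold code digit
  rw [← Finset.sum_fiberwise_of_maps_to (g := fun v => (I.cls v : ℕ)) (t := Finset.range (k + 1))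
    fun v _ => by simpa using (I.cls v).2]
  refine Finset.sum_congr rfl fun i _ => ?_
  rw [Finset.sum_congr rfl (g := fun _ => (n + 1) ^ i), Finset.sum_const, smul_eq_mul]
  intro v hv
  rw [(Finset.mem_filter.1 hv).2]

theorem code_lt (F : Finset (Fin n)) : I.code F < (n + 1) ^ (k + 1) := by
  rw [code_eq_sum]
  exact sum_digits_lt _ (I.digit_lt F) _

theorem digit_val (F : Finset (Fin n)) (i : Fin (k + 1)) :
    I.digit F i = classCount I.cls F i := by
  simp only [digit, classCount, Fin.val_inj]

theorem classCount_eq_of_code_eq {F F' : Finset (Fin n)} (h : I.code F = I.code F') :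
    classCount I.cls F = classCount I.cls F' := by
  rw [code_eq_sum, code_eq_sum] at h
  funext i
  rw [← digit_val, ← digit_val]
  exact digits_eq_of_sum_eq (I.digit_lt F) (I.digit_lt F') h i i.2

theorem code_eq_of_classCount_eq {F F' : Finset (Fin n)}
    (h : classCount I.cls F = classCount I.cls F') : I.code F = I.code F' := by
  rw [code_eq_sum, code_eq_sum]
  refine Finset.sum_congr rfl fun i hi => ?_
  have := congrFun h ⟨i, Finset.mem_range.1 hi⟩
  rw [← digit_val, ← digit_val] at this
  rw [this]

/-- Due to the extra class every vertex is counted once. This keeps sets with the same code in the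
same round of the construction of the table. -/
theorem card_eq_of_classCount_eq {F F' : Finset (Fin n)}
    (h : classCount I.cls F = classCount I.cls F') : F.card = F'.card := by
  have key : ∀ A : Finset (Fin n), A.card = ∑ i, classCount I.cls A i := fun A =>
    Finset.card_eq_sum_card_fiberwise (f := I.cls) (t := Finset.univ) (fun _ _ => by simp)
  rw [key, key, h]

theorem classCount_castSucc (F : Finset (Fin n)) (g : Fin k) :
    classCount I.cls F g.castSucc = (F ∩ I.group g).card := by
  unfold classCount
  congr 1
  ext v
  simp [cls_eq_castSucc_iff]

/-- The constraints on the set of covered vertices. -/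
def FairSet (F : Finset (Fin n)) : Prop :=
  ∀ i, (I.lower i ≤ (F ∩ I.group i).card ∧ (F ∩ I.group i).card ≤ I.upper i) ∧
    ∀ j, (i, j) ∈ I.pairs → ((F ∩ I.group i).card : ℝ) ≤ I.ratio i j * (F ∩ I.group j).card

/-- The constraints mention a set only through its numbers of vertices in the groups, so one test
decides for all sets with the same code. -/
theorem FairSet.congr {F F' : Finset (Fin n)} (hF : I.FairSet F)
    (h : classCount I.cls F' = classCount I.cls F) : I.FairSet F' := by
  unfold FairSet at hF ⊢
  simp only [← classCount_castSucc] at hF ⊢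
  rwa [h]

/-- Removing a matching edge from a feasible set. -/
theorem exists_smaller {F : Finset (Fin n)} (hF : Feasible I.graph.Adj F) (hne : F.Nonempty) :
    ∃ F₀, Feasible I.graph.Adj F₀ ∧ F₀.card + 2 = F.card ∧
      ∀ i, |(classCount I.cls F i : ℤ) - classCount I.cls F₀ i| ≤ 2 := by
  obtain ⟨σ, hσ, hσF⟩ := hF
  obtain ⟨x, hx⟩ := hne
  have hinv := hσ.invol
  have hxσ := (hσF x).2 hx
  have hσx : σ x ∈ F := (hσF _).1 (by rw [hinv]; exact hxσ.symm)
  have hcard : (F \ {x, σ x}).card + 2 = F.card := by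
    rw [← Finset.card_pair hxσ.symm]
    refine Finset.card_sdiff_add_card_eq_card fun z hz => ?_
    rcases Finset.mem_insert.1 hz with rfl | hz
    · exact hx
    · rwa [Finset.mem_singleton.1 hz]
  refine ⟨F \ {x, σ x}, ⟨fun z => if z = x ∨ z = σ x then z else σ z, ⟨fun z => ?_, fun z => ?_⟩,
    fun z => ?_⟩, hcard, fun i => ?_⟩
  · have := hinv z
    have := hinv x
    grind
  · have := hσ.adj z
    grind
  · have := hσF z
    simp only [Finset.mem_sdiff, Finset.mem_insert, Finset.mem_singleton]
    grind
  · have h1 : classCount I.cls (F \ {x, σ x}) i ≤ classCount I.cls F i :=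
      Finset.card_le_card (Finset.filter_subset_filter _ Finset.sdiff_subset)
    have h2 : classCount I.cls F i ≤ classCount I.cls (F \ {x, σ x}) i + 2 := by
      unfold classCount
      calc _ ≤ ((F \ {x, σ x}).filter (fun z => I.cls z = i) ∪ {x, σ x}).card := by
            refine Finset.card_le_card fun z hz => ?_
            simp only [Finset.mem_filter, Finset.mem_union, Finset.mem_sdiff] at hz ⊢
            tauto
        _ ≤ _ := (Finset.card_union_le _ _).trans (by rw [Finset.card_pair hxσ.symm])
    rw [abs_le]
    omega

end Input
/-! ## The table of optimal sets -/

namespace Prog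

/-- Change the membership of the vertex in the variable `x` in the set in the array `40`. -/
def toggle (x : ℕ) : Prog :=
  .ite (isOne 40 (.const 0) (var x)) (.setNat 40 (.const 0) (var x) (.const 0))
    (.setNat 40 (.const 0) (var x) (.const 1))

/-- Execute `c` for all sets that arise from the set in the array `40` by at most `m` exchanges. -/
def enumProg : ℕ → Prog → Prog
  | 0, c => c
  -- The loop runs over `n + 1` indices. The index `n` belongs to no vertex, so its toggle is idle
  -- and accounts for fewer than `m + 1` exchanges. The second toggle restores the set.
  | m + 1, c => .loop (100 + m) 5
      (.seq (toggle (100 + m)) (.seq (enumProg m c) (toggle (100 + m))))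

/-- The set in the array `40`. -/
def setOf (n : ℕ) (s : State) : Finset (Fin n) := Finset.univ.filter fun v => s.nat 40 0 v = 1

theorem mem_setOf {n : ℕ} {s : State} {v : Fin n} : v ∈ setOf n s ↔ s.nat 40 0 v = 1 := by
  simp [setOf]

theorem setOf_congr {n : ℕ} {s t : State} (h : t.nat 40 = s.nat 40) : setOf n t = setOf n s := by
  simp only [setOf, h]

theorem toggle_spec {s : State} {x : ℕ} :
    (toggle x).run s = s.setNat 40 0 (s.nat x 0 0) (if s.nat 40 0 (s.nat x 0 0) = 1 then 0
      else 1) := by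
  simp only [toggle, run, isOne_holds, NExp.eval, var]
  split <;> rfl

theorem setOf_toggle {n : ℕ} {s : State} {x : ℕ} :
    setOf n ((toggle x).run s) =
      symmDiff (setOf n s) (Finset.univ.filter fun v : Fin n => v.val = s.nat x 0 0) := by
  ext v
  simp only [mem_setOf, Finset.mem_symmDiff, Finset.mem_filter, Finset.mem_univ, true_and,
    toggle_spec, State.setNat]
  by_cases h : v.val = s.nat x 0 0
  · simp only [h, if_true]
    split <;> simp [*]
  · simp [h]

/-- The names from `100` on are reserved for the counters of the nested loops, which keeps them
apart from each other and from the variables of `c`. -/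
theorem enumProg_writes {m : ℕ} {c : Prog} {a : ℕ} (h : a ∈ (enumProg m c).writes) :
    a ∈ c.writes ∨ a = 40 ∨ (100 ≤ a ∧ a < 100 + m) := by
  induction m with
  | zero => exact Or.inl h
  | succ m ih =>
    simp only [enumProg, writes, toggle, List.mem_cons, List.mem_append, List.not_mem_nil,
      or_false] at h
    rcases h with h | h | h | h
    · omega
    · omega
    · rcases ih h with h | h | h
      · exact Or.inl h
      · exact Or.inr (Or.inl h)
      · omega
    · omega

/-- The enumeration reaches all sets with a bounded symmetric difference. -/
theorem enumProg_spec {n : ℕ} {c : Prog} (Inv : State → Prop) (Hit : Finset (Fin n) → State → Prop)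
    (hcongr : ∀ s t : State, (∀ a < 100, a ≠ 40 → t.nat a = s.nat a) → t.real = s.real →
      (Inv s → Inv t) ∧ ∀ Y, Hit Y s → Hit Y t)
    (hn : ∀ s, Inv s → s.nat 8 5 0 = n + 1)
    (hw : ∀ a ∈ c.writes, a < 100 ∧ a ≠ 40 ∧ a ≠ 8)
    (hc : ∀ s, Inv s → Inv (c.run s) ∧ Hit (setOf n s) (c.run s) ∧ ∀ Y, Hit Y s → Hit Y (c.run s))
    (m : ℕ) (s : State) (hs : Inv s) :
    Inv ((enumProg m c).run s) ∧ setOf n ((enumProg m c).run s) = setOf n s ∧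
    (∀ Y, Hit Y s → Hit Y ((enumProg m c).run s)) ∧
    ∀ D : Finset (Fin n), D.card ≤ m → Hit (symmDiff (setOf n s) D) ((enumProg m c).run s) := by
  induction m generalizing s with
  | zero =>
    obtain ⟨h1, h2, h3⟩ := hc s hs
    refine ⟨h1, setOf_congr (run_nat (fun h => (hw 40 h).2.1 rfl) s), h3, fun D hD => ?_⟩
    obtain rfl := Finset.card_eq_zero.1 (Nat.le_zero.1 hD)
    rw [← Finset.bot_eq_empty, symmDiff_bot]
    exact h2
  | succ m ih =>
    have hself : ∀ (x v : ℕ) (s : State), 100 ≤ x →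
        (Inv s → Inv (s.setNat x 0 0 v)) ∧ ∀ Y, Hit Y s → Hit Y (s.setNat x 0 0 v) :=
      fun x v s hx => hcongr _ _ (fun a ha _ => State.setNat_nat_of_ne (by omega)) rfl
    have htog : ∀ (x : ℕ) (s : State),
        (Inv s → Inv ((toggle x).run s)) ∧ ∀ Y, Hit Y s → Hit Y ((toggle x).run s) := by
      intro x s
      rw [toggle_spec]
      exact hcongr _ _ (fun a _ ha => State.setNat_nat_of_ne ha) rfl
    set body : Prog := .seq (toggle (100 + m)) (.seq (enumProg m c) (toggle (100 + m)))
    have key := loop_induct (x := 100 + m) (b := 5) (c := body) (s := s)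
      (fun j t => Inv t ∧ setOf n t = setOf n s ∧ (∀ Y, Hit Y s → Hit Y t) ∧
        ∀ (i : ℕ) (D : Finset (Fin n)), i < j → D.card ≤ m → Hit (symmDiff (symmDiff (setOf n s)
          (Finset.univ.filter fun v : Fin n => v.val = i)) D) t) ?_ ?_
    · obtain ⟨h1, h2, h3, h4⟩ := key
      refine ⟨h1, h2, h3, fun D hD => ?_⟩
      rw [hn s hs] at h4
      rcases D.eq_empty_or_nonempty with rfl | ⟨v, hv⟩
      -- The idle index `n` handles the case that no vertex is exchanged.
      · have h5 := h4 n ∅ (by omega) (by simp)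
        have h6 : (Finset.univ.filter fun v : Fin n => v.val = n) = ∅ :=
          Finset.filter_eq_empty_iff.2 fun v _ => v.2.ne
        rw [h6, ← Finset.bot_eq_empty, symmDiff_bot, symmDiff_bot] at h5
        rw [← Finset.bot_eq_empty, symmDiff_bot]
        exact h5
      · have h5 := h4 v (D.erase v) (by omega) (by rw [Finset.card_erase_of_mem hv]; omega)
        have h6 : (Finset.univ.filter fun u : Fin n => u.val = v.val) = {v} := by
          ext u
          simp [Fin.ext_iff]
        have h7 : symmDiff {v} (D.erase v) = D := by
          ext u
          simp only [Finset.mem_symmDiff, Finset.mem_singleton, Finset.mem_erase]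
          by_cases h : u = v
          · subst h
            simp [hv]
          · simp [h]
        rwa [h6, symmDiff_assoc, h7] at h5
    · have h := hself (100 + m) 0 s (by omega)
      exact ⟨h.1 hs, setOf_congr (State.setNat_nat_of_ne (by omega)), h.2, fun i D hi =>
        absurd hi (by omega)⟩
    · rintro j t hj hx hF ⟨h1, h2, h3, h4⟩
      have g1 := htog (100 + m) t
      have g1' := setOf_toggle (n := n) (s := t) (x := 100 + m)
      have g1x : ((toggle (100 + m)).run t).nat (100 + m) 0 0 = j := by
        rw [toggle_spec, State.setNat_nat_of_ne (by omega), hx]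
      obtain ⟨a1, a2, a3, a4⟩ := ih _ (g1.1 h1)
      have g2x : ((enumProg m c).run ((toggle (100 + m)).run t)).nat (100 + m) 0 0 = j := by
        rw [run_nat, g1x]
        intro h
        rcases enumProg_writes h with h | h | h
        · have := hw _ h
          omega
        · omega
        · omega
      have g3 := htog (100 + m) ((enumProg m c).run ((toggle (100 + m)).run t))
      have g3' := setOf_toggle (n := n) (s := (enumProg m c).run ((toggle (100 + m)).run t))
        (x := 100 + m)
      have g4 := hself (100 + m) (j + 1) (body.run t) (by omega)
      rw [hx] at g1'
      rw [g2x, a2, g1', symmDiff_assoc, symmDiff_self, symmDiff_bot] at g3'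
      refine ⟨g4.1 (g3.1 a1), ?_, fun Y hY => g4.2 Y (g3.2 Y (a3 Y (g1.2 Y (h3 Y hY)))), ?_⟩
      · rw [setOf_congr (State.setNat_nat_of_ne (by omega)), ← h2]
        exact g3'
      · intro i D hi hD
        rcases Nat.lt_succ_iff_lt_or_eq.1 hi with hi | rfl
        · exact g4.2 _ (g3.2 _ (a3 _ (g1.2 _ (h4 i D hi hD))))
        · have := a4 D hD
          rw [g1', h2] at this
          exact g4.2 _ (g3.2 _ this)

theorem run_ite_pos {b : BExp} {c d : Prog} {s : State} (h : b.Holds s) :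
    (ite b c d).run s = c.run s := if_pos h

theorem run_ite_neg {b : BExp} {c d : Prog} {s : State} (h : ¬ b.Holds s) :
    (ite b c d).run s = d.run s := if_neg h

/-! ### Recording candidates in the table -/

/-- Record the set in the array `40` in the table if it has a perfect matching and a larger weight
than the recorded set with the same code. -/
def testProg : Prog :=
  .seq matchProg (.ite (isOne 48 (.const 0) (.const 0))
    (.seq (sum 55 68 0 (.ite (isOne 40 (.const 0) (var 68))
        (set 55 (.add (var 55) (entry 51 (var 68)))) .skip))
      (.seq (sumReal 3 68 0 (.ite (isOne 40 (.const 0) (var 68))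
          (.setReal 3 (.const 0) (.const 0) (.add (.get 3 (.const 0) (.const 0))
            (.get 0 (var 68) (.const 0)))) .skip))
        (.ite (.and (isOne 60 (var 55) (.const 0))
            (.realLe (.get 3 (.const 0) (.const 0)) (.get 2 (var 55) (.const 0)))) .skip
          (.seq (.setNat 60 (var 55) (.const 0) (.const 1))
            (.seq (assignRow 61 (var 55) (ret (entry 40 (var 21))))
              (.seq (assignRow 62 (var 55) (ret (entry 41 (var 21))))
                (.setReal 2 (var 55) (.const 0) (.get 3 (.const 0) (.const 0)))))))))
    .skip)

variable {k n : ℕ}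

/-- The memory holds the instance and the numbers derived from it. -/
structure Loaded (I : Input k n) (s : State) : Prop where
  size : s.nat 8 0 0 = n
  size₂ : s.nat 8 1 0 = 2 * n + 1
  codes : s.nat 8 2 0 = (n + 1) ^ (k + 1)
  groups : s.nat 8 3 0 = k
  size₁ : s.nat 8 5 0 = n + 1
  input : ∀ a ∈ [1, 2, 3, 4, 5], s.nat a = I.initial.nat a
  weight : s.real 0 = I.initial.real 0
  ratio : s.real 1 = I.initial.real 1
  digit : ∀ v : Fin n, s.nat 51 0 v = (n + 1) ^ (I.cls v : ℕ)

theorem Loaded.congr {I : Input k n} {s t : State} (hs : Loaded I s)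
    (h : ∀ a ∈ [1, 2, 3, 4, 5, 8, 51], t.nat a = s.nat a)
    (h' : ∀ a ∈ [0, 1], t.real a = s.real a) : Loaded I t := by
  have h8 := h 8 (by decide)
  refine ⟨by rw [h8, hs.size], by rw [h8, hs.size₂], by rw [h8, hs.codes], by rw [h8, hs.groups],
    by rw [h8, hs.size₁], fun a ha => ?_, by rw [h' 0 (by decide), hs.weight],
    by rw [h' 1 (by decide), hs.ratio], fun v => by rw [h 51 (by decide), hs.digit]⟩
  rw [h a (by revert a; decide), hs.input a ha]

theorem Loaded.adj {I : Input k n} {s : State} (hs : Loaded I s) (u v : Fin n) :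
    I.graph.Adj u v ↔ s.nat 1 u v = 1 := by
  rw [hs.input 1 (by decide)]
  simp only [Input.initial, ite_one_iff]
  constructor
  · exact fun h => ⟨u, v, rfl, rfl, h⟩
  · rintro ⟨u', v', h1, h2, h3⟩
    rwa [← Fin.ext h1, ← Fin.ext h2]

theorem _root_.GroupFair.Input.initial_group (I : Input k n) (g : Fin k) (v : Fin n) :
    I.initial.nat 2 g v = 1 ↔ v ∈ I.group g := by
  simp only [Input.initial, ite_one_iff]
  constructor
  · rintro ⟨u', v', h1, h2, h3⟩
    rwa [← Fin.ext h1, ← Fin.ext h2]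
  · exact fun h => ⟨g, v, rfl, rfl, h⟩

theorem Loaded.group {I : Input k n} {s : State} (hs : Loaded I s) (g : Fin k) (v : Fin n) :
    v ∈ I.group g ↔ s.nat 2 g v = 1 := by
  rw [hs.input 2 (by decide), I.initial_group]

theorem Loaded.weight_eq {I : Input k n} {s : State} (hs : Loaded I s) (v : Fin n) :
    s.real 0 v 0 = I.weight v := by
  rw [hs.weight]
  simp [Input.initial]

/-- The entry of the table for the code `c`: a feasible set, its weight and a matching. -/
def Entry (I : Input k n) (s : State) (c : ℕ) (F : Finset (Fin n)) (σ : Fin n → Fin n) : Prop :=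
  IsMate I.graph.Adj σ ∧ (∀ z, σ z ≠ z ↔ z ∈ F) ∧ (∀ v : Fin n, s.nat 61 c v = 1 ↔ v ∈ F) ∧
  (∀ v : Fin n, s.nat 62 c v = σ v) ∧ s.real 2 c 0 = ∑ v ∈ F, I.weight v ∧ I.code F = c

/-- The memory holds the instance and a correct table. -/
def TableInv (I : Input k n) (s : State) : Prop :=
  Loaded I s ∧ ∀ c, s.nat 60 c 0 = 1 → ∃ F σ, Entry I s c F σ

/-- The set `F` is dominated by the table. -/
def Recorded (I : Input k n) (F : Finset (Fin n)) (s : State) : Prop :=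
  Feasible I.graph.Adj F → s.nat 60 (I.code F) 0 = 1 ∧
    ∑ v ∈ F, I.weight v ≤ s.real 2 (I.code F) 0

theorem TableInv.congr {I : Input k n} {s t : State} (hs : TableInv I s)
    (h : ∀ a ∈ [1, 2, 3, 4, 5, 8, 51, 60, 61, 62], t.nat a = s.nat a)
    (h' : ∀ a ∈ [0, 1, 2], t.real a = s.real a) : TableInv I t := by
  refine ⟨hs.1.congr (fun a ha => h a (by revert a; decide)) fun a ha => h' a (by revert a; decide),
    ?_⟩
  have := hs.2
  unfold Entry at this ⊢
  rwa [h 60 (by decide), h 61 (by decide), h 62 (by decide), h' 2 (by decide)]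

theorem Recorded.congr {I : Input k n} {s t : State} {F : Finset (Fin n)} (hs : Recorded I F s)
    (h : t.nat 60 = s.nat 60) (h' : t.real 2 = s.real 2) : Recorded I F t := by
  unfold Recorded at hs ⊢
  rwa [h, h']

theorem sum_range_ite {M : Type*} [AddCommMonoid M] {n : ℕ} (F : Finset (Fin n)) (p : ℕ → Prop)
    [DecidablePred p] (f : ℕ → M) (hp : ∀ v : Fin n, p v ↔ v ∈ F) :
    (∑ j ∈ Finset.range n, if p j then f j else 0) = ∑ v ∈ F, f v := by
  rw [Finset.sum_range (fun j => if p j then f j else 0)]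
  simp only [hp, Finset.sum_ite_mem, Finset.univ_inter]

/-- An entry is only ever replaced by a heavier set with the same code, so whatever the table
dominates stays dominated. -/
theorem testProg_spec {I : Input k n} {s : State} (hs : TableInv I s) :
    TableInv I (testProg.run s) ∧ Recorded I (setOf n s) (testProg.run s) ∧
      ∀ Y, Recorded I Y s → Recorded I Y (testProg.run s) := by
  classical
  have hm := matchProg_spec (G := I.graph.Adj) (s := s) (setOf n s) (fun x y h => h.symm)
    hs.1.size hs.1.size₂ hs.1.adj (fun v => mem_setOf)
  rw [testProg]
  simp only [run_seq]
  generalize h1 : matchProg.run s = s1 at hm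
  have e1 : ∀ a ∈ [1, 2, 3, 4, 5, 8, 40, 51, 60, 61, 62], s1.nat a = s.nat a := fun a ha => by
    rw [← h1]
    exact run_nat (by revert a; decide) s
  have e1' : s1.real = s.real := by
    rw [← h1]
    exact funext fun a => run_real (by simp [show matchProg.writesReal = [] by decide]) s
  have hs1 : TableInv I s1 := hs.congr (fun a ha => e1 a (by revert a; decide)) fun a _ => by
    rw [e1']
  have hR1 : ∀ Y, Recorded I Y s → Recorded I Y s1 := fun Y hY => hY.congr (e1 60 (by decide)) (by
    rw [e1'])
  rcases hm with ⟨h48, σ, hσ, hσX, hσ1⟩ | ⟨h48, hno⟩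
  swap
  · rw [run_ite_neg (by rw [isOne_holds]; simp [NExp.eval, h48])]
    exact ⟨hs1, fun h => absurd h hno, hR1⟩
  rw [run_ite_pos (isOne_holds.2 h48)]
  simp only [run_seq]
  generalize h2 : Prog.run (sum 55 68 0 _) s1 = s2
  generalize h3 : Prog.run (sumReal 3 68 0 _) s2 = s3
  have e2 : ∀ a ∉ [55, 68], s2.nat a = s1.nat a := fun a ha => by
    rw [← h2]
    refine run_nat ?_ s1
    simp [sum, set, writes] at ha ⊢
    tauto
  have e2' : s2.real = s1.real := by
    rw [← h2]
    exact funext fun a => run_real (by simp [sum, set, writesReal]) s1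
  have e3 : ∀ a ∉ [68], s3.nat a = s2.nat a := fun a ha => by
    rw [← h3]
    refine run_nat ?_ s2
    simp [sumReal, writes] at ha ⊢
    tauto
  have e3' : ∀ a ∉ [3], s3.real a = s2.real a := fun a ha => by
    rw [← h3]
    refine run_real ?_ s2
    simp [sumReal, writesReal] at ha ⊢
    tauto
  have hcode : s3.nat 55 0 0 = I.code (setOf n s) := by
    rw [e3 55 (by decide), ← h2, sum_spec (by decide) (by decide)
      (fun j => if s.nat 40 0 j = 1 then s.nat 51 0 j else 0), e1 8 (by decide), hs.1.size,
      sum_range_ite (setOf n s) _ _ fun v => mem_setOf.symm]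
    · exact Finset.sum_congr rfl fun v _ => hs.1.digit v
    · intro j t hj hx hF
      have f1 : t.nat 40 = s.nat 40 := by rw [hF.1 40 (by decide), e1 40 (by decide)]
      have f2 : t.nat 51 = s.nat 51 := by rw [hF.1 51 (by decide), e1 51 (by decide)]
      simp only [run, isOne_holds, ite_nat, set, State.setNat_nat_self, NExp.eval, var, entry, f1,
        f2, hx]
      split <;> simp
  have hwt : s3.real 3 0 0 = ∑ v ∈ setOf n s, I.weight v := by
    rw [← h3, sumReal_spec (fun j => if s.nat 40 0 j = 1 then s.real 0 j 0 else 0),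
      e2 8 (by decide), e1 8 (by decide), hs.1.size,
      sum_range_ite (setOf n s) _ (fun j => s.real 0 j 0) fun v => mem_setOf.symm]
    · exact Finset.sum_congr rfl fun v _ => hs.1.weight_eq v
    · intro j t hj hx hF
      have f1 : t.nat 40 = s.nat 40 := by
        rw [hF.1 40 (by decide), e2 40 (by decide), e1 40 (by decide)]
      have f2 : t.real 0 = s.real 0 := by rw [hF.2 0 (by decide), e2', e1']
      simp only [run, isOne_holds, NExp.eval, RExp.eval, var, f1, f2, hx]
      split <;> simp [State.setReal]
  have h60 : s3.nat 60 = s1.nat 60 := by rw [e3 60 (by decide), e2 60 (by decide)]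
  have hr2 : s3.real 2 = s1.real 2 := by rw [e3' 2 (by decide), e2']
  have hs3 : TableInv I s3 := hs1.congr (fun a ha => by
    rw [e3 a (by revert a; decide), e2 a (by revert a; decide)]) fun a ha => by
    rw [e3' a (by revert a; decide), e2']
  have hR3 : ∀ Y, Recorded I Y s → Recorded I Y s3 := fun Y hY => (hR1 Y hY).congr h60 hr2
  have htest : (BExp.and (isOne 60 (var 55) (.const 0)) (.realLe (.get 3 (.const 0) (.const 0))
      (.get 2 (var 55) (.const 0)))).Holds s3 ↔ s3.nat 60 (I.code (setOf n s)) 0 = 1 ∧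
      ∑ v ∈ setOf n s, I.weight v ≤ s3.real 2 (I.code (setOf n s)) 0 := by
    simp only [BExp.Holds, isOne_holds, NExp.eval, RExp.eval, var, hcode, hwt]
  by_cases hold : s3.nat 60 (I.code (setOf n s)) 0 = 1 ∧
      ∑ v ∈ setOf n s, I.weight v ≤ s3.real 2 (I.code (setOf n s)) 0
  · rw [run_ite_pos (htest.2 hold)]
    exact ⟨hs3, fun _ => hold, hR3⟩
  rw [run_ite_neg (mt htest.1 hold)]
  simp only [run_seq]
  generalize h4 : Prog.run (.setNat 60 _ _ _) s3 = s4
  generalize h5 : Prog.run (assignRow 61 _ _) s4 = s5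
  generalize h6 : Prog.run (assignRow 62 _ _) s5 = s6
  generalize h7 : Prog.run (.setReal 2 _ _ _) s6 = s7
  have e4 : ∀ a ∉ [60], s4.nat a = s3.nat a := fun a ha => by
    rw [← h4]
    exact run_nat ha s3
  have e4' : s4.real = s3.real := by rw [← h4]; rfl
  have e5 : ∀ a ∉ [61, 21, 22, 23], s5.nat a = s4.nat a := fun a ha => by
    rw [← h5]
    refine run_nat ?_ s4
    simp [assignRow, writes, ret, set] at ha ⊢
    tauto
  have e5' : s5.real = s4.real := by
    rw [← h5]
    exact funext fun a => run_real (by simp [assignRow, ret, set, writesReal]) s4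
  have e6 : ∀ a ∉ [62, 21, 22, 23], s6.nat a = s5.nat a := fun a ha => by
    rw [← h6]
    refine run_nat ?_ s5
    simp [assignRow, writes, ret, set] at ha ⊢
    tauto
  have e6' : s6.real = s5.real := by
    rw [← h6]
    exact funext fun a => run_real (by simp [assignRow, ret, set, writesReal]) s5
  have e7 : s7.nat = s6.nat := by rw [← h7]; rfl
  have h55 : s4.nat 55 0 0 = I.code (setOf n s) := by rw [e4 55 (by decide), hcode]
  have h55' : s5.nat 55 0 0 = I.code (setOf n s) := by rw [e5 55 (by decide), h55]
  have h40 : s4.nat 40 = s.nat 40 := by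
    rw [e4 40 (by decide), e3 40 (by decide), e2 40 (by decide), e1 40 (by decide)]
  have h41 : s5.nat 41 = s1.nat 41 := by
    rw [e5 41 (by decide), e4 41 (by decide), e3 41 (by decide), e2 41 (by decide)]
  have h8 : s4.nat 8 0 0 = n := by
    rw [e4 8 (by decide), e3 8 (by decide), e2 8 (by decide), e1 8 (by decide), hs.1.size]
  have t60 : ∀ c, s7.nat 60 c 0 = if c = I.code (setOf n s) then 1 else s3.nat 60 c 0 := by
    intro c
    rw [e7, e6 60 (by decide), e5 60 (by decide), ← h4]
    simp [run, NExp.eval, var, State.setNat, hcode]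
  have t61 : ∀ c, ∀ v : Fin n, s7.nat 61 c v = if c = I.code (setOf n s) then s.nat 40 0 v else
      s3.nat 61 c v := by
    intro c v
    rw [e7, e6 61 (by decide), ← h5, assignRow_spec (I.code (setOf n s)) (fun v => s.nat 40 0 v)
      (by decide) (by decide), h8, e4 61 (by decide)]
    · simp [v.2]
    · intro t hF
      simp only [NExp.eval, var]
      rw [hF.1 55 (by decide), h55]
    · intro j t hj hx hF
      have f1 : t.nat 40 = s.nat 40 := by rw [hF.1 40 (by decide), h40]
      simp only [ret_nat, NExp.eval, var, entry, f1, hx]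
  have t62 : ∀ c, ∀ v : Fin n, s7.nat 62 c v = if c = I.code (setOf n s) then s1.nat 41 0 v else
      s3.nat 62 c v := by
    intro c v
    rw [e7, ← h6, assignRow_spec (I.code (setOf n s)) (fun v => s1.nat 41 0 v)
      (by decide) (by decide), e5 8 (by decide), h8, e5 62 (by decide), e4 62 (by decide)]
    · simp [v.2]
    · intro t hF
      simp only [NExp.eval, var]
      rw [hF.1 55 (by decide), h55']
    · intro j t hj hx hF
      have f1 : t.nat 41 = s1.nat 41 := by rw [hF.1 41 (by decide), h41]
      simp only [ret_nat, NExp.eval, var, entry, f1, hx]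
  have r6 : s6.real = s3.real := by rw [e6', e5', e4']
  have h55'' : s6.nat 55 0 0 = I.code (setOf n s) := by rw [e6 55 (by decide), h55']
  have tr : ∀ c, s7.real 2 c 0 = if c = I.code (setOf n s) then ∑ v ∈ setOf n s, I.weight v else
      s3.real 2 c 0 := by
    intro c
    rw [← h7]
    simp [run, NExp.eval, RExp.eval, var, State.setReal, h55'', r6, hwt]
  have hl7 : Loaded I s7 := by
    refine hs3.1.congr (fun a ha => ?_) fun a ha => ?_
    · rw [e7, e6 a (by revert a; decide), e5 a (by revert a; decide), e4 a (by revert a; decide)]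
    · rw [← h7, run_real, r6]
      simp only [writesReal]
      revert a
      decide
  refine ⟨⟨hl7, fun c hc => ?_⟩, fun hf => ?_, fun Y hY hf => ?_⟩
  · by_cases hcc : c = I.code (setOf n s)
    · refine ⟨setOf n s, σ, hσ, hσX, fun v => ?_, fun v => ?_, ?_, hcc.symm⟩
      · rw [t61, if_pos hcc, mem_setOf]
      · rw [t62, if_pos hcc, hσ1]
      · rw [tr, if_pos hcc]
    · rw [t60, if_neg hcc] at hc
      obtain ⟨F, τ, a1, a2, a3, a4, a5, a6⟩ := hs3.2 c hc
      refine ⟨F, τ, a1, a2, fun v => ?_, fun v => ?_, ?_, a6⟩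
      · rw [t61, if_neg hcc, a3]
      · rw [t62, if_neg hcc, a4]
      · rw [tr, if_neg hcc, a5]
  · rw [t60, tr, if_pos rfl, if_pos rfl]
    exact ⟨rfl, le_rfl⟩
  · obtain ⟨a1, a2⟩ := hR3 Y hY hf
    rw [t60, tr]
    by_cases hcc : I.code Y = I.code (setOf n s)
    · rw [if_pos hcc, if_pos hcc]
      refine ⟨rfl, ?_⟩
      rw [hcc] at a1 a2
      -- If `Y` were heavier than the new set, so would be the old entry that dominates `Y`, and it
      -- would not have been replaced.
      by_contra hlt
      exact hold ⟨a1, by linarith⟩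
    · rw [if_neg hcc, if_neg hcc]
      exact ⟨a1, a2⟩

/-- Test all sets that arise from the table entry for the code in `53` by at most `C` exchanges. -/
def rowProg (C : ℕ) : Prog :=
  .ite (isOne 60 (var 53) (.const 0))
    (.seq (assignRow 40 (.const 0) (ret (.get 61 (var 53) (var 21)))) (enumProg C testProg)) .skip

/-- Fill the table. -/
def tableProg (C : ℕ) : Prog := .loop 52 5 (.loop 53 2 (rowProg C))

set_option maxRecDepth 10000 in
theorem testProg_writes : ∀ a ∈ testProg.writes,
    a < 100 ∧ a ≠ 40 ∧ a ∉ [1, 2, 3, 4, 5, 6, 8, 51, 52, 53] := by decide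

theorem rowProg_writes {C a : ℕ} (h : a ∈ (rowProg C).writes) :
    a ∉ [1, 2, 3, 4, 5, 6, 8, 51, 52, 53] := by
  simp only [rowProg, assignRow, writes, ret, set, List.mem_append, List.mem_cons,
    List.not_mem_nil, or_false] at h
  have h1 := @enumProg_writes C testProg a
  have h2 := testProg_writes a
  rcases h with h | h
  · simp only [List.mem_cons, List.not_mem_nil, or_false, not_or]
    omega
  rcases h1 h with h | h
  · exact (h2 h).2.2
  · simp only [List.mem_cons, List.not_mem_nil, or_false, not_or]
    omega

/-- The entry for `c` may be replaced while its neighbours are tested. The set `F` is copied to the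
array `40` first, so the enumeration stays centred at the entry found at the start. -/
theorem rowProg_spec {I : Input k n} {s : State} {C c : ℕ} (hs : TableInv I s)
    (hc : s.nat 53 0 0 = c) :
    TableInv I ((rowProg C).run s) ∧ (∀ Y, Recorded I Y s → Recorded I Y ((rowProg C).run s)) ∧
    (s.nat 60 c 0 = 1 → ∀ F σ, Entry I s c F σ → ∀ D : Finset (Fin n), D.card ≤ C →
      Recorded I (symmDiff F D) ((rowProg C).run s)) := by
  by_cases h : s.nat 60 c 0 = 1
  swap
  · rw [rowProg, run_ite_neg (by rw [isOne_holds]; simpa [NExp.eval, var, hc] using h)]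
    exact ⟨hs, fun _ h => h, fun h' => absurd h' h⟩
  rw [rowProg, run_ite_pos (by rw [isOne_holds]; simpa [NExp.eval, var, hc] using h), run_seq]
  generalize h1 : Prog.run (assignRow 40 _ _) s = s1
  have e1 : ∀ a ∉ [40, 21, 22, 23], s1.nat a = s.nat a := fun a ha => by
    rw [← h1]
    refine run_nat ?_ s
    simp [assignRow, writes, ret, set] at ha ⊢
    tauto
  have e1' : s1.real = s.real := by
    rw [← h1]
    exact funext fun a => run_real (by simp [assignRow, ret, set, writesReal]) s
  have hs1 : TableInv I s1 := hs.congr (fun a ha => e1 a (by revert a; decide)) fun a _ => by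
    rw [e1']
  obtain ⟨a1, -, a3, a4⟩ := enumProg_spec (c := testProg) (TableInv I) (Recorded I)
    (fun s t hst hst' => ⟨fun hs => hs.congr (fun a ha => hst a (by revert a; decide) (by
      revert a; decide)) fun a _ => by rw [hst'], fun Y hY => hY.congr (hst 60 (by decide)
      (by decide)) (by rw [hst'])⟩) (fun s hs => hs.1.size₁)
    (fun a ha => ⟨(testProg_writes a ha).1, (testProg_writes a ha).2.1, fun h8 =>
      (testProg_writes a ha).2.2 (by simp [h8])⟩)
    (fun s hs => testProg_spec hs) C s1 hs1
  refine ⟨a1, fun Y hY => a3 Y (hY.congr (e1 60 (by decide)) (by rw [e1'])), ?_⟩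
  intro _ F σ hF D hD
  have hset : setOf n s1 = F := by
    ext v
    rw [mem_setOf, ← hF.2.2.1 v, ← h1, assignRow_spec 0 (fun v => s.nat 61 c v) (by decide)
      (by decide) (fun _ _ => rfl), if_pos ⟨rfl, by rw [hs.1.size]; exact v.2⟩]
    intro j t hj hx hF
    have f1 : t.nat 61 = s.nat 61 := hF.1 61 (by decide)
    have f2 : t.nat 53 = s.nat 53 := hF.1 53 (by decide)
    simp only [ret_nat, NExp.eval, var, f1, f2, hx, hc]
  have := a4 D hD
  rwa [hset] at this

/-- After round `p` the table dominates all feasible sets with at most `2 * p` vertices. A nonempty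
feasible set has a feasible set with two vertices fewer and nearby class counts, and the exchange
bound reaches a set that dominates it from the table entry for those counts. -/
theorem exists_tableProg_spec (k : ℕ) : ∃ C : ℕ, ∀ {n : ℕ} {I : Input k n} {s : State},
    TableInv I s → Recorded I ∅ s →
      TableInv I ((tableProg C).run s) ∧ ∀ Y, Recorded I Y ((tableProg C).run s) := by
  obtain ⟨C, hC⟩ := exists_exchange_bound (Fin (k + 1))
  refine ⟨C, fun {n I s} hs h0 => ?_⟩
  have hset : ∀ (x v : ℕ) (t : State), x ∈ [52, 53] →
      (TableInv I t → TableInv I (t.setNat x 0 0 v)) ∧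
      ∀ Y, Recorded I Y t → Recorded I Y (t.setNat x 0 0 v) := by
    intro x v t hx
    have hne : ∀ a ∈ [1, 2, 3, 4, 5, 8, 51, 60, 61, 62], a ≠ x := by
      revert x
      decide
    exact ⟨fun h => h.congr (fun a ha => State.setNat_nat_of_ne (hne a ha)) fun _ _ => rfl,
      fun Y h => h.congr (State.setNat_nat_of_ne (hne 60 (by decide))) rfl⟩
  have key := loop_induct (x := 52) (b := 5) (c := .loop 53 2 (rowProg C)) (s := s)
    (fun p t => TableInv I t ∧ ∀ Y : Finset (Fin n), Y.card ≤ 2 * p → Recorded I Y t) ?_ ?_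
  · rw [hs.1.size₁] at key
    refine ⟨key.1, fun Y => key.2 Y ?_⟩
    have := Finset.card_le_univ Y
    rw [Fintype.card_fin] at this
    omega
  · refine ⟨(hset 52 0 s (by simp)).1 hs, fun Y hY => ?_⟩
    obtain rfl := Finset.card_eq_zero.1 (Nat.le_zero.1 hY)
    exact (hset 52 0 s (by simp)).2 _ h0
  · rintro p t hp hx hF ⟨ht, hrec⟩
    have key2 := loop_induct (x := 53) (b := 2) (c := rowProg C) (s := t)
      (fun j t' => TableInv I t' ∧ (∀ Y : Finset (Fin n), Y.card ≤ 2 * p → Recorded I Y t') ∧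
        ∀ Y₀ Y : Finset (Fin n), Feasible I.graph.Adj Y₀ → Y₀.card ≤ 2 * p → I.code Y₀ < j →
        (∀ i, |(classCount I.cls Y i : ℤ) - classCount I.cls Y₀ i| ≤ 2) → Recorded I Y t') ?_ ?_
    · rw [ht.1.codes] at key2
      obtain ⟨a1, a2, a3⟩ := key2
      have hs' := hset 52 (p + 1) ((loop 53 2 (rowProg C)).run t) (by simp)
      refine ⟨hs'.1 a1, fun Y hY => hs'.2 Y fun hfe => ?_⟩
      rcases Y.eq_empty_or_nonempty with rfl | hne
      · exact a2 ∅ (by simp) hfe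
      · obtain ⟨Y₀, b1, b2, b3⟩ := I.exists_smaller hfe hne
        exact a3 Y₀ Y b1 (by omega) (I.code_lt Y₀) b3 hfe
    · have hs' := hset 53 0 t (by simp)
      exact ⟨hs'.1 ht, fun Y hY => hs'.2 Y (hrec Y hY), fun _ _ _ _ h => absurd h (by omega)⟩
    · rintro j t' hj hx' hF' ⟨a1, a2, a3⟩
      have hs' := hset 53 (j + 1) ((rowProg C).run t') (by simp)
      obtain ⟨b1, b2, b3⟩ := rowProg_spec (C := C) a1 hx'
      refine ⟨hs'.1 b1, fun Y hY => hs'.2 Y (b2 Y (a2 Y hY)), fun Y₀ Y c1 c2 c3 c4 => hs'.2 Y ?_⟩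
      rcases Nat.lt_succ_iff_lt_or_eq.1 c3 with c3 | c3
      · exact b2 Y (a3 Y₀ Y c1 c2 c3 c4)
      intro hY
      -- The entry `F` need not be `Y₀`. It is optimal for its counts, since every competitor has
      -- the cardinality of `Y₀` and is already dominated.
      obtain ⟨d1, -⟩ := a2 Y₀ c2 c1
      rw [c3] at d1
      obtain ⟨F, σ, hE⟩ := a1.2 j d1
      have hcount : classCount I.cls F = classCount I.cls Y₀ :=
        I.classCount_eq_of_code_eq (hE.2.2.2.2.2.trans c3.symm)
      have hopt : ∀ F₂, Feasible I.graph.Adj F₂ → classCount I.cls F₂ = classCount I.cls F →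
          ∑ z ∈ F₂, I.weight z ≤ ∑ z ∈ F, I.weight z := by
        intro F₂ g1 g2
        have g3 := I.card_eq_of_classCount_eq (g2.trans hcount)
        have g4 := (a2 F₂ (by omega) g1).2
        rwa [I.code_eq_of_classCount_eq g2, hE.2.2.2.2.2, hE.2.2.2.2.1] at g4
      obtain ⟨F', f1, f2, f3, f4⟩ := hC I.graph.Adj I.cls I.weight F Y ⟨σ, hE.1, hE.2.1⟩ hY
        hopt (fun i => by rw [hcount]; exact c4 i)
      -- `F'` arises from `F` by exchanging their symmetric difference, which has at most `C`
      -- elements, so it has been tested; being recorded, it makes `Y` recorded as well.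
      have f5 := b3 d1 F σ hE (symmDiff F F') f4
      rw [symmDiff_symmDiff_cancel_left] at f5
      obtain ⟨f6, f7⟩ := f5 f1
      rw [I.code_eq_of_classCount_eq f2] at f6 f7
      exact ⟨f6, f3.trans f7⟩

/-! ## The choice of a fair set -/

/-- Test whether the set recorded for the code in `53` satisfies the constraints. -/
def fairProg : Prog :=
  all 65 63 3 (.seq (sum 66 68 0 (.ite (.and (isOne 61 (var 53) (var 68))
      (isOne 2 (var 63) (var 68))) (set 66 (.add (var 66) (.const 1))) .skip))
    (.seq (all 69 64 3 (.ite (isOne 5 (var 63) (var 64))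
        (.seq (sumReal 5 68 0 (.ite (.and (isOne 61 (var 53) (var 68)) (isOne 2 (var 64) (var 68)))
          (.setReal 5 (.const 0) (.const 0) (.add (.get 5 (.const 0) (.const 0))
            (.get 1 (var 63) (var 64)))) .skip))
          (.ite (.realLe (.ofNat (var 66)) (.get 5 (.const 0) (.const 0))) .skip
            (set 69 (.const 0)))) .skip))
      (.ite (.and (.natLe (.get 3 (var 63) (.const 0)) (var 66))
        (.and (.natLe (var 66) (.get 4 (var 63) (.const 0))) (isOne 69 (.const 0) (.const 0))))
        .skip (set 65 (.const 0)))))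

theorem Loaded.lower {I : Input k n} {s : State} (hs : Loaded I s) (g : Fin k) :
    s.nat 3 g 0 = I.lower g := by
  rw [hs.input 3 (by decide)]
  simp [Input.initial]

theorem Loaded.upper {I : Input k n} {s : State} (hs : Loaded I s) (g : Fin k) :
    s.nat 4 g 0 = I.upper g := by
  rw [hs.input 4 (by decide)]
  simp [Input.initial]

theorem Loaded.pairs {I : Input k n} {s : State} (hs : Loaded I s) (i j : Fin k) :
    s.nat 5 i j = 1 ↔ (i, j) ∈ I.pairs := by
  rw [hs.input 5 (by decide)]
  simp only [Input.initial, ite_one_iff]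
  constructor
  · rintro ⟨⟨a, b⟩, h1, h2, h3⟩
    rwa [← Fin.ext h2, ← Fin.ext h3]
  · exact fun h => ⟨_, h, rfl, rfl⟩

theorem Loaded.ratio_eq {I : Input k n} {s : State} (hs : Loaded I s) {i j : Fin k}
    (h : (i, j) ∈ I.pairs) : s.real 1 i j = I.ratio i j := by
  rw [hs.ratio]
  simp [Input.initial, h]

/-- The machine has no multiplication, so the right side of a relative constraint is computed by
adding the ratio once for every vertex of `F` in the second group. -/
theorem fairProg_spec {I : Input k n} {s : State} {c : ℕ} {F : Finset (Fin n)} (hs : Loaded I s)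
    (hc : s.nat 53 0 0 = c) (hF : ∀ v : Fin n, s.nat 61 c v = 1 ↔ v ∈ F) :
    (fairProg.run s).nat 65 0 0 = 1 ↔ I.FairSet F := by
  classical
  have hcnt : ∀ (A : Finset (Fin n)), A.card = ∑ _v ∈ A, 1 := fun A => by simp
  rw [fairProg, all_spec (by decide) (by decide) (fun i => ∀ h : i < k,
    (I.lower ⟨i, h⟩ ≤ (F ∩ I.group ⟨i, h⟩).card ∧ (F ∩ I.group ⟨i, h⟩).card ≤ I.upper ⟨i, h⟩) ∧
    ∀ j, (⟨i, h⟩, j) ∈ I.pairs → ((F ∩ I.group ⟨i, h⟩).card : ℝ) ≤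
      I.ratio ⟨i, h⟩ j * (F ∩ I.group j).card), ite_one_iff, hs.groups]
  · exact ⟨fun h i => h i i.2 i.2, fun h i hi _ => h ⟨i, hi⟩⟩
  intro i t hi hx hfr
  rw [hs.groups] at hi
  simp only [hi, forall_true_left]
  set g : Fin k := ⟨i, hi⟩
  have f : ∀ a ∈ [1, 2, 3, 4, 5, 8, 51, 53, 61], t.nat a = s.nat a := fun a ha =>
    hfr.1 a (by revert a; decide)
  have f' : ∀ a ∈ [0, 1], t.real a = s.real a := fun a ha => hfr.2 a (by revert a; decide)
  have ht : Loaded I t := hs.congr (fun a ha => f a (by revert a; decide)) f'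
  have h53 : t.nat 53 0 0 = c := by rw [f 53 (by decide), hc]
  have htF : ∀ v : Fin n, t.nat 61 c v = 1 ↔ v ∈ F := by rw [f 61 (by decide)]; exact hF
  simp only [run_seq]
  generalize h1 : Prog.run (sum 66 68 0 _) t = t1
  generalize h2 : Prog.run (all 69 64 3 _) t1 = t2
  have e1 : ∀ a ∉ [66, 68], t1.nat a = t.nat a := fun a ha => by
    rw [← h1]
    refine run_nat ?_ t
    simp [sum, set, writes] at ha ⊢
    tauto
  have e1' : t1.real = t.real := by
    rw [← h1]
    exact funext fun a => run_real (by simp [sum, set, writesReal]) t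
  have e2 : ∀ a ∉ [69, 64, 68], t2.nat a = t1.nat a := fun a ha => by
    rw [← h2]
    refine run_nat ?_ t1
    simp [all, sumReal, set, writes] at ha ⊢
    tauto
  have h66 : t1.nat 66 0 0 = (F ∩ I.group g).card := by
    rw [← h1, sum_spec (by decide) (by decide)
      (fun j => if t.nat 61 c j = 1 ∧ t.nat 2 i j = 1 then 1 else 0), ht.size,
      sum_range_ite (F ∩ I.group g) _ (fun _ => 1), ← hcnt]
    · intro v
      rw [htF, Finset.mem_inter, ht.group]
    · intro j t' hj hx' hF'
      have f1 : t'.nat 61 = t.nat 61 := hF'.1 61 (by decide)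
      have f2 : t'.nat 53 = t.nat 53 := hF'.1 53 (by decide)
      have f3 : t'.nat 2 = t.nat 2 := hF'.1 2 (by decide)
      have f4 : t'.nat 63 = t.nat 63 := hF'.1 63 (by decide)
      simp only [run, BExp.Holds, isOne_holds, ite_nat, set, State.setNat_nat_self, NExp.eval, var,
        f1, f2, f3, f4, hx, hx', h53]
      split <;> simp
  have h69 : t2.nat 69 0 0 = 1 ↔ ∀ j, (g, j) ∈ I.pairs → ((F ∩ I.group g).card : ℝ) ≤
      I.ratio g j * (F ∩ I.group j).card := by
    rw [← h2, all_spec (by decide) (by decide) (fun j => ∀ h : j < k, (g, ⟨j, h⟩) ∈ I.pairs →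
      ((F ∩ I.group g).card : ℝ) ≤ I.ratio g ⟨j, h⟩ * (F ∩ I.group ⟨j, h⟩).card), ite_one_iff,
      e1 8 (by decide), ht.groups]
    · exact ⟨fun h j => h j j.2 j.2, fun h j hj _ => h ⟨j, hj⟩⟩
    intro j t' hj hx' hF'
    rw [e1 8 (by decide), ht.groups] at hj
    simp only [hj, forall_true_left]
    have q : ∀ a ∈ [1, 2, 3, 4, 5, 8, 51, 53, 61, 63], t'.nat a = t.nat a := fun a ha => by
      rw [hF'.1 a (by revert a; decide), e1 a (by revert a; decide)]
    have q' : ∀ a ∈ [0, 1], t'.real a = t.real a := fun a ha => by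
      rw [hF'.2 a (by revert a; decide), e1']
    have ht' : Loaded I t' := ht.congr (fun a ha => q a (by revert a; decide)) q'
    have q66 : t'.nat 66 0 0 = (F ∩ I.group g).card := by rw [hF'.1 66 (by decide), h66]
    have q63 : t'.nat 63 0 0 = i := by rw [q 63 (by decide), hx]
    by_cases hp : (g, (⟨j, hj⟩ : Fin k)) ∈ I.pairs
    swap
    · rw [run_ite_neg]
      · simp only [hp, false_imp_iff, if_true]
        rfl
      · rw [isOne_holds]
        simp only [NExp.eval, var, q63, hx']
        exact mt (ht'.pairs g ⟨j, hj⟩).1 hp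
    rw [run_ite_pos]
    swap
    · rw [isOne_holds]
      simp only [NExp.eval, var, q63, hx']
      exact (ht'.pairs g ⟨j, hj⟩).2 hp
    rw [run_seq]
    generalize h3 : Prog.run (sumReal 5 68 0 _) t' = t3
    have e3 : ∀ a ∉ [68], t3.nat a = t'.nat a := fun a ha => by
      rw [← h3]
      refine run_nat ?_ t'
      simp [sumReal, writes] at ha ⊢
      tauto
    have h5 : t3.real 5 0 0 = I.ratio g ⟨j, hj⟩ * (F ∩ I.group ⟨j, hj⟩).card := by
      rw [← h3, sumReal_spec (fun v => if t.nat 61 c v = 1 ∧ t.nat 2 j v = 1 then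
        t'.real 1 i j else 0), ht'.size, sum_range_ite (F ∩ I.group ⟨j, hj⟩) _
        (fun _ => t'.real 1 i j), Finset.sum_const, nsmul_eq_mul, mul_comm]
      · congr 1
        exact ht'.ratio_eq hp
      · intro v
        rw [htF, Finset.mem_inter, ht.group]
      · intro v t'' hv hx'' hF''
        have f1 : t''.nat 61 = t.nat 61 := by rw [hF''.1 61 (by decide), q 61 (by decide)]
        have f2 : t''.nat 53 = t.nat 53 := by rw [hF''.1 53 (by decide), q 53 (by decide)]
        have f3 : t''.nat 2 = t.nat 2 := by rw [hF''.1 2 (by decide), q 2 (by decide)]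
        have f4 : t''.nat 63 = t'.nat 63 := hF''.1 63 (by decide)
        have f5 : t''.nat 64 = t'.nat 64 := hF''.1 64 (by decide)
        have f6 : t''.real 1 = t'.real 1 := hF''.2 1 (by decide)
        simp only [run, BExp.Holds, isOne_holds, NExp.eval, RExp.eval, var, f1, f2, f3, f4, f5, f6,
          q63, hx', hx'', h53]
        split <;> simp [State.setReal]
    have h66' : t3.nat 66 0 0 = (F ∩ I.group g).card := by rw [e3 66 (by decide), q66]
    simp only [hp, forall_true_left]
    by_cases hle : ((F ∩ I.group g).card : ℝ) ≤ I.ratio g ⟨j, hj⟩ * (F ∩ I.group ⟨j, hj⟩).card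
    · rw [if_pos hle, run_ite_pos, ← e3 69 (by decide)]
      · rfl
      · simpa only [BExp.Holds, RExp.eval, NExp.eval, var, h66', h5] using hle
    · rw [if_neg hle, run_ite_neg]
      · exact State.setNat_nat_self
      · simpa only [BExp.Holds, RExp.eval, NExp.eval, var, h66', h5] using hle
  have h66' : t2.nat 66 0 0 = (F ∩ I.group g).card := by rw [e2 66 (by decide), h66]
  have h3 : t2.nat 3 i 0 = I.lower g := by
    rw [e2 3 (by decide), e1 3 (by decide)]
    exact ht.lower g
  have h4 : t2.nat 4 i 0 = I.upper g := by
    rw [e2 4 (by decide), e1 4 (by decide)]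
    exact ht.upper g
  have h63 : t2.nat 63 0 0 = i := by rw [e2 63 (by decide), e1 63 (by decide), hx]
  have htest : (BExp.and (.natLe (.get 3 (var 63) (.const 0)) (var 66))
        (.and (.natLe (var 66) (.get 4 (var 63) (.const 0)))
          (isOne 69 (.const 0) (.const 0)))).Holds t2 ↔
      (I.lower g ≤ (F ∩ I.group g).card ∧ (F ∩ I.group g).card ≤ I.upper g) ∧
      ∀ j, (g, j) ∈ I.pairs → ((F ∩ I.group g).card : ℝ) ≤ I.ratio g j * (F ∩ I.group j).card := by
    simp only [BExp.Holds, isOne_holds, NExp.eval, var, h66', h3, h4, h63, h69, and_assoc]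
  by_cases hall : (I.lower g ≤ (F ∩ I.group g).card ∧ (F ∩ I.group g).card ≤ I.upper g) ∧
      ∀ j, (g, j) ∈ I.pairs → ((F ∩ I.group g).card : ℝ) ≤ I.ratio g j * (F ∩ I.group j).card
  · rw [if_pos hall, run_ite_pos (htest.2 hall), ← e1 65 (by decide), ← e2 65 (by decide)]
    rfl
  · rw [if_neg hall, run_ite_neg (mt htest.1 hall)]
    exact State.setNat_nat_self

end Prog
/-! ## Matchings and covered sets -/

namespace Input

variable {k n : ℕ} (I : Input k n)

/-- The matching of the pairs `u`, `σ u` with `σ u ≠ u`. -/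
def mateSubgraph {σ : Fin n → Fin n} (hσ : IsMate I.graph.Adj σ) : I.graph.Subgraph where
  verts := {v | σ v ≠ v}
  Adj u v := σ u = v ∧ u ≠ v
  adj_sub := by
    rintro u v ⟨rfl, h⟩
    exact hσ.adj u h.symm
  edge_vert := by
    rintro u v ⟨rfl, h⟩
    exact h.symm
  symm := ⟨by
    rintro u v ⟨rfl, h⟩
    exact ⟨hσ.invol u, h.symm⟩⟩

theorem mateSubgraph_isMatching {σ : Fin n → Fin n} (hσ : IsMate I.graph.Adj σ) :
    (I.mateSubgraph hσ).IsMatching := fun v hv => ⟨σ v, ⟨rfl, Ne.symm hv⟩, fun _ h => h.1.symm⟩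

-- The partner function of the matching, extended by the identity, is the required involution;
-- uniqueness of partners makes it one.
open Classical in
theorem feasible_of_isMatching {M : I.graph.Subgraph} (hM : M.IsMatching) :
    Feasible I.graph.Adj M.verts.toFinset := by
  choose f hf using fun (v : Fin n) (hv : v ∈ M.verts) => (hM hv).exists
  let σ : Fin n → Fin n := fun v => if hv : v ∈ M.verts then f v hv else v
  have hσ : ∀ v (hv : v ∈ M.verts), σ v = f v hv := fun v hv => dif_pos hv
  have hadj : ∀ v, v ∈ M.verts → M.Adj v (σ v) := fun v hv => by
    rw [hσ v hv]
    exact hf v hv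
  have hmem : ∀ v, σ v ≠ v ↔ v ∈ M.verts := fun v => by
    refine ⟨fun h => by_contra fun hv => h (dif_neg hv), fun hv => (hadj v hv).ne.symm⟩
  refine ⟨σ, ⟨fun v => ?_, fun v hv => (hadj v ((hmem v).1 hv)).adj_sub⟩, fun v => by
    rw [hmem, Set.mem_toFinset]⟩
  by_cases hv : v ∈ M.verts
  · have h1 := hadj v hv
    have h2 := hadj (σ v) h1.snd_mem
    exact (hM h1.snd_mem).unique h2 h1.symm
  · have h1 : σ v = v := dif_neg hv
    rw [h1, h1]

theorem covered_eq {M : I.graph.Subgraph} {F : Finset (Fin n)} (h : ∀ v, v ∈ M.verts ↔ v ∈ F)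
    (i : Fin k) : I.covered M i = (F ∩ I.group i).card := by
  rw [covered, ← Set.ncard_coe_finset, Finset.coe_inter]
  congr 2
  ext v
  simp [h]

theorem isGroupFair_iff {M : I.graph.Subgraph} {F : Finset (Fin n)} (h : ∀ v, v ∈ M.verts ↔ v ∈ F) :
    I.IsGroupFair M ↔ M.IsMatching ∧ I.FairSet F := by
  simp only [IsGroupFair, FairSet, I.covered_eq h, forall_and]

theorem totalWeight_eq {M : I.graph.Subgraph} {F : Finset (Fin n)}
    (h : ∀ v, v ∈ M.verts ↔ v ∈ F) : I.totalWeight M = ∑ v ∈ F, I.weight v := by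
  classical
  simp only [totalWeight, Set.indicator_apply, h, Finset.sum_ite_mem, Finset.univ_inter]

end Input

/-! ## The whole program -/

namespace Prog

variable {k n : ℕ}

/-- Choose the set recorded for the code in `53` if it satisfies the constraints and is better than
the chosen one. -/
def offerProg : Prog :=
  .ite (isOne 60 (var 53) (.const 0)) (.seq fairProg
    (.ite (.and (isOne 65 (.const 0) (.const 0)) (orB (.not (isOne 6 (.const 0) (.const 0)))
        (.not (.realLe (.get 2 (var 53) (.const 0)) (.get 4 (.const 0) (.const 0))))))
      (.seq (set 6 (.const 1)) (.seq (set 67 (var 53))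
        (.setReal 4 (.const 0) (.const 0) (.get 2 (var 53) (.const 0))))) .skip)) .skip

/-- Choose the best entry of the table that satisfies the constraints. -/
def selectProg : Prog := .loop 53 2 offerProg

/-- The real cell `4[0][0]` holds the weight of the current choice and has no meaning while
`6[0][0]` is zero; hence the disjunction in the test. -/
theorem selectProg_spec {I : Input k n} {s : State} (hs : TableInv I s) (h6 : s.nat 6 0 0 = 0) :
    ((selectProg.run s).nat 6 0 0 = 0 ∧ ∀ c < (n + 1) ^ (k + 1), s.nat 60 c 0 = 1 →
      ∀ F σ, Entry I s c F σ → ¬ I.FairSet F) ∨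
    ((selectProg.run s).nat 6 0 0 = 1 ∧ ∃ F σ, Entry I s ((selectProg.run s).nat 67 0 0) F σ ∧
      I.FairSet F ∧ ∀ c < (n + 1) ^ (k + 1), s.nat 60 c 0 = 1 → ∀ F' σ', Entry I s c F' σ' →
        I.FairSet F' → s.real 2 c 0 ≤ s.real 2 ((selectProg.run s).nat 67 0 0) 0) := by
  have key := loop_induct (x := 53) (b := 2) (c := offerProg) (s := s)
    (fun m t => (t.nat 6 0 0 = 0 ∧ ∀ c < m, s.nat 60 c 0 = 1 →
      ∀ F σ, Entry I s c F σ → ¬ I.FairSet F) ∨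
    (t.nat 6 0 0 = 1 ∧ t.real 4 0 0 = s.real 2 (t.nat 67 0 0) 0 ∧
      ∃ F σ, Entry I s (t.nat 67 0 0) F σ ∧
      I.FairSet F ∧ ∀ c < m, s.nat 60 c 0 = 1 → ∀ F' σ', Entry I s c F' σ' →
        I.FairSet F' → s.real 2 c 0 ≤ s.real 2 (t.nat 67 0 0) 0)) ?_ ?_
  · rw [selectProg, ← hs.1.codes]
    refine key.imp id ?_
    rintro ⟨a1, -, a2⟩
    exact ⟨a1, a2⟩
  · exact Or.inl ⟨by rw [State.setNat_nat_of_ne (by decide), h6], fun c hc => absurd hc (by omega)⟩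
  intro j t hj hx hfr hP
  have e : ∀ a ∈ [1, 2, 3, 4, 5, 8, 51, 60, 61], t.nat a = s.nat a := fun a ha =>
    hfr.1 a (by revert a; decide)
  have e' : ∀ a ∈ [0, 1, 2], t.real a = s.real a := fun a ha => hfr.2 a (by revert a; decide)
  rw [State.setNat_nat_of_ne (by decide), State.setNat_nat_of_ne (by decide), State.setNat_real]
  rw [offerProg]
  by_cases h60 : s.nat 60 j 0 = 1
  swap
  · rw [run_ite_neg (by
      rw [isOne_holds]; simpa only [NExp.eval, var, hx, e 60 (by decide)] using h60)]
    refine hP.imp (fun ⟨a1, a2⟩ => ⟨a1, fun c hc hc1 => ?_⟩)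
      fun ⟨a1, a2, F, σ, a3, a4, a5⟩ => ⟨a1, a2, F, σ, a3, a4, fun c hc hc1 => ?_⟩
    all_goals
      have hcj : c < j := lt_of_le_of_ne (by omega) fun h => h60 (h ▸ hc1)
    exacts [a2 c hcj hc1, a5 c hcj hc1]
  rw [run_ite_pos (by
    rw [isOne_holds]; simpa only [NExp.eval, var, hx, e 60 (by decide)] using h60), run_seq]
  obtain ⟨F, σ, hE⟩ := hs.2 j h60
  have hfair := fairProg_spec (I := I) (s := t) (c := j) (F := F)
    (hs.1.congr (fun a ha => e a (by revert a; decide)) fun a ha => e' a (by revert a; decide)) hx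
    (by rw [e 61 (by decide)]; exact hE.2.2.1)
  -- The array `61` determines the set of an entry, so the single fairness test speaks for every set
  -- that fits the entry.
  have huniq : ∀ F' σ', Entry I s j F' σ' → F' = F := fun F' σ' h => by
    ext v
    rw [← h.2.2.1, hE.2.2.1]
  generalize h1 : fairProg.run t = t1 at hfair
  have g : ∀ a ∈ [6, 53, 67], t1.nat a = t.nat a := fun a ha => by
    rw [← h1]
    exact run_nat (by revert a; decide) t
  have g' : ∀ a ∈ [2, 4], t1.real a = t.real a := fun a ha => by
    rw [← h1]
    exact run_real (by revert a; decide) t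
  have htest : (BExp.and (isOne 65 (.const 0) (.const 0))
      (orB (.not (isOne 6 (.const 0) (.const 0)))
        (.not (.realLe (.get 2 (var 53) (.const 0)) (.get 4 (.const 0) (.const 0)))))).Holds t1 ↔
      I.FairSet F ∧ (t.nat 6 0 0 ≠ 1 ∨ t.real 4 0 0 < s.real 2 j 0) := by
    simp only [BExp.Holds, orB_holds, isOne_holds, NExp.eval, RExp.eval, var, hfair,
      g 6 (by decide), g 53 (by decide), g' 2 (by decide), g' 4 (by decide), hx,
      e' 2 (by decide), not_le, ne_eq]
  by_cases hall : I.FairSet F ∧ (t.nat 6 0 0 ≠ 1 ∨ t.real 4 0 0 < s.real 2 j 0)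
  · rw [run_ite_pos (htest.2 hall)]
    generalize h2 : Prog.run _ t1 = t2
    have b6 : t2.nat 6 0 0 = 1 := by
      rw [← h2]
      simp [run, set, State.setNat, State.setReal, NExp.eval]
    have b67 : t2.nat 67 0 0 = j := by
      rw [← h2]
      simp [run, set, State.setNat, State.setReal, NExp.eval, var, g 53 (by decide), hx]
    have b4 : t2.real 4 0 0 = s.real 2 j 0 := by
      rw [← h2]
      simp [run, set, State.setNat, State.setReal, NExp.eval, RExp.eval, var, g 53 (by decide), hx,
        g' 2 (by decide), e' 2 (by decide)]
    rw [b6, b67, b4]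
    refine Or.inr ⟨rfl, rfl, F, σ, hE, hall.1, fun c hc hc1 F' σ' hE' hF' => ?_⟩
    rcases Nat.lt_succ_iff_lt_or_eq.1 hc with hc | rfl
    · rcases hP with ⟨a1, a2⟩ | ⟨a1, a2, F₁, σ₁, a3, a4, a5⟩
      · exact absurd hF' (a2 c hc hc1 F' σ' hE')
      · have h3 := a5 c hc hc1 F' σ' hE' hF'
        have h4 := hall.2.resolve_left (by simpa using a1)
        rw [a2] at h4
        linarith
    · exact le_rfl
  · rw [run_ite_neg (mt htest.1 hall), run, g 6 (by decide), g 67 (by decide), g' 4 (by decide)]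
    rcases hP with ⟨a1, a2⟩ | ⟨a1, a2, F₁, σ₁, a3, a4, a5⟩
    · refine Or.inl ⟨a1, fun c hc hc1 F' σ' hE' hF' => ?_⟩
      rcases Nat.lt_succ_iff_lt_or_eq.1 hc with hc | rfl
      · exact a2 c hc hc1 F' σ' hE' hF'
      · rw [huniq F' σ' hE'] at hF'
        exact hall ⟨hF', Or.inl (by omega)⟩
    · refine Or.inr ⟨a1, a2, F₁, σ₁, a3, a4, fun c hc hc1 F' σ' hE' hF' => ?_⟩
      rcases Nat.lt_succ_iff_lt_or_eq.1 hc with hc | rfl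
      · exact a5 c hc hc1 F' σ' hE' hF'
      · rw [huniq F' σ' hE'] at hF'
        by_contra hlt
        exact hall ⟨hF', Or.inr (by rw [a2]; exact not_le.1 hlt)⟩

/-- Write the chosen matching to the array `7`. -/
def outputProg : Prog :=
  .ite (isOne 6 (.const 0) (.const 0))
    (assign 7 (.ite (.and (eqN (.get 62 (var 67) (var 20)) (var 21)) (.not (eqN (var 20) (var 21))))
      (ret (.const 1)) (ret (.const 0)))) .skip

/-- Every group-fair matching is dominated by the entry for its class counts, and that entry is fair
because fairness depends only on the counts. So the best fair entry is optimal, and if no entry is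
fair, no group-fair matching exists. -/
theorem outputProg_spec {I : Input k n} {s : State} (hs : TableInv I s)
    (hrec : ∀ Y, Recorded I Y s) (h6 : s.nat 6 0 0 = 0) :
    I.Answers (outputProg.run (selectProg.run s)) := by
  classical
  have hsel := selectProg_spec hs h6
  generalize h1 : selectProg.run s = s1 at hsel
  have e : ∀ a ∈ [8, 62], s1.nat a = s.nat a := fun a ha => by
    rw [← h1]
    exact run_nat (by revert a; decide) s
  have hbest : ∀ M, I.IsGroupFair M → ∃ F σ, s.nat 60 (I.code F) 0 = 1 ∧ Entry I s (I.code F) F σ ∧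
      I.FairSet F ∧ I.totalWeight M ≤ s.real 2 (I.code F) 0 := by
    intro M hM
    have hv : ∀ v, v ∈ M.verts ↔ v ∈ M.verts.toFinset := fun v => by rw [Set.mem_toFinset]
    obtain ⟨hmat, hfair⟩ := (I.isGroupFair_iff hv).1 hM
    obtain ⟨b1, b2⟩ := hrec _ (I.feasible_of_isMatching hmat)
    obtain ⟨F, σ, hE⟩ := hs.2 _ b1
    have hcode := hE.2.2.2.2.2
    rw [← hcode] at b1 b2 hE
    exact ⟨F, σ, b1, hE, hfair.congr I (I.classCount_eq_of_code_eq hcode), by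
      rwa [I.totalWeight_eq hv]⟩
  rcases hsel with ⟨a1, a2⟩ | ⟨a1, F, σ, hE, hF, a2⟩
  · rw [outputProg, run_ite_neg (by rw [isOne_holds]; simp [NExp.eval, a1])]
    refine Or.inl ⟨a1, fun M hM => ?_⟩
    obtain ⟨F, σ, b1, b2, b3, -⟩ := hbest M hM
    exact a2 _ (I.code_lt F) b1 F σ b2 b3
  · rw [outputProg, run_ite_pos (isOne_holds.2 a1)]
    have hv : ∀ v, v ∈ (I.mateSubgraph hE.1).verts ↔ v ∈ F := hE.2.1
    refine Or.inr ⟨by rw [run_nat (by decide), a1], I.mateSubgraph hE.1, ⟨(I.isGroupFair_iff hv).2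
      ⟨I.mateSubgraph_isMatching hE.1, hF⟩, fun M' hM' => ?_⟩, fun u v => ?_⟩
    · obtain ⟨F', σ', b1, b2, b3, b4⟩ := hbest M' hM'
      rw [I.totalWeight_eq hv, ← hE.2.2.2.2.1]
      exact b4.trans (a2 _ (I.code_lt F') b1 F' σ' b2 b3)
    · rw [assign_spec (fun i j => if s.nat 62 (s1.nat 67 0 0) i = j ∧ i ≠ j then 1 else 0)
        (by decide) (by decide), e 8 (by decide), hs.1.size, if_pos ⟨u.2, v.2⟩, hE.2.2.2.1]
      · exact if_congr (by simp only [Input.mateSubgraph, Fin.val_inj, ne_eq]) rfl rfl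
      · intro i j t hi hj hx hy hfr
        have f1 : t.nat 62 = s.nat 62 := by rw [hfr.1 62 (by decide), e 62 (by decide)]
        have f2 : t.nat 67 = s1.nat 67 := hfr.1 67 (by decide)
        simp only [run, BExp.Holds, eqN_holds, ite_nat, ret_nat, NExp.eval, var, f1, f2, hx, hy,
          ne_eq]

/-! ### Preparation of the memory -/

/-- Store the loop bounds that depend linearly on the number of vertices. -/
def boundsProg (k : ℕ) : Prog :=
  .seq (.setNat 8 (.const 0) (.const 0) (var 0))
    (.seq (.setNat 8 (.const 1) (.const 0) (.add (.add (var 0) (var 0)) (.const 1)))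
      (.seq (.setNat 8 (.const 3) (.const 0) (.const k))
        (.seq (.setNat 8 (.const 4) (.const 0) (.const (k + 1)))
          (.setNat 8 (.const 5) (.const 0) (.add (var 0) (.const 1))))))

/-- Compute the powers of the number of vertices plus one. -/
def powProg : Prog :=
  .seq (set 50 (.const 1)) (.loop 63 4
    (.seq (.setNat 50 (.add (var 63) (.const 1)) (.const 0) (.const 0))
      (.loop 64 5 (.setNat 50 (.add (var 63) (.const 1)) (.const 0)
        (.add (.get 50 (.add (var 63) (.const 1)) (.const 0)) (.get 50 (var 63) (.const 0)))))))

/-- Store the number of codes. -/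
def codesProg (k : ℕ) : Prog :=
  .setNat 8 (.const 2) (.const 0) (.get 50 (.const (k + 1)) (.const 0))

/-- Compute the contribution of the vertex in `21` to the code of a set. -/
def digitProg (k : ℕ) : Prog :=
  .seq (ret (.get 50 (.const k) (.const 0))) (.loop 63 3
    (.ite (isOne 2 (var 63) (var 21)) (ret (.get 50 (var 63) (.const 0))) .skip))

/-- Initialize the table with the empty set. -/
def initProg (k : ℕ) : Prog :=
  .seq (assignRow 51 (.const 0) (digitProg k))
    (.seq (set 60 (.const 1)) (assignRow 62 (.const 0) (ret (var 21))))

theorem boundsProg_spec {s : State} (hn : s.nat 0 0 0 = n) (h8 : ∀ b, s.nat 8 b 0 = 0) (b : ℕ) :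
    ((boundsProg k).run s).nat 8 b 0 = if b = 0 then n else if b = 1 then 2 * n + 1 else
      if b = 3 then k else if b = 4 then k + 1 else if b = 5 then n + 1 else 0 := by
  simp only [boundsProg, run, State.setNat, NExp.eval, var, hn, h8, and_true, true_and]
  grind

/-- Multiplication by `n + 1` is carried out as `n + 1` additions of the previous power. -/
theorem powProg_spec {s : State} (h4 : s.nat 8 4 0 = k + 1) (h5 : s.nat 8 5 0 = n + 1) :
    ∀ i ≤ k + 1, (powProg.run s).nat 50 i 0 = (n + 1) ^ i := by
  rw [powProg, run_seq]
  generalize h1 : Prog.run (set 50 _) s = s1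
  have e1 : s1.nat 8 = s.nat 8 := by
    rw [← h1]
    exact run_nat (by decide) s
  have h0 : s1.nat 50 0 0 = 1 := by
    rw [← h1]
    exact State.setNat_nat_self
  rw [← h4, ← e1]
  refine loop_induct (s := s1) (fun m t => ∀ i ≤ m, t.nat 50 i 0 = (n + 1) ^ i) ?_ ?_
  · intro i hi
    obtain rfl := Nat.le_zero.1 hi
    rw [State.setNat_nat_of_ne (by decide), h0, pow_zero]
  intro m t hm hx hF hP i hi
  rw [State.setNat_nat_of_ne (by decide), run_seq]
  have hx' : (t.setNat 50 (m + 1) 0 0).nat 63 0 0 = m := hx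
  have h2 : Prog.run (.setNat 50 (.add (var 63) (.const 1)) (.const 0) (.const 0)) t =
      t.setNat 50 (m + 1) 0 0 := by
    simp only [run, NExp.eval, var, hx]
  have h8 : (t.setNat 50 (m + 1) 0 0).nat 8 5 0 = n + 1 := by
    rw [State.setNat_nat_of_ne (by decide), hF.1 8 (by decide), e1, h5]
  rw [h2]
  have key := loop_induct (x := 64) (b := 5) (c := .setNat 50 (.add (var 63) (.const 1)) (.const 0)
        (.add (.get 50 (.add (var 63) (.const 1)) (.const 0)) (.get 50 (var 63) (.const 0))))
    (s := t.setNat 50 (m + 1) 0 0) (fun j t' => t'.nat 50 (m + 1) 0 = j * (n + 1) ^ m ∧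
      ∀ i ≤ m, t'.nat 50 i 0 = (n + 1) ^ i) ?_ ?_
  · rw [h8] at key
    rcases Nat.le_succ_iff.1 hi with hi | rfl
    · exact key.2 i hi
    · rw [key.1, pow_succ, mul_comm]
  · refine ⟨by simp [State.setNat], fun i hi => ?_⟩
    rw [← hP i hi]
    simp only [State.setNat]
    rw [if_neg (by omega), if_neg (by omega)]
  · rintro j t' hj hy hF' ⟨a1, a2⟩
    have h63 : t'.nat 63 0 0 = m := by rw [hF'.1 63 (by decide), hx']
    rw [State.setNat_nat_of_ne (by decide)]
    simp only [run, NExp.eval, var, h63, a1, a2 m le_rfl]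
    refine ⟨by rw [State.setNat_nat_self, add_mul, one_mul], fun i hi => ?_⟩
    rw [← a2 i hi]
    simp only [State.setNat]
    rw [if_neg (by omega)]

/-- The default is the power for the class of ungrouped vertices. The groups are disjoint, so at
most one of them overwrites it. -/
theorem digitProg_spec {I : Input k n} {s : State} {v : Fin n} (h3 : s.nat 8 3 0 = k)
    (h2 : s.nat 2 = I.initial.nat 2) (h50 : ∀ i ≤ k, s.nat 50 i 0 = (n + 1) ^ i)
    (hv : s.nat 21 0 0 = v) :
    ((digitProg k).run s).nat 23 0 0 = (n + 1) ^ (I.cls v : ℕ) := by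
  rw [digitProg, run_seq]
  generalize h1 : Prog.run (ret _) s = s1
  have e1 : ∀ a ∉ [23], s1.nat a = s.nat a := fun a ha => by
    rw [← h1]
    exact run_nat ha s
  have h23 : s1.nat 23 0 0 = (n + 1) ^ k := by
    rw [← h1, ret_nat]
    exact h50 k le_rfl
  have key := loop_induct (x := 63) (b := 3) (c := .ite (isOne 2 (var 63) (var 21))
    (ret (.get 50 (var 63) (.const 0))) .skip) (s := s1)
    (fun m t => t.nat 23 0 0 = (n + 1) ^ (if (I.cls v : ℕ) < m then (I.cls v : ℕ) else k)) ?_ ?_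
  · rw [key, e1 8 (by decide), h3]
    congr 1
    have := (I.cls v).2
    split <;> omega
  · rw [State.setNat_nat_of_ne (by decide), h23]
    simp
  intro m t hm hx hF hP
  rw [e1 8 (by decide), h3] at hm
  have f2 : t.nat 2 = I.initial.nat 2 := by rw [hF.1 2 (by decide), e1 2 (by decide), h2]
  have f21 : t.nat 21 0 0 = v := by rw [hF.1 21 (by decide), e1 21 (by decide), hv]
  have f50 : t.nat 50 m 0 = (n + 1) ^ m := by
    rw [hF.1 50 (by decide), e1 50 (by decide), h50 m hm.le]
  have htest : (isOne 2 (var 63) (var 21)).Holds t ↔ (I.cls v : ℕ) = m := by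
    rw [isOne_holds]
    simp only [NExp.eval, var, hx, f21, f2]
    rw [I.initial_group ⟨m, hm⟩ v, ← I.cls_eq_castSucc_iff, Fin.ext_iff]
    rfl
  rw [State.setNat_nat_of_ne (by decide)]
  by_cases h : (I.cls v : ℕ) = m
  · rw [run_ite_pos (htest.2 h), ret_nat, if_pos (by omega), h, ← f50, ← hx]
    rfl
  · rw [run_ite_neg (mt htest.1 h), run, hP]
    congr 1
    split <;> split <;> omega

/-- The empty set has code zero and weight zero. Its row in the array `61` and its weight are
already correct in a cleared memory; only the flag and the identity as its matching have to be
written. -/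
theorem initProg_spec {I : Input k n} {s : State} (h0 : s.nat 8 0 0 = n)
    (h1 : s.nat 8 1 0 = 2 * n + 1) (h2 : s.nat 8 2 0 = (n + 1) ^ (k + 1)) (h3 : s.nat 8 3 0 = k)
    (h5 : s.nat 8 5 0 = n + 1) (h50 : ∀ i ≤ k, s.nat 50 i 0 = (n + 1) ^ i)
    (hs : ∀ a ∉ [8, 50, 63, 64], s.nat a = I.initial.nat a) (hs' : s.real = I.initial.real) :
    TableInv I ((initProg k).run s) ∧ Recorded I ∅ ((initProg k).run s) ∧
      ((initProg k).run s).nat 6 0 0 = 0 := by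
  rw [initProg]
  simp only [run_seq]
  generalize g1 : Prog.run (assignRow 51 _ _) s = s1
  generalize g2 : Prog.run (set 60 _) s1 = s2
  generalize g3 : Prog.run (assignRow 62 _ _) s2 = s3
  have e1 : ∀ a ∉ [51, 21, 22, 23, 63], s1.nat a = s.nat a := fun a ha => by
    rw [← g1]
    refine run_nat ?_ s
    simp [assignRow, digitProg, writes, ret, set] at ha ⊢
    tauto
  have e2 : ∀ a ∉ [60], s2.nat a = s1.nat a := fun a ha => by
    rw [← g2]
    exact run_nat ha s1
  have e3 : ∀ a ∉ [62, 21, 22, 23], s3.nat a = s2.nat a := fun a ha => by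
    rw [← g3]
    refine run_nat ?_ s2
    simp [assignRow, writes, ret, set] at ha ⊢
    tauto
  have e : ∀ a ∈ [1, 2, 3, 4, 5, 6, 8, 61], s3.nat a = s.nat a := fun a ha => by
    rw [e3 a (by revert a; decide), e2 a (by revert a; decide), e1 a (by revert a; decide)]
  have er : s3.real = I.initial.real := by
    rw [← hs', ← g3, ← g2, ← g1]
    funext a
    rw [run_real (by simp [assignRow, ret, set, writesReal]),
      run_real (by simp [set, writesReal]),
      run_real (by simp [assignRow, digitProg, ret, set, writesReal])]
  have e8 := e 8 (by decide)
  have h51 : ∀ v : Fin n, s3.nat 51 0 v = (n + 1) ^ (I.cls v : ℕ) := by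
    intro v
    rw [e3 51 (by decide), e2 51 (by decide), ← g1, assignRow_spec 0
      (fun j => if h : j < n then (n + 1) ^ (I.cls ⟨j, h⟩ : ℕ) else 0) (by decide) ?_
      (fun _ _ => rfl),
      if_pos ⟨rfl, by rw [h0]; exact v.2⟩, dif_pos v.2]
    · intro j t hj hx hF
      rw [h0] at hj
      rw [dif_pos hj]
      refine digitProg_spec ?_ ?_ ?_ hx
      · rw [hF.1 8 (by simp [digitProg, ret, set, writes]), h3]
      · rw [hF.1 2 (by simp [digitProg, ret, set, writes]), hs 2 (by decide)]
      · rw [hF.1 50 (by simp [digitProg, ret, set, writes])]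
        exact h50
    · simp [digitProg, ret, set, writes]
  have h60 : ∀ c, s3.nat 60 c 0 = if c = 0 then 1 else 0 := by
    intro c
    rw [e3 60 (by decide), ← g2]
    simp only [set, run, State.setNat, NExp.eval, true_and, and_true]
    rw [e1 60 (by decide), hs 60 (by decide)]
    rfl
  have h62 : ∀ v : Fin n, s3.nat 62 0 v = v := by
    intro v
    rw [← g3, assignRow_spec 0 (fun j => j) (by decide) (by decide) (fun _ _ => rfl),
      if_pos ⟨rfl, by rw [e2 8 (by decide), e1 8 (by decide), h0]; exact v.2⟩]
    intro j t hj hx hF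
    rw [ret_nat]
    exact hx
  have hload : Loaded I s3 := ⟨by rw [e8, h0], by rw [e8, h1], by rw [e8, h2], by rw [e8, h3],
    by rw [e8, h5], fun a ha => by
      rw [e a (by revert a; decide), hs a (by revert a; decide)], by rw [er], by rw [er], h51⟩
  have hr : s3.real 2 0 0 = 0 := by rw [er]; rfl
  have hcode : I.code ∅ = 0 := by simp [Input.code]
  refine ⟨⟨hload, fun c hc => ?_⟩, fun _ => ?_, ?_⟩
  · rw [h60] at hc
    obtain rfl : c = 0 := by
      by_contra h
      rw [if_neg h] at hc
      omega
    refine ⟨∅, id, ⟨fun _ => rfl, fun _ h => absurd rfl h⟩, by simp, fun v => ?_, h62, ?_, hcode⟩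
    · rw [e 61 (by decide), hs 61 (by decide)]
      simp [Input.initial]
    · rw [hr, Finset.sum_empty]
  · rw [hcode, h60, hr, Finset.sum_empty]
    exact ⟨rfl, le_rfl⟩
  · rw [e 6 (by decide), hs 6 (by decide)]
    rfl

/-! ## The running time -/

/-- A loop program halts within its time bound, with `B` iterations for every loop. -/
def Halts (c : Prog) (B : ℕ) (s : State) : Prop :=
  ∃ t ≤ c.cost.eval B, Exec c.toCmd s t (c.run s)

theorem Halts.seq {c d : Prog} {B : ℕ} {s : State} (hc : c.Halts B s) (hd : d.Halts B (c.run s)) :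
    (Prog.seq c d).Halts B s := by
  obtain ⟨t, ht, h⟩ := hc
  obtain ⟨t', ht', h'⟩ := hd
  exact ⟨t + t', by simp only [cost, Polynomial.eval_add]; omega, .seq h h'⟩

theorem Halts.setNat {a B : ℕ} {i j e : NExp} {s : State} : (Prog.setNat a i j e).Halts B s :=
  ⟨_, by simp [cost], .setNat a i j e s⟩

instance decidableWF : (c : Prog) → Decidable c.WF
  | skip => inferInstanceAs (Decidable True)
  | setNat _ _ _ _ => inferInstanceAs (Decidable True)
  | setReal _ _ _ _ => inferInstanceAs (Decidable True)
  | seq c d => @instDecidableAnd _ _ (decidableWF c) (decidableWF d)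
  | ite _ c d => @instDecidableAnd _ _ (decidableWF c) (decidableWF d)
  | loop x _ c =>
    have := decidableWF c
    inferInstanceAs (Decidable (x ≠ 8 ∧ x ∉ c.writes ∧ 8 ∉ c.writes ∧ c.WF))

theorem enumProg_wf {c : Prog} (hc : c.WF) (hw : ∀ a ∈ c.writes, a < 100 ∧ a ≠ 8) (m : ℕ) :
    (enumProg m c).WF := by
  induction m with
  | zero => exact hc
  | succ m ih =>
    have h : ∀ a, a = 8 ∨ a = 100 + m → a ∉ (enumProg m c).writes := fun a ha h => by
      rcases enumProg_writes h with h | h | h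
      · have := hw a h
        omega
      · omega
      · omega
    refine ⟨by omega, ?_, ?_, ⟨trivial, trivial⟩, ih, trivial, trivial⟩
    · simp only [writes, toggle, List.mem_append, List.mem_cons, List.not_mem_nil, or_false,
        not_or]
      exact ⟨by omega, h (100 + m) (Or.inr rfl), by omega⟩
    · simp only [writes, toggle, List.mem_append, List.mem_cons, List.not_mem_nil, or_false,
        not_or]
      exact ⟨by decide, h 8 (Or.inl rfl), by decide⟩

set_option maxRecDepth 10000 in
theorem testProg_wf : testProg.WF := by decide

theorem rowProg_wf (C : ℕ) : (rowProg C).WF :=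
  ⟨⟨by simp [assignRow, ret, set, writes, WF], enumProg_wf testProg_wf (fun a ha =>
    ⟨(testProg_writes a ha).1, fun h => (testProg_writes a ha).2.2 (by simp [h])⟩) C⟩, trivial⟩

theorem tableProg_writes {C a : ℕ} (h : a ∈ (tableProg C).writes) :
    a ∉ [1, 2, 3, 4, 5, 6, 8, 51] := by
  simp only [tableProg, writes, List.mem_cons] at h
  rcases h with rfl | rfl | h
  · decide
  · decide
  · have := rowProg_writes h
    simp only [List.mem_cons, List.not_mem_nil, or_false, not_or] at this ⊢
    omega

theorem tableProg_wf (C : ℕ) : (tableProg C).WF := by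
  have h : ∀ a ∈ [8, 52, 53], a ∉ (rowProg C).writes := fun a ha h =>
    rowProg_writes h (by clear h; revert a; decide)
  refine ⟨by decide, ?_, ?_, by decide, h 53 (by simp), h 8 (by simp), rowProg_wf C⟩
  · simp only [writes, List.mem_cons, not_or]
    exact ⟨by decide, h 52 (by simp)⟩
  · simp only [writes, List.mem_cons, not_or]
    exact ⟨by decide, h 8 (by simp)⟩

/-- The algorithm. -/
def solveProg (k C : ℕ) : Prog :=
  .seq (boundsProg k) (.seq powProg (.seq (codesProg k) (.seq (initProg k)
    (.seq (tableProg C) (.seq selectProg outputProg)))))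

/-- A bound for the number of iterations of every loop. -/
noncomputable def iterations (k : ℕ) : Polynomial ℕ :=
  -- The summands cover the number of search passes, the number of codes and the number of powers;
  -- the bounds `n`, `n + 1` and `k` are smaller than one of them.
  2 * .X + 1 + (.X + 1) ^ (k + 1) + .C (k + 1)

theorem eval_iterations (k n : ℕ) :
    (iterations k).eval n = 2 * n + 1 + (n + 1) ^ (k + 1) + (k + 1) := by
  simp [iterations]

-- The general time bound needs programs that leave the loop bounds alone. The two parts that write
-- bounds contain no loops and are treated separately; in particular the number of codes becomes
-- available only after the powers have been computed.
set_option maxRecDepth 10000 in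
theorem solveProg_halts (C : ℕ) (I : Input k n) :
    (solveProg k C).Halts ((iterations k).eval n) I.initial := by
  have hb := boundsProg_spec (k := k) (n := n) (s := I.initial) rfl fun _ => rfl
  rw [solveProg, eval_iterations]
  refine .seq (.seq .setNat (.seq .setNat (.seq .setNat (.seq .setNat .setNat)))) ?_
  generalize (boundsProg k).run I.initial = s1 at hb
  have hb1 : ∀ b, s1.nat 8 b 0 ≤ 2 * n + 1 + (n + 1) ^ (k + 1) + (k + 1) := fun b => by
    rw [hb]
    split_ifs <;> omega
  refine .seq (exec (by decide) (by decide) hb1) ?_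
  have hp := powProg_spec (k := k) (n := n) (s := s1) (hb 4) (hb 5) (k + 1) le_rfl
  have h8 : (powProg.run s1).nat 8 = s1.nat 8 := run_nat (by decide) s1
  generalize powProg.run s1 = s2 at hp h8
  refine .seq .setNat ?_
  have hb3 : ∀ b, ((codesProg k).run s2).nat 8 b 0 ≤
      2 * n + 1 + (n + 1) ^ (k + 1) + (k + 1) := fun b => by
    simp only [codesProg, run, State.setNat, NExp.eval, hp, h8, true_and, and_true]
    split_ifs
    · omega
    · exact hb1 b
  have hwf : (initProg k).WF := by simp [initProg, digitProg, assignRow, ret, set, WF, writes]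
  refine exec (c := .seq _ (.seq _ (.seq _ _))) ⟨hwf, tableProg_wf C, by decide, by decide⟩ ?_ hb3
  · have h1 : 8 ∉ (tableProg C).writes := fun h => tableProg_writes h (by decide)
    have h2 : 8 ∉ (initProg k).writes := by
      simp [initProg, digitProg, assignRow, ret, set, writes]
    have h3 : 8 ∉ (Prog.seq selectProg outputProg).writes := by decide
    rw [writes, List.mem_append, writes, List.mem_append]
    tauto

theorem exists_solveProg_spec (k : ℕ) :
    ∃ C, ∀ {n : ℕ} (I : Input k n), I.Answers ((solveProg k C).run I.initial) := by
  obtain ⟨C, hC⟩ := exists_tableProg_spec k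
  refine ⟨C, fun {n} I => ?_⟩
  rw [solveProg]
  simp only [run_seq]
  have hb := boundsProg_spec (k := k) (n := n) (s := I.initial) rfl fun _ => rfl
  generalize h1 : (boundsProg k).run I.initial = s1 at hb
  have hp := powProg_spec (k := k) (n := n) (s := s1) (hb 4) (hb 5)
  generalize h2 : powProg.run s1 = s2 at hp
  generalize h3 : (codesProg k).run s2 = s3
  have e1 : ∀ a ∉ [8], s1.nat a = I.initial.nat a := fun a ha => by
    rw [← h1]
    refine run_nat ?_ _
    simpa [boundsProg, writes] using ha
  have e2 : ∀ a ∉ [50, 63, 64], s2.nat a = s1.nat a := fun a ha => by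
    rw [← h2]
    refine run_nat ?_ _
    simp [powProg, writes, set] at ha ⊢
    tauto
  have e3 : ∀ a ∉ [8], s3.nat a = s2.nat a := fun a ha => by
    rw [← h3]
    exact run_nat ha _
  have h8 : ∀ b, s3.nat 8 b 0 = if b = 2 then (n + 1) ^ (k + 1) else s1.nat 8 b 0 := fun b => by
    rw [← h3, ← e2 8 (by decide)]
    simp only [codesProg, run, State.setNat, NExp.eval, hp _ le_rfl, true_and, and_true]
  have er : s3.real = I.initial.real := by
    rw [← h3, ← h2, ← h1]
    funext a
    rw [run_real (by simp [codesProg, writesReal]), run_real (by simp [powProg, set, writesReal]),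
      run_real (by simp [boundsProg, writesReal])]
  obtain ⟨a1, a2, a3⟩ := initProg_spec (I := I) (s := s3) (by rw [h8, hb]; rfl)
    (by rw [h8, hb]; rfl)
    (h8 2) (by rw [h8, hb]; rfl) (by rw [h8, hb]; rfl) (fun i hi => by
      rw [e3 50 (by decide), hp i (by omega)]) (fun a ha => by
      simp only [List.mem_cons, List.not_mem_nil, or_false, not_or] at ha
      rw [e3 a (by simp [ha]), e2 a (by simp [ha]), e1 a (by simp [ha])]) er
  obtain ⟨b1, b2⟩ := hC a1 a2
  refine outputProg_spec b1 b2 ?_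
  rw [run_nat (fun h => tableProg_writes h (by decide)), a3]

end Prog
end GroupFair

/-- For every constant number `k` of groups there are a program and a polynomial `p` such that on
every instance with `n` vertices the program halts within `p(n)` steps with a group-fair matching
of maximum total vertex weight, or reports that there is no group-fair matching. -/
theorem mainTheorem7 (k : ℕ) :
    ∃ (c : GroupFair.Cmd) (p : Polynomial ℕ), ∀ (n : ℕ) (I : GroupFair.Input k n),
      ∃ (t : ℕ) (s : GroupFair.State),
        GroupFair.Exec c I.initial t s ∧ t ≤ p.eval n ∧ I.Answers s := by
  obtain ⟨C, hC⟩ := GroupFair.Prog.exists_solveProg_spec k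
  -- The exchange bound `C` depends only on `k`, so the program and the polynomial are fixed before
  -- the instance. The time is a polynomial in the loop bounds, themselves polynomials in `n`.
  refine ⟨(GroupFair.Prog.solveProg k C).toCmd,
    (GroupFair.Prog.solveProg k C).cost.comp (GroupFair.Prog.iterations k), fun n I => ?_⟩
  obtain ⟨t, ht, h⟩ := GroupFair.Prog.solveProg_halts C I
  exact ⟨t, _, h, by rwa [Polynomial.eval_comp], hC I⟩
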